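/- Throughout, $k$ is a field of characteristic zero, $\otimes=\otimes_k$, $\tau(x\otimes y)=y\otimes x$, and $A$ is a finite-dimensional $k$-vector space with bilinear maps $\ast,\circ:A\times A\to A$ and linear maps $\vartheta,\theta:A\to A\otimes A$. Put $l(a)b=a\ast b$, $r(a)b=b\ast a$, $\hat l(a)b=a\circ b$, $\hat r(a)b=b\circ a$. **Pre-Poisson bialgebras.** $(A,\ast,\circ,\vartheta,\theta)$ is a *pre-Poisson bialgebra* if, for all $a,b,c\in A$: (1) (pre-Poisson algebra) $a\ast(b\ast c)=(a\ast b)\ast c+(b\ast a)\ast c$; $(a\circ b)\circ c-a\circ(b\circ c)=(b\circ a)\circ c-b\circ(a\circ c)$; $(a\circ b-b\circ a)\ast c=a\circ(b\ast c)-b\ast(a\circ c)$; $(a\ast b+b\ast a)\circ c=a\ast(b\circ c)+b\ast(a\circ c)$. (2) (pre-Poisson coalgebra) $(\vartheta\otimes\mathrm{id})\vartheta+(\tau\otimes\mathrm{id})(\vartheta\otimes\mathrm{id})\vartheta=(\mathrm{id}\otimes\vartheta)\vartheta$; $(\mathrm{id}\otimes\theta)\theta-(\tau\otimes\mathrm{id})(\mathrm{id}\otimes\theta)\theta=(\theta\otimes\mathrm{id})\theta-(\tau\otimes\mathrm{id})(\theta\otimes\mathrm{id})\theta$;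 $((\theta-\tau\theta)\otimes\mathrm{id})\vartheta=(\mathrm{id}\otimes\vartheta)\theta-(\tau\otimes\mathrm{id})(\mathrm{id}\otimes\theta)\vartheta$; $((\vartheta+\tau\vartheta)\otimes\mathrm{id})\theta=(\mathrm{id}\otimes\theta)\vartheta+(\tau\otimes\mathrm{id})(\mathrm{id}\otimes\theta)\vartheta$. (3) (Zinbiel bialgebra) $(\vartheta+\tau\vartheta)(a\ast b)=(\mathrm{id}\otimes r(b))\vartheta(a)+(l(a)\otimes\mathrm{id})\vartheta(b)+\tau((\mathrm{id}\otimes l(a))\vartheta(b))$; $\vartheta(a\ast b+b\ast a)=(l(a)\otimes\mathrm{id})\vartheta(b)+(\mathrm{id}\otimes l(b))\vartheta(a)+(\mathrm{id}\otimes r(b))\vartheta(a)$. (4) (pre-Lie bialgebra) $(\theta-\tau\theta)(a\circ b)=(\hat l(a)\otimes\mathrm{id}+\mathrm{id}\otimes\hat l(a))(\theta-\tau\theta)(b)+(\mathrm{id}\otimes\hat r(b))\theta(a)-(\hat r(b)\otimes\mathrm{id})\tau\theta(a)$; $\theta(a\circ b-b\circ a)=(\mathrm{id}\otimes(\hat r-\hat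 l)(b))\theta(a)+(\mathrm{id}\otimes(\hat l-\hat r)(a))\theta(b)+(\hat l(a)\otimes\mathrm{id})\theta(b)-(\hat l(b)\otimes\mathrm{id})\theta(a)$. (5) $\theta(a\ast b+b\ast a)=(\mathrm{id}\otimes(l+r)(b))\theta(a)+(\mathrm{id}\otimes(l+r)(a))\theta(b)-(\hat l(a)\otimes\mathrm{id})\vartheta(b)-(\hat l(b)\otimes\mathrm{id})\vartheta(a)$; $\vartheta(a\circ b-b\circ a)=(l(b)\otimes\mathrm{id}-\mathrm{id}\otimes(l+r)(b))\theta(a)+(\hat l(a)\otimes\mathrm{id}+\mathrm{id}\otimes(\hat l-\hat r)(a))\vartheta(b)$; $(\vartheta+\tau\vartheta)(a\circ b)=-(\mathrm{id}\otimes r(b))\theta(a)-(r(b)\otimes\mathrm{id})\tau\theta(a)+(\hat l(a)\otimes\mathrm{id}+\mathrm{id}\otimes\hat l(a))(\vartheta+\tau\vartheta)(b)$; $(\theta-\tau\theta)(a\ast b)=(\mathrm{id}\otimes r(b))\theta(a)+(\mathrm{id}\otimes l(a))(\theta-\tau\theta)(b)+(\hat r(b)\otimes\mathrm{id})\tau\vartheta(a)-(\hat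 l(a)\otimes\mathrm{id})(\vartheta+\tau\vartheta)(b)$. **Completed structures.** Let $\Gamma$ be an abelian group (for instance $\mathbb Z$). For $\Gamma$-graded spaces $U=\bigoplus U_i$, $V=\bigoplus V_j$ let $U\hat\otimes V=\prod_{i,j}U_i\otimes V_j$; $\hat\tau$, $f\hat\otimes g$ and threefold products are defined termwise on formal sums. A *completed comultiplication* on $V$ is a linear map $\Delta:V\to V\hat\otimes V$ such that for each $(i,j)$ the component $V\to V_i\otimes V_j$ of $\Delta$ vanishes on all but finitely many $V_p$; then $\Delta\hat\otimes\mathrm{id}$ and $\mathrm{id}\hat\otimes\Delta$ are well defined. A *completed Poisson bialgebra* $(P,\cdot,[-,-],\Delta,\delta)$ is a $\Gamma$-graded space $P=\bigoplus P_i$ with all $P_i$ finite-dimensional, bilinear operations with $P_iP_j\subseteq P_{i+j}$, $[P_i,P_j]\subseteq P_{i+j}$ making $P$ a Poisson algebra (commutative associative product, Lie bracket, Leibniz rule), and completed comultiplications $\Delta,\delta$ such that $\hat\tau\Delta=\Delta$, $(\Delta\hat\otimes\mathrm{id})\Delta=(\mathrm{id}\hat\otimes\Delta)\Delta$, $\hat\tau\delta=-\delta$,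 $(\mathrm{id}\hat\otimes\delta)\delta-(\hat\tau\hat\otimes\mathrm{id})(\mathrm{id}\hat\otimes\delta)\delta=(\delta\hat\otimes\mathrm{id})\delta$, $(\mathrm{id}\hat\otimes\Delta)\delta=(\delta\hat\otimes\mathrm{id})\Delta+(\hat\tau\hat\otimes\mathrm{id})(\mathrm{id}\hat\otimes\delta)\Delta$, and, with $u(p)q=pq$ and $\mathrm{ad}(p)q=[p,q]$, for all $p,q\in P$, $\Delta(pq)=(u(q)\hat\otimes\mathrm{id})\Delta(p)+(\mathrm{id}\hat\otimes u(p))\Delta(q)$; $\delta([p,q])=(\mathrm{ad}(p)\hat\otimes\mathrm{id}+\mathrm{id}\hat\otimes\mathrm{ad}(p))\delta(q)-(\mathrm{ad}(q)\hat\otimes\mathrm{id}+\mathrm{id}\hat\otimes\mathrm{ad}(q))\delta(p)$; $\Delta([p,q])=(\mathrm{ad}(p)\hat\otimes\mathrm{id}+\mathrm{id}\hat\otimes\mathrm{ad}(p))\Delta(q)+(u(q)\hat\otimes\mathrm{id}-\mathrm{id}\hat\otimes u(q))\delta(p)$; $\delta(pq)=(u(p)\hat\otimes\mathrm{id})\delta(q)+(u(q)\hat\otimes\mathrm{id})\delta(p)+(\mathrm{id}\hat\otimes\mathrm{ad}(p))\Delta(q)+(\mathrm{id}\hat\otimes\mathrm{ad}(q))\Delta(p)$.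 **Quadratic graded perm algebras.** A *quadratic $\Gamma$-graded perm algebra* $(B=\bigoplus_{i\in\Gamma}B_i,\diamond,\omega)$ consists of finite-dimensional $B_i$, a bilinear $\diamond$ with $B_i\diamond B_j\subseteq B_{i+j}$ and $x\diamond(y\diamond z)=(x\diamond y)\diamond z=(y\diamond x)\diamond z$, and an antisymmetric nondegenerate bilinear form $\omega$ with $\omega(x\diamond y,z)=\omega(x,y\diamond z-z\diamond y)$ for which there is $m\in\Gamma$ with $\omega(B_i,B_j)=0$ whenever $i+j+m\ne0$. Then there is a unique linear map $\nu_\omega:B\to B\hat\otimes B$ with $\hat\omega(\nu_\omega(x),y\otimes z)=-\omega(x,y\diamond z)$ for all $x,y,z\in B$, where $\hat\omega(\sum x'\otimes x'',y\otimes z)=\sum\omega(x',y)\omega(x'',z)$. **Induced operations.** On $A\otimes B$, graded by $(A\otimes B)_i=A\otimes B_i$, put $(a\otimes b)(a'\otimes b')=(a\ast a')\otimes(b\diamond b')+(a'\ast a)\otimes(b'\diamond b)$, $[a\otimes b,a'\otimes b']=(a\circ a')\otimes(b\diamond b')-(a'\circ a)\otimes(b'\diamond b)$, $\Delta(a\otimes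 b)=(\mathrm{id}+\hat\tau)(\vartheta(a)\bullet\nu_\omega(b))$, $\delta(a\otimes b)=(\mathrm{id}-\hat\tau)(\theta(a)\bullet\nu_\omega(b))$, where $(\sum a_1\otimes a_2)\bullet(\sum b_1\otimes b_2)=\sum(a_1\otimes b_1)\otimes(a_2\otimes b_2)$. **Theorem.** (i) If $(A,\ast,\circ,\vartheta,\theta)$ is a finite-dimensional pre-Poisson bialgebra and $(B,\diamond,\omega)$ is a quadratic $\Gamma$-graded perm algebra, for any abelian group $\Gamma$ (in particular for $\Gamma=\mathbb Z$), then $(A\otimes B,\cdot,[-,-],\Delta,\delta)$ is a completed Poisson bialgebra. (ii) Let $B=\{f_1\partial_1+f_2\partial_2\mid f_1,f_2\in k[x_1^{\pm1},x_2^{\pm1}]\}$ with $(f_1\partial_1+f_2\partial_2)\diamond(g_1\partial_1+g_2\partial_2)=(x_1f_1+x_2f_2)(g_1\partial_1+g_2\partial_2)$, with $\omega(f_1\partial_1+f_2\partial_2,g_1\partial_1+g_2\partial_2)$ the constant coefficient of $f_2g_1-f_1g_2$, and with the $\mathbb Z^2$-grading in which $x_1^{n_1}x_2^{n_2}\partial_1$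 has degree $(n_1+1,n_2)$ and $x_1^{n_1}x_2^{n_2}\partial_2$ has degree $(n_1,n_2+1)$. This is a quadratic $\mathbb Z^2$-graded perm algebra. For any finite-dimensional $A$ with bilinear $\ast,\circ$ and linear $\vartheta,\theta$ as above, $(A\otimes B,\cdot,[-,-],\Delta,\delta)$ is a completed Poisson bialgebra if and only if $(A,\ast,\circ,\vartheta,\theta)$ is a pre-Poisson bialgebra. -/

import Mathlib

open scoped TensorProduct DirectSum

namespace PrePoissonAffinization

/-! ### Pre-Poisson bialgebras -/

section FiniteSide

variable {k : Type*} [Field k] {A : Type*} [AddCommGroup A] [Module k A]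

/-- `a ∗ (b ∗ c) = (a ∗ b) ∗ c + (b ∗ a) ∗ c`. -/
def IsZinbielAlgebra (ast : A →ₗ[k] A →ₗ[k] A) : Prop :=
  ∀ a b c : A, ast a (ast b c) = ast (ast a b) c + ast (ast b a) c

/-- `(a ∘ b) ∘ c - a ∘ (b ∘ c) = (b ∘ a) ∘ c - b ∘ (a ∘ c)`. -/
def IsPreLieAlgebra (circ : A →ₗ[k] A →ₗ[k] A) : Prop :=
  ∀ a b c : A,
    circ (circ a b) c - circ a (circ b c) = circ (circ b a) c - circ b (circ a c)

/-- Pre-Poisson algebras `(A, ∗, ∘)`. -/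
structure IsPrePoissonAlgebra (ast circ : A →ₗ[k] A →ₗ[k] A) : Prop where
  zinbiel : IsZinbielAlgebra ast
  preLie : IsPreLieAlgebra circ
  compat₁ : ∀ a b c : A,
    ast (circ a b - circ b a) c = circ a (ast b c) - ast b (circ a c)
  compat₂ : ∀ a b c : A,
    circ (ast a b + ast b a) c = ast a (circ b c) + ast b (circ a c)

/-- The flip `τ` of `A ⊗ A`. -/
noncomputable def tau : A ⊗[k] A →ₗ[k] A ⊗[k] A := (TensorProduct.comm k A A).toLinearMap

/-- `τ ⊗ id` on `A ⊗ A ⊗ A`. -/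
noncomputable def tauId : (A ⊗[k] A) ⊗[k] A →ₗ[k] (A ⊗[k] A) ⊗[k] A := tau.rTensor A

/-- `(Δ₁ ⊗ id) Δ₂`. -/
noncomputable def comulLeft (Δ₁ Δ₂ : A →ₗ[k] A ⊗[k] A) : A →ₗ[k] (A ⊗[k] A) ⊗[k] A :=
  Δ₁.rTensor A ∘ₗ Δ₂

/-- `(id ⊗ Δ₁) Δ₂`, with values in `(A ⊗ A) ⊗ A` through the associator. -/
noncomputable def comulRight (Δ₁ Δ₂ : A →ₗ[k] A ⊗[k] A) : A →ₗ[k] (A ⊗[k] A) ⊗[k] A :=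
  (TensorProduct.assoc k A A A).symm.toLinearMap ∘ₗ Δ₁.lTensor A ∘ₗ Δ₂

/-- `(ϑ ⊗ id) ϑ + (τ ⊗ id) (ϑ ⊗ id) ϑ = (id ⊗ ϑ) ϑ`. -/
def IsZinbielCoalgebra (ϑ : A →ₗ[k] A ⊗[k] A) : Prop :=
  ∀ a : A, comulLeft ϑ ϑ a + tauId (comulLeft ϑ ϑ a) = comulRight ϑ ϑ a

/-- `(id ⊗ θ) θ - (τ ⊗ id) (id ⊗ θ) θ = (θ ⊗ id) θ - (τ ⊗ id) (θ ⊗ id) θ`. -/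
def IsPreLieCoalgebra (θ : A →ₗ[k] A ⊗[k] A) : Prop :=
  ∀ a : A, comulRight θ θ a - tauId (comulRight θ θ a) =
    comulLeft θ θ a - tauId (comulLeft θ θ a)

/-- Pre-Poisson coalgebras `(A, ϑ, θ)`. -/
structure IsPrePoissonCoalgebra (ϑ θ : A →ₗ[k] A ⊗[k] A) : Prop where
  zinbiel : IsZinbielCoalgebra ϑ
  preLie : IsPreLieCoalgebra θ
  compat₁ : ∀ a : A,
    comulLeft (θ - tau ∘ₗ θ) ϑ a = comulRight ϑ θ a - tauId (comulRight θ ϑ a)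
  compat₂ : ∀ a : A,
    comulLeft (ϑ + tau ∘ₗ ϑ) θ a = comulRight θ ϑ a + tauId (comulRight θ ϑ a)

/-- Zinbiel bialgebras `(A, ∗, ϑ)`. Left multiplication by `a` is `ast a`, right multiplication
by `a` is `ast.flip a`; `f.rTensor A` is `f ⊗ id` and `f.lTensor A` is `id ⊗ f`. -/
structure IsZinbielBialgebra (ast : A →ₗ[k] A →ₗ[k] A) (ϑ : A →ₗ[k] A ⊗[k] A) : Prop where
  algebra : IsZinbielAlgebra ast
  coalgebra : IsZinbielCoalgebra ϑ
  compat₁ : ∀ a b : A,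
    ϑ (ast a b) + tau (ϑ (ast a b)) =
      (ast.flip b).lTensor A (ϑ a) + (ast a).rTensor A (ϑ b) + tau ((ast a).lTensor A (ϑ b))
  compat₂ : ∀ a b : A,
    ϑ (ast a b + ast b a) =
      (ast a).rTensor A (ϑ b) + (ast b).lTensor A (ϑ a) + (ast.flip b).lTensor A (ϑ a)

/-- Pre-Lie bialgebras `(A, ∘, θ)`. -/
structure IsPreLieBialgebra (circ : A →ₗ[k] A →ₗ[k] A) (θ : A →ₗ[k] A ⊗[k] A) : Prop where
  algebra : IsPreLieAlgebra circ
  coalgebra : IsPreLieCoalgebra θ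
  compat₁ : ∀ a b : A,
    (θ - tau ∘ₗ θ) (circ a b) - (circ a).rTensor A ((θ - tau ∘ₗ θ) b)
      - (circ a).lTensor A ((θ - tau ∘ₗ θ) b) - (circ.flip b).lTensor A (θ a)
      + (circ.flip b).rTensor A (tau (θ a)) = 0
  compat₂ : ∀ a b : A,
    θ (circ a b - circ b a) - (circ.flip b - circ b).lTensor A (θ a)
      - (circ a - circ.flip a).lTensor A (θ b) - (circ a).rTensor A (θ b)
      + (circ b).rTensor A (θ a) = 0

/-- Pre-Poisson bialgebras `(A, ∗, ∘, ϑ, θ)`. -/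
structure IsPrePoissonBialgebra (ast circ : A →ₗ[k] A →ₗ[k] A) (ϑ θ : A →ₗ[k] A ⊗[k] A) :
    Prop where
  algebra : IsPrePoissonAlgebra ast circ
  coalgebra : IsPrePoissonCoalgebra ϑ θ
  zinbiel : IsZinbielBialgebra ast ϑ
  preLie : IsPreLieBialgebra circ θ
  compat₁ : ∀ a b : A,
    θ (ast a b + ast b a) =
      (ast b + ast.flip b).lTensor A (θ a) + (ast a + ast.flip a).lTensor A (θ b)
        - (circ a).rTensor A (ϑ b) - (circ b).rTensor A (ϑ a)
  compat₂ : ∀ a b : A,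
    ϑ (circ a b - circ b a) =
      ((ast b).rTensor A - (ast b + ast.flip b).lTensor A) (θ a)
        + ((circ a).rTensor A + (circ a - circ.flip a).lTensor A) (ϑ b)
  compat₃ : ∀ a b : A,
    (ϑ + tau ∘ₗ ϑ) (circ a b) =
      -(ast.flip b).lTensor A (θ a) - (ast.flip b).rTensor A (tau (θ a))
        + ((circ a).rTensor A + (circ a).lTensor A) ((ϑ + tau ∘ₗ ϑ) b)
  compat₄ : ∀ a b : A,
    (θ - tau ∘ₗ θ) (ast a b) =
      (ast.flip b).lTensor A (θ a) + (ast a).lTensor A ((θ - tau ∘ₗ θ) b)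
        + (circ.flip b).rTensor A (tau (ϑ a)) - (circ a).rTensor A ((ϑ + tau ∘ₗ ϑ) b)

end FiniteSide

/-! ### Graded spaces and completed tensor products -/

section Completed

variable {k : Type*} [Field k] {Γ : Type*}
variable {U U' V V' : Type*} [AddCommGroup U] [Module k U] [AddCommGroup U'] [Module k U']
  [AddCommGroup V] [Module k V] [AddCommGroup V'] [Module k V']

/-- The completed tensor product `∏ i j, U i ⊗ V j` of two graded vector spaces. -/
abbrev CompletedTensor (𝒰 : Γ → Submodule k U) (𝒱 : Γ → Submodule k V) : Type _ :=
  ∀ i j : Γ, 𝒰 i ⊗[k] 𝒱 j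

/-- The threefold completed tensor power `∏ i j l, (V i ⊗ V j) ⊗ V l`. -/
abbrev CompletedTensor₃ (𝒱 : Γ → Submodule k V) : Type _ :=
  ∀ i j l : Γ, (𝒱 i ⊗[k] 𝒱 j) ⊗[k] 𝒱 l

/-- The component of degree `(i, j)`. -/
def CompletedTensor.component (𝒰 : Γ → Submodule k U) (𝒱 : Γ → Submodule k V) (i j : Γ) :
    CompletedTensor 𝒰 𝒱 →ₗ[k] 𝒰 i ⊗[k] 𝒱 j :=
  LinearMap.proj j ∘ₗ LinearMap.proj i

/-- The projection of a graded vector space onto its component of degree `i`. -/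
def gradedProj [DecidableEq Γ] (𝒱 : Γ → Submodule k V) [DirectSum.Decomposition 𝒱] (i : Γ) :
    V →ₗ[k] 𝒱 i :=
  DirectSum.component k Γ (fun i => 𝒱 i) i ∘ₗ (DirectSum.decomposeLinearEquiv 𝒱).toLinearMap

/-- The map `f ⊗̂ g`, computed degree by degree: its component of degree `(i, j)` is the sum over
all `(p, q)` of the degree `(i, j)` part of `(f ⊗ g)` applied to the `(p, q)` component.
It is used when only finitely many `(p, q)` contribute to each `(i, j)`, for instance when
`f` and `g` are multiplication operators of a graded algebra or identities. -/
noncomputable def hatMap [DecidableEq Γ]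
    (𝒰 : Γ → Submodule k U) (𝒱 : Γ → Submodule k V)
    (𝒰' : Γ → Submodule k U') [DirectSum.Decomposition 𝒰']
    (𝒱' : Γ → Submodule k V') [DirectSum.Decomposition 𝒱']
    (f : U →ₗ[k] U') (g : V →ₗ[k] V') (X : CompletedTensor 𝒰 𝒱) : CompletedTensor 𝒰' 𝒱' :=
  fun i j => ∑ᶠ p : Γ × Γ,
    TensorProduct.map (gradedProj 𝒰' i ∘ₗ f ∘ₗ (𝒰 p.1).subtype)
      (gradedProj 𝒱' j ∘ₗ g ∘ₗ (𝒱 p.2).subtype) (X p.1 p.2)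

/-- The completed flip `τ̂`. -/
noncomputable def tauHat (𝒱 : Γ → Submodule k V) :
    CompletedTensor 𝒱 𝒱 →ₗ[k] CompletedTensor 𝒱 𝒱 :=
  LinearMap.pi fun i => LinearMap.pi fun j =>
    (TensorProduct.comm k (𝒱 j) (𝒱 i)).toLinearMap ∘ₗ CompletedTensor.component 𝒱 𝒱 j i

/-- The operator `id + τ̂`. -/
noncomputable def idAddTauHat (𝒱 : Γ → Submodule k V) :
    CompletedTensor 𝒱 𝒱 →ₗ[k] CompletedTensor 𝒱 𝒱 :=
  LinearMap.id + tauHat 𝒱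

/-- The operator `id - τ̂`. -/
noncomputable def idSubTauHat (𝒱 : Γ → Submodule k V) :
    CompletedTensor 𝒱 𝒱 →ₗ[k] CompletedTensor 𝒱 𝒱 :=
  LinearMap.id - tauHat 𝒱

lemma idAddTauHat_apply (𝒱 : Γ → Submodule k V) (X : CompletedTensor 𝒱 𝒱) (i j : Γ) :
    idAddTauHat 𝒱 X i j = X i j + TensorProduct.comm k (𝒱 j) (𝒱 i) (X j i) := rfl

lemma idSubTauHat_apply (𝒱 : Γ → Submodule k V) (X : CompletedTensor 𝒱 𝒱) (i j : Γ) :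
    idSubTauHat 𝒱 X i j = X i j - TensorProduct.comm k (𝒱 j) (𝒱 i) (X j i) := rfl

/-- `τ̂ ⊗̂ id` on the threefold completed tensor power. -/
noncomputable def tauHatId (𝒱 : Γ → Submodule k V) (Y : CompletedTensor₃ 𝒱) :
    CompletedTensor₃ 𝒱 :=
  fun i j l => (TensorProduct.comm k (𝒱 j) (𝒱 i)).toLinearMap.rTensor (𝒱 l) (Y j i l)

/-- A linear map `V → V ⊗̂ V` whose component of each degree `(i, j)` vanishes on all but finitely
many of the `V p`. This makes `Δ ⊗̂ id` and `id ⊗̂ Δ` well defined on `V ⊗̂ V`. -/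
def IsCompletedComul (𝒱 : Γ → Submodule k V) (Δ : V →ₗ[k] CompletedTensor 𝒱 𝒱) : Prop :=
  ∀ i j : Γ, {p : Γ | ∃ v ∈ 𝒱 p, Δ v i j ≠ 0}.Finite

/-- `(Δ ⊗̂ id) X`. -/
noncomputable def comulHatId (𝒱 : Γ → Submodule k V) (Δ : V →ₗ[k] CompletedTensor 𝒱 𝒱)
    (X : CompletedTensor 𝒱 𝒱) : CompletedTensor₃ 𝒱 :=
  fun i j l => ∑ᶠ p : Γ,
    (CompletedTensor.component 𝒱 𝒱 i j ∘ₗ Δ ∘ₗ (𝒱 p).subtype).rTensor (𝒱 l) (X p l)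

/-- `(id ⊗̂ Δ) X`. -/
noncomputable def idHatComul (𝒱 : Γ → Submodule k V) (Δ : V →ₗ[k] CompletedTensor 𝒱 𝒱)
    (X : CompletedTensor 𝒱 𝒱) : CompletedTensor₃ 𝒱 :=
  fun i j l => ∑ᶠ p : Γ, (TensorProduct.assoc k (𝒱 i) (𝒱 j) (𝒱 l)).symm
    ((CompletedTensor.component 𝒱 𝒱 j l ∘ₗ Δ ∘ₗ (𝒱 p).subtype).lTensor (𝒱 i) (X i p))

end Completed

/-! ### Completed Poisson bialgebras -/

section CompletedPoisson

variable {k : Type*} [Field k] {Γ : Type*} [AddCommGroup Γ]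
variable {P : Type*} [AddCommGroup P] [Module k P]

/-- The components are finite-dimensional and `P i * P j ⊆ P (i + j)`. -/
structure IsGradedProduct (𝒢 : Γ → Submodule k P) (mul : P →ₗ[k] P →ₗ[k] P) : Prop where
  finite : ∀ i, FiniteDimensional k (𝒢 i)
  mul_mem : ∀ i j, ∀ x ∈ 𝒢 i, ∀ y ∈ 𝒢 j, mul x y ∈ 𝒢 (i + j)

/-- Graded commutative associative algebras. -/
structure IsGradedCommAssoc (𝒢 : Γ → Submodule k P) (mul : P →ₗ[k] P →ₗ[k] P) : Prop where
  graded : IsGradedProduct 𝒢 mul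
  comm : ∀ x y, mul x y = mul y x
  assoc : ∀ x y z, mul (mul x y) z = mul x (mul y z)

/-- Graded Lie algebras. -/
structure IsGradedLie (𝒢 : Γ → Submodule k P) (br : P →ₗ[k] P →ₗ[k] P) : Prop where
  graded : IsGradedProduct 𝒢 br
  self : ∀ x, br x x = 0
  jacobi : ∀ x y z, br x (br y z) + br y (br z x) + br z (br x y) = 0

/-- Graded Poisson algebras. -/
structure IsGradedPoisson (𝒢 : Γ → Submodule k P) (mul br : P →ₗ[k] P →ₗ[k] P) : Prop where
  commAssoc : IsGradedCommAssoc 𝒢 mul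
  lie : IsGradedLie 𝒢 br
  leibniz : ∀ x y z, br x (mul y z) = mul (br x y) z + mul y (br x z)

/-- Completed cocommutative coassociative coalgebras. -/
structure IsCompletedCocommCoassoc (𝒢 : Γ → Submodule k P)
    (Δ : P →ₗ[k] CompletedTensor 𝒢 𝒢) : Prop where
  comul : IsCompletedComul 𝒢 Δ
  cocomm : ∀ x, tauHat 𝒢 (Δ x) = Δ x
  coassoc : ∀ x, comulHatId 𝒢 Δ (Δ x) = idHatComul 𝒢 Δ (Δ x)

/-- Completed Lie coalgebras. -/
structure IsCompletedLieCoalgebra (𝒢 : Γ → Submodule k P)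
    (δ : P →ₗ[k] CompletedTensor 𝒢 𝒢) : Prop where
  comul : IsCompletedComul 𝒢 δ
  coantisymm : ∀ x, tauHat 𝒢 (δ x) = -δ x
  cojacobi : ∀ x, idHatComul 𝒢 δ (δ x) - tauHatId 𝒢 (idHatComul 𝒢 δ (δ x)) =
    comulHatId 𝒢 δ (δ x)

/-- Completed Poisson coalgebras. -/
structure IsCompletedPoissonCoalgebra (𝒢 : Γ → Submodule k P)
    (Δ δ : P →ₗ[k] CompletedTensor 𝒢 𝒢) : Prop where
  cocommCoassoc : IsCompletedCocommCoassoc 𝒢 Δ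
  lie : IsCompletedLieCoalgebra 𝒢 δ
  coleibniz : ∀ x, idHatComul 𝒢 Δ (δ x) =
    comulHatId 𝒢 δ (Δ x) + tauHatId 𝒢 (idHatComul 𝒢 δ (Δ x))

variable [DecidableEq Γ]

/-- The operator `f ⊗̂ id` on `P ⊗̂ P`. -/
noncomputable def leftOp (𝒢 : Γ → Submodule k P) [DirectSum.Decomposition 𝒢] (f : P →ₗ[k] P)
    (X : CompletedTensor 𝒢 𝒢) : CompletedTensor 𝒢 𝒢 :=
  hatMap 𝒢 𝒢 𝒢 𝒢 f LinearMap.id X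

/-- The operator `id ⊗̂ f` on `P ⊗̂ P`. -/
noncomputable def rightOp (𝒢 : Γ → Submodule k P) [DirectSum.Decomposition 𝒢] (f : P →ₗ[k] P)
    (X : CompletedTensor 𝒢 𝒢) : CompletedTensor 𝒢 𝒢 :=
  hatMap 𝒢 𝒢 𝒢 𝒢 LinearMap.id f X

/-- Completed infinitesimal bialgebras. -/
structure IsCompletedInfinitesimalBialgebra (𝒢 : Γ → Submodule k P)
    [DirectSum.Decomposition 𝒢] (mul : P →ₗ[k] P →ₗ[k] P)
    (Δ : P →ₗ[k] CompletedTensor 𝒢 𝒢) : Prop where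
  algebra : IsGradedCommAssoc 𝒢 mul
  coalgebra : IsCompletedCocommCoassoc 𝒢 Δ
  compat : ∀ x y, Δ (mul x y) = leftOp 𝒢 (mul y) (Δ x) + rightOp 𝒢 (mul x) (Δ y)

/-- Completed Lie bialgebras. -/
structure IsCompletedLieBialgebra (𝒢 : Γ → Submodule k P)
    [DirectSum.Decomposition 𝒢] (br : P →ₗ[k] P →ₗ[k] P)
    (δ : P →ₗ[k] CompletedTensor 𝒢 𝒢) : Prop where
  algebra : IsGradedLie 𝒢 br
  coalgebra : IsCompletedLieCoalgebra 𝒢 δ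
  compat : ∀ x y, δ (br x y) =
    (leftOp 𝒢 (br x) (δ y) + rightOp 𝒢 (br x) (δ y))
      - (leftOp 𝒢 (br y) (δ x) + rightOp 𝒢 (br y) (δ x))

/-- Completed Poisson bialgebras `(P, ·, [-,-], Δ, δ)`. -/
structure IsCompletedPoissonBialgebra (𝒢 : Γ → Submodule k P)
    [DirectSum.Decomposition 𝒢] (mul br : P →ₗ[k] P →ₗ[k] P)
    (Δ δ : P →ₗ[k] CompletedTensor 𝒢 𝒢) : Prop where
  algebra : IsGradedPoisson 𝒢 mul br
  coalgebra : IsCompletedPoissonCoalgebra 𝒢 Δ δ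
  infinitesimal : IsCompletedInfinitesimalBialgebra 𝒢 mul Δ
  lie : IsCompletedLieBialgebra 𝒢 br δ
  compat₁ : ∀ x y, Δ (br x y) =
    (leftOp 𝒢 (br x) (Δ y) + rightOp 𝒢 (br x) (Δ y))
      + (leftOp 𝒢 (mul y) (δ x) - rightOp 𝒢 (mul y) (δ x))
  compat₂ : ∀ x y, δ (mul x y) =
    leftOp 𝒢 (mul x) (δ y) + leftOp 𝒢 (mul y) (δ x)
      + rightOp 𝒢 (br x) (Δ y) + rightOp 𝒢 (br y) (Δ x)

end CompletedPoisson

/-! ### Quadratic graded perm algebras and the coproduct `ν_ω` -/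

section Perm

variable {k : Type*} [Field k] {Γ : Type*} [AddCommGroup Γ]
variable {B : Type*} [AddCommGroup B] [Module k B]

/-- Graded perm algebras. -/
structure IsGradedPerm (ℬ : Γ → Submodule k B) (dia : B →ₗ[k] B →ₗ[k] B) : Prop where
  graded : IsGradedProduct ℬ dia
  assoc : ∀ x y z, dia x (dia y z) = dia (dia x y) z
  perm : ∀ x y z, dia (dia x y) z = dia (dia y x) z

/-- Quadratic graded perm algebras: `ω` is antisymmetric, invariant, nondegenerate and graded. -/
structure IsQuadraticGradedPerm (ℬ : Γ → Submodule k B) (dia : B →ₗ[k] B →ₗ[k] B)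
    (ω : B →ₗ[k] B →ₗ[k] k) : Prop where
  perm : IsGradedPerm ℬ dia
  antisymm : ∀ x y, ω x y = -ω y x
  invariant : ∀ x y z, ω (dia x y) z = ω x (dia y z - dia z y)
  nondegenerate : ∀ x, (∀ y, ω x y = 0) → x = 0
  graded : ∃ m : Γ, ∀ i j, i + j + m ≠ 0 → ∀ x ∈ ℬ i, ∀ y ∈ ℬ j, ω x y = 0

/-- The form `x ⊗ x' ↦ ω(x, y) ω(x', z)` on `B i ⊗ B j`. -/
noncomputable def omegaPair (ℬ : Γ → Submodule k B) (ω : B →ₗ[k] B →ₗ[k] k) (y z : B) (i j : Γ) :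
    ℬ i ⊗[k] ℬ j →ₗ[k] k :=
  LinearMap.mul' k k ∘ₗ
    TensorProduct.map (ω.flip y ∘ₗ (ℬ i).subtype) (ω.flip z ∘ₗ (ℬ j).subtype)

/-- The induced form `ω̂(X, y ⊗ z) = ∑ ω(x, y) ω(x', z)` for `X = ∑ x ⊗ x'` in `B ⊗̂ B`. For a
graded nondegenerate `ω`, only finitely many degrees contribute. -/
noncomputable def omegaHat (ℬ : Γ → Submodule k B) (ω : B →ₗ[k] B →ₗ[k] k)
    (X : CompletedTensor ℬ ℬ) (y z : B) : k :=
  ∑ᶠ p : Γ × Γ, omegaPair ℬ ω y z p.1 p.2 (X p.1 p.2)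

variable [DecidableEq Γ]

lemma finite_pairing_support {ℬ : Γ → Submodule k B} [DirectSum.Decomposition ℬ]
    {ω : B →ₗ[k] B →ₗ[k] k} {m : Γ}
    (hm : ∀ i j, i + j + m ≠ 0 → ∀ x ∈ ℬ i, ∀ y ∈ ℬ j, ω x y = 0) (y : B) :
    {i : Γ | ω.flip y ∘ₗ (ℬ i).subtype ≠ 0}.Finite := by
  induction y using DirectSum.Decomposition.inductionOn ℬ with
  | zero => simp
  | @homogeneous p y =>
    refine (Set.finite_singleton (-m - p)).subset fun i hi => ?_
    by_contra hne
    apply hi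
    ext x
    refine hm i p (fun h => hne ?_) x x.2 y y.2
    simp only [Set.mem_singleton_iff]
    rw [← sub_eq_zero, ← h]; abel
  | add y y' h h' =>
    refine (h.union h').subset fun i hi => ?_
    by_contra hne
    simp only [Set.mem_union, Set.mem_ofPred_eq, not_or, not_not] at hne
    apply hi
    rw [map_add, LinearMap.add_comp, hne.1, hne.2, add_zero]

lemma finite_omegaPair_support {ℬ : Γ → Submodule k B} [DirectSum.Decomposition ℬ]
    {ω : B →ₗ[k] B →ₗ[k] k} {m : Γ}
    (hm : ∀ i j, i + j + m ≠ 0 → ∀ x ∈ ℬ i, ∀ y ∈ ℬ j, ω x y = 0)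
    (X : CompletedTensor ℬ ℬ) (y z : B) :
    (Function.support fun p : Γ × Γ => omegaPair ℬ ω y z p.1 p.2 (X p.1 p.2)).Finite := by
  refine ((finite_pairing_support hm y).prod (finite_pairing_support hm z)).subset
    fun p hp => ?_
  by_contra hne
  simp only [Set.mem_prod, Set.mem_ofPred_eq, not_and_or, not_not] at hne
  apply hp
  rcases hne with h | h <;> simp [omegaPair, h]

lemma omegaHat_add_left {ℬ : Γ → Submodule k B} [DirectSum.Decomposition ℬ]
    {ω : B →ₗ[k] B →ₗ[k] k} {m : Γ}
    (hm : ∀ i j, i + j + m ≠ 0 → ∀ x ∈ ℬ i, ∀ y ∈ ℬ j, ω x y = 0)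
    (X : CompletedTensor ℬ ℬ) (y y' z : B) :
    omegaHat ℬ ω X (y + y') z = omegaHat ℬ ω X y z + omegaHat ℬ ω X y' z := by
  unfold omegaHat
  rw [← finsum_add_distrib (finite_omegaPair_support hm X y z)
    (finite_omegaPair_support hm X y' z)]
  refine finsum_congr fun p => ?_
  simp [omegaPair, LinearMap.add_comp, TensorProduct.map_add_left]

lemma omegaHat_add_right {ℬ : Γ → Submodule k B} [DirectSum.Decomposition ℬ]
    {ω : B →ₗ[k] B →ₗ[k] k} {m : Γ}
    (hm : ∀ i j, i + j + m ≠ 0 → ∀ x ∈ ℬ i, ∀ y ∈ ℬ j, ω x y = 0)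
    (X : CompletedTensor ℬ ℬ) (y z z' : B) :
    omegaHat ℬ ω X y (z + z') = omegaHat ℬ ω X y z + omegaHat ℬ ω X y z' := by
  unfold omegaHat
  rw [← finsum_add_distrib (finite_omegaPair_support hm X y z)
    (finite_omegaPair_support hm X y z')]
  refine finsum_congr fun p => ?_
  simp [omegaPair, LinearMap.add_comp, TensorProduct.map_add_right]

/-- On homogeneous arguments a single degree contributes to `ω̂`. -/
lemma omegaHat_homogeneous {ℬ : Γ → Submodule k B}
    {ω : B →ₗ[k] B →ₗ[k] k} {m : Γ}
    (hm : ∀ i j, i + j + m ≠ 0 → ∀ x ∈ ℬ i, ∀ y ∈ ℬ j, ω x y = 0)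
    (X : CompletedTensor ℬ ℬ) (i j : Γ) {y z : B} (hy : y ∈ ℬ (-m - i)) (hz : z ∈ ℬ (-m - j)) :
    omegaHat ℬ ω X y z = omegaPair ℬ ω y z i j (X i j) := by
  unfold omegaHat
  refine finsum_eq_single _ (i, j) fun p hp => ?_
  have key : ∀ (a b : Γ) (w : B), w ∈ ℬ (-m - b) → a ≠ b → ω.flip w ∘ₗ (ℬ a).subtype = 0 := by
    intro a b w hw hab
    ext x
    refine hm a _ (fun h => hab ?_) x x.2 w hw
    rw [← sub_eq_zero, ← h]; abel
  have : p.1 ≠ i ∨ p.2 ≠ j := by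
    by_contra h
    push Not at h
    exact hp (Prod.ext h.1 h.2)
  rcases this with h | h
  · simp [omegaPair, key _ _ _ hy h]
  · simp [omegaPair, key _ _ _ hz h]

/-- The restriction of `ω` to `B i × B (-m - i)` is a perfect pairing. -/
lemma isPerfPair_restrict {ℬ : Γ → Submodule k B} [DirectSum.Decomposition ℬ]
    {dia : B →ₗ[k] B →ₗ[k] B} {ω : B →ₗ[k] B →ₗ[k] k} (h : IsQuadraticGradedPerm ℬ dia ω) {m : Γ}
    (hm : ∀ i j, i + j + m ≠ 0 → ∀ x ∈ ℬ i, ∀ y ∈ ℬ j, ω x y = 0) (i : Γ) :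
    (ω.domRestrict₁₂ (ℬ i) (ℬ (-m - i))).IsPerfPair := by
  have key : ∀ a b : Γ, a + b = -m → ∀ x ∈ ℬ a, (∀ y ∈ ℬ b, ω x y = 0) → x = 0 := by
    intro a b hab x hx hxy
    refine h.nondegenerate x fun y => ?_
    induction y using DirectSum.Decomposition.inductionOn ℬ with
    | zero => simp
    | @homogeneous p y =>
      by_cases hp : p = b
      · subst hp; exact hxy y y.2
      · refine hm a p (fun h0 => hp ?_) x hx y y.2
        have h1 : a + p = -m := eq_neg_of_add_eq_zero_left h0
        exact add_left_cancel (h1.trans hab.symm)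
    | add y y' h h' => rw [map_add, h, h', add_zero]
  have := h.perm.graded.finite i
  apply LinearMap.IsPerfPair.of_injective
  · rw [injective_iff_map_eq_zero]
    intro x hx
    refine Subtype.ext (key i (-m - i) (by abel) x x.2 fun y hy => ?_)
    exact LinearMap.congr_fun hx ⟨y, hy⟩
  · rw [injective_iff_map_eq_zero]
    intro y hy
    refine Subtype.ext (key (-m - i) i (by abel) y y.2 fun x hx => ?_)
    rw [h.antisymm]
    rw [neg_eq_zero.2]
    exact LinearMap.congr_fun hy ⟨x, hx⟩

/-- Existence and uniqueness of the coproduct dual to the product of a quadratic graded perm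
algebra. -/
lemma existsUnique_nuOmega {ℬ : Γ → Submodule k B} [DirectSum.Decomposition ℬ]
    {dia : B →ₗ[k] B →ₗ[k] B} {ω : B →ₗ[k] B →ₗ[k] k} (h : IsQuadraticGradedPerm ℬ dia ω) :
    ∃! ν : B →ₗ[k] CompletedTensor ℬ ℬ,
      ∀ x y z, omegaHat ℬ ω (ν x) y z = -ω x (dia y z) := by
  obtain ⟨m, hm⟩ := h.graded
  have hfin := h.perm.graded.finite
  have hperf := isPerfPair_restrict h hm
  let e : ∀ i, ℬ i ≃ₗ[k] Module.Dual k (ℬ (-m - i)) := fun i =>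
    (ω.domRestrict₁₂ (ℬ i) (ℬ (-m - i))).toPerfPair
  let G : ∀ i j, ℬ i ⊗[k] ℬ j ≃ₗ[k] Module.Dual k (ℬ (-m - i) ⊗[k] ℬ (-m - j)) := fun i j =>
    TensorProduct.congr (e i) (e j) ≪≫ₗ
      TensorProduct.dualDistribEquiv k (ℬ (-m - i)) (ℬ (-m - j))
  have hG : ∀ i j (X : ℬ i ⊗[k] ℬ j) (y : ℬ (-m - i)) (z : ℬ (-m - j)),
      G i j X (y ⊗ₜ z) = omegaPair ℬ ω y z i j X := by
    intro i j X y z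
    induction X with
    | zero => simp
    | tmul a b =>
      simp only [G, omegaPair, LinearEquiv.trans_apply, TensorProduct.congr_tmul]
      rfl
    | add X X' h h' => simp only [map_add, LinearMap.add_apply, h, h']
  let ν : B →ₗ[k] CompletedTensor ℬ ℬ := LinearMap.pi fun i => LinearMap.pi fun j =>
    (G i j).symm.toLinearMap ∘ₗ
      (-((TensorProduct.lift dia ∘ₗ
        TensorProduct.map (ℬ (-m - i)).subtype (ℬ (-m - j)).subtype).dualMap ∘ₗ ω))
  have hdeg : ∀ p : Γ, -m - (-m - p) = p := fun p => by abel
  refine ⟨ν, fun x y z => ?_, fun ν' hν' => ?_⟩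
  · induction y using DirectSum.Decomposition.inductionOn ℬ with
    | zero => simp [omegaHat, omegaPair]
    | add y y' h h' => rw [omegaHat_add_left hm, h, h']; simp; ring
    | @homogeneous p y =>
      induction z using DirectSum.Decomposition.inductionOn ℬ with
      | zero => simp [omegaHat, omegaPair]
      | add z z' h h' => rw [omegaHat_add_right hm, h, h']; simp; ring
      | @homogeneous q z =>
        have hy : (y : B) ∈ ℬ (-m - (-m - p)) := by rw [hdeg]; exact y.2
        have hz : (z : B) ∈ ℬ (-m - (-m - q)) := by rw [hdeg]; exact z.2
        rw [omegaHat_homogeneous hm _ (-m - p) (-m - q) hy hz,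
          ← hG _ _ _ ⟨y, hy⟩ ⟨z, hz⟩]
        simp [ν]
  · ext x : 1
    funext i j
    apply (G i j).injective
    apply TensorProduct.ext'
    intro y z
    rw [hG, ← omegaHat_homogeneous hm (ν' x) i j y.2 z.2, hν']
    simp [ν]

/-- The coproduct `ν_ω : B → B ⊗̂ B` with `ω̂(ν_ω(x), y ⊗ z) = -ω(x, y ⋄ z)`. -/
noncomputable def nuOmega {ℬ : Γ → Submodule k B} [DirectSum.Decomposition ℬ]
    {dia : B →ₗ[k] B →ₗ[k] B} {ω : B →ₗ[k] B →ₗ[k] k} (h : IsQuadraticGradedPerm ℬ dia ω) :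
    B →ₗ[k] CompletedTensor ℬ ℬ :=
  (existsUnique_nuOmega h).choose

lemma omegaHat_nuOmega {ℬ : Γ → Submodule k B} [DirectSum.Decomposition ℬ]
    {dia : B →ₗ[k] B →ₗ[k] B} {ω : B →ₗ[k] B →ₗ[k] k} (h : IsQuadraticGradedPerm ℬ dia ω)
    (x y z : B) : omegaHat ℬ ω (nuOmega h x) y z = -ω x (dia y z) :=
  (existsUnique_nuOmega h).choose_spec.1 x y z

end Perm

/-! ### The induced structures on `A ⊗ B` -/

section Decomp

variable {k : Type*} [Field k] {Γ : Type*} [DecidableEq Γ]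
variable {V : Type*} [AddCommGroup V] [Module k V]

lemma isInternal_of_proj (𝒱 : Γ → Submodule k V) (pr : Γ → V →ₗ[k] V)
    (h₁ : ∀ d, ∀ v ∈ 𝒱 d, pr d v = v) (h₂ : ∀ d d', d ≠ d' → ∀ v ∈ 𝒱 d', pr d v = 0)
    (h₃ : ∀ v : V, v ∈ ⨆ d, 𝒱 d) : DirectSum.IsInternal 𝒱 := by
  rw [DirectSum.isInternal_submodule_iff_iSupIndep_and_iSup_eq_top]
  refine ⟨fun d => ?_, (Submodule.eq_top_iff').2 h₃⟩
  rw [Submodule.disjoint_def]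
  intro v hv hv'
  have hle : (⨆ (j) (_ : j ≠ d), 𝒱 j) ≤ LinearMap.ker (pr d) :=
    iSup₂_le fun j hj v hv => h₂ d j hj.symm v hv
  rw [← h₁ d v hv]
  exact hle hv'

end Decomp

section Induced

variable {k : Type*} [Field k] {A : Type*} [AddCommGroup A] [Module k A]
variable {Γ : Type*} {B : Type*} [AddCommGroup B] [Module k B]

/-- The grading `(A ⊗ B) i = A ⊗ B i`, as a submodule of `A ⊗ B`. -/
noncomputable def tensorGrading (A : Type*) [AddCommGroup A] [Module k A]
    (ℬ : Γ → Submodule k B) (i : Γ) : Submodule k (A ⊗[k] B) :=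
  LinearMap.range ((ℬ i).subtype.lTensor A)

noncomputable instance tensorDecomposition [DecidableEq Γ] (ℬ : Γ → Submodule k B)
    [DirectSum.Decomposition ℬ] : DirectSum.Decomposition (tensorGrading A ℬ) :=
  DirectSum.IsInternal.chooseDecomposition _ <| by
    refine isInternal_of_proj (tensorGrading A ℬ)
      (fun d => ((ℬ d).subtype ∘ₗ gradedProj ℬ d).lTensor A) ?_ ?_ ?_
    · rintro d _ ⟨t, rfl⟩
      rw [← LinearMap.comp_apply, ← LinearMap.lTensor_comp]
      have : ((ℬ d).subtype ∘ₗ gradedProj ℬ d) ∘ₗ (ℬ d).subtype = (ℬ d).subtype := by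
        ext x
        simp [gradedProj]
      rw [this]
    · rintro d d' hd _ ⟨t, rfl⟩
      rw [← LinearMap.comp_apply, ← LinearMap.lTensor_comp]
      have : ((ℬ d).subtype ∘ₗ gradedProj ℬ d) ∘ₗ (ℬ d').subtype = 0 := by
        ext x
        simp [gradedProj, DirectSum.component.of, hd.symm]
      rw [this]; simp
    · intro t
      induction t with
      | zero => exact zero_mem _
      | add s t hs ht => exact add_mem hs ht
      | tmul a b =>
        induction b using DirectSum.Decomposition.inductionOn ℬ with
        | zero => simp
        | add b b' h h' => rw [TensorProduct.tmul_add]; exact add_mem h h'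
        | @homogeneous i b =>
          exact Submodule.mem_iSup_of_mem i ⟨a ⊗ₜ b, by simp⟩

/-- The product `(a ⊗ b) (a' ⊗ b') = (a ∗ a') ⊗ (b ⋄ b') + (a' ∗ a) ⊗ (b' ⋄ b)`. -/
noncomputable def inducedMul (ast : A →ₗ[k] A →ₗ[k] A) (dia : B →ₗ[k] B →ₗ[k] B) :
    A ⊗[k] B →ₗ[k] A ⊗[k] B →ₗ[k] A ⊗[k] B :=
  TensorProduct.map₂ ast dia + TensorProduct.map₂ ast.flip dia.flip

/-- The bracket `[a ⊗ b, a' ⊗ b'] = (a ∘ a') ⊗ (b ⋄ b') - (a' ∘ a) ⊗ (b' ⋄ b)`. -/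
noncomputable def inducedBracket (circ : A →ₗ[k] A →ₗ[k] A) (dia : B →ₗ[k] B →ₗ[k] B) :
    A ⊗[k] B →ₗ[k] A ⊗[k] B →ₗ[k] A ⊗[k] B :=
  TensorProduct.map₂ circ dia - TensorProduct.map₂ circ.flip dia.flip

/-- The canonical map from `A ⊗ B i` to the component of degree `i` of `A ⊗ B`. -/
noncomputable def toTensorGrading (A : Type*) [AddCommGroup A] [Module k A]
    (ℬ : Γ → Submodule k B) (i : Γ) : A ⊗[k] ℬ i →ₗ[k] tensorGrading A ℬ i :=
  ((ℬ i).subtype.lTensor A).rangeRestrict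

/-- The map `a ⊗ b ↦ ϑ(a) • ν(b)`, where for `ϑ(a) = ∑ a₁ ⊗ a₂` and `ν(b) = ∑ b₁ ⊗ b₂` one puts
`ϑ(a) • ν(b) = ∑ (a₁ ⊗ b₁) ⊗ (a₂ ⊗ b₂)`. -/
noncomputable def bullet (ℬ : Γ → Submodule k B) (ϑ : A →ₗ[k] A ⊗[k] A)
    (ν : B →ₗ[k] CompletedTensor ℬ ℬ) :
    A ⊗[k] B →ₗ[k] CompletedTensor (tensorGrading A ℬ) (tensorGrading A ℬ) :=
  LinearMap.pi fun i => LinearMap.pi fun j =>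
    TensorProduct.map (toTensorGrading A ℬ i) (toTensorGrading A ℬ j) ∘ₗ
      (TensorProduct.tensorTensorTensorComm k A A (ℬ i) (ℬ j)).toLinearMap ∘ₗ
        TensorProduct.map ϑ (CompletedTensor.component ℬ ℬ i j ∘ₗ ν)

/-- `Δ(a ⊗ b) = (id + τ̂)(ϑ(a) • ν(b))`. -/
noncomputable def inducedDelta (ℬ : Γ → Submodule k B) (ϑ : A →ₗ[k] A ⊗[k] A)
    (ν : B →ₗ[k] CompletedTensor ℬ ℬ) :
    A ⊗[k] B →ₗ[k] CompletedTensor (tensorGrading A ℬ) (tensorGrading A ℬ) :=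
  idAddTauHat (tensorGrading A ℬ) ∘ₗ bullet ℬ ϑ ν

/-- `δ(a ⊗ b) = (id - τ̂)(θ(a) • ν(b))`. -/
noncomputable def inducedCobracket (ℬ : Γ → Submodule k B) (θ : A →ₗ[k] A ⊗[k] A)
    (ν : B →ₗ[k] CompletedTensor ℬ ℬ) :
    A ⊗[k] B →ₗ[k] CompletedTensor (tensorGrading A ℬ) (tensorGrading A ℬ) :=
  idSubTauHat (tensorGrading A ℬ) ∘ₗ bullet ℬ θ ν

/-- The statement that `A ⊗ B`, with the operations induced from `(A, ∗, ∘, ϑ, θ)` and the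
quadratic graded perm algebra `(B, ⋄, ω)`, is a completed Poisson bialgebra. -/
def InducedIsCompletedPoissonBialgebra [AddCommGroup Γ] [DecidableEq Γ]
    (ast circ : A →ₗ[k] A →ₗ[k] A) (ϑ θ : A →ₗ[k] A ⊗[k] A)
    {ℬ : Γ → Submodule k B} [DirectSum.Decomposition ℬ]
    {dia : B →ₗ[k] B →ₗ[k] B} {ω : B →ₗ[k] B →ₗ[k] k}
    (hB : IsQuadraticGradedPerm ℬ dia ω) : Prop :=
  IsCompletedPoissonBialgebra (tensorGrading A ℬ)
    (inducedMul ast dia) (inducedBracket circ dia)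
    (inducedDelta ℬ ϑ (nuOmega hB)) (inducedCobracket ℬ θ (nuOmega hB))

end Induced

/-! ### The perm algebra of Laurent polynomial vector fields in two variables -/

section Laurent

variable (k : Type*) [Field k]

/-- The Laurent polynomial ring `k[x₁^±, x₂^±]`; `single (i₁, i₂) c` is `c x₁^i₁ x₂^i₂`. -/
abbrev Laurent₂ : Type _ := AddMonoidAlgebra k (ℤ × ℤ)

/-- The vector fields `f₁ ∂₁ + f₂ ∂₂`, encoded as `(f₁, f₂)`. -/
abbrev LaurentField : Type _ := Fin 2 → Laurent₂ k

/-- The exponent of `x₁`, respectively `x₂`. -/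
def expo : Fin 2 → ℤ × ℤ := ![(1, 0), (0, 1)]

/-- The vector field `c x₁^n₁ x₂^n₂ ∂ₛ`. -/
noncomputable def monom (n : ℤ × ℤ) (s : Fin 2) (c : k) : LaurentField k :=
  Pi.single s (AddMonoidAlgebra.single n c)

/-- The product `f ⋄ g = (x₁ f₁ + x₂ f₂) g`. -/
noncomputable def laurentDia : LaurentField k →ₗ[k] LaurentField k →ₗ[k] LaurentField k :=
  LinearMap.mk₂ k
    (fun f g t => (∑ s, AddMonoidAlgebra.single (expo s) (1 : k) * f s) * g t)
    (fun f f' g => by funext t; simp [mul_add, add_mul]; ring)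
    (fun c f g => by funext t; simp [add_mul])
    (fun f g g' => by funext t; simp [mul_add])
    (fun c f g => by funext t; simp)

/-- The form `ω(f, g) =` constant coefficient of `f₂ g₁ - f₁ g₂`. -/
noncomputable def laurentOmega : LaurentField k →ₗ[k] LaurentField k →ₗ[k] k :=
  LinearMap.mk₂ k (fun f g => (f 1 * g 0 - f 0 * g 1).coeff 0)
    (fun f f' g => by simp [add_mul]; ring)
    (fun c f g => by simp [mul_sub])
    (fun f g g' => by simp [mul_add]; ring)
    (fun c f g => by simp [mul_sub])

/-- The `ℤ × ℤ`-grading by exponents in which `x₁^n₁ x₂^n₂ ∂₁` has degree `(n₁ + 1, n₂)` and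
`x₁^n₁ x₂^n₂ ∂₂` has degree `(n₁, n₂ + 1)`. -/
def laurentGrading (d : ℤ × ℤ) : Submodule k (LaurentField k) where
  carrier := {f | ∀ t n, n + expo t ≠ d → (f t).coeff n = 0}
  zero_mem' := by intro t n _; simp
  add_mem' := by
    intro f g hf hg t n hn
    simp [hf t n hn, hg t n hn]
  smul_mem' := by
    intro c f hf t n hn
    simp [hf t n hn]

variable {k}

lemma mem_laurentGrading_iff {d : ℤ × ℤ} {f : LaurentField k} :
    f ∈ laurentGrading k d ↔
      ∀ t, f t = AddMonoidAlgebra.single (d - expo t) ((f t).coeff (d - expo t)) := by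
  constructor
  · intro hf t
    ext n
    by_cases h : n + expo t = d
    · have : n = d - expo t := eq_sub_of_add_eq h
      subst this; simp
    · have h' : d - expo t ≠ n := fun h' => h (by rw [← h']; abel)
      rw [hf t n h]; simp [h']
  · intro hf t n hn
    have h' : d - expo t ≠ n := fun h' => hn (by rw [← h']; abel)
    rw [hf t]; simp [h']

lemma monom_mem_laurentGrading (n : ℤ × ℤ) (s : Fin 2) (c : k) :
    monom k n s c ∈ laurentGrading k (n + expo s) := by
  intro t n' hn
  by_cases hts : t = s
  · subst hts
    have : n ≠ n' := fun h => hn (by rw [h])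
    simp [monom, this]
  · simp [monom, hts]

/-- The projection to the component of degree `d`. -/
noncomputable def laurentProj (d : ℤ × ℤ) : LaurentField k →ₗ[k] LaurentField k where
  toFun f := fun t => AddMonoidAlgebra.single (d - expo t) ((f t).coeff (d - expo t))
  map_add' f g := by funext t; simp
  map_smul' c f := by funext t; simp

noncomputable instance laurentDecomposition : DirectSum.Decomposition (laurentGrading k) :=
  DirectSum.IsInternal.chooseDecomposition _ <| by
    refine isInternal_of_proj (laurentGrading k) laurentProj ?_ ?_ ?_
    · intro d f hf
      funext t
      exact ((mem_laurentGrading_iff.1 hf) t).symm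
    · intro d d' hd f hf
      funext t
      have : (f t).coeff (d - expo t) = 0 := hf t _ (by simpa using hd)
      simp [laurentProj, this]
    · intro f
      have hf : f = ∑ s, Pi.single s (f s) := (Finset.univ_sum_single f).symm
      rw [hf]
      refine sum_mem fun s _ => ?_
      induction f s using AddMonoidAlgebra.induction_linear with
      | zero => simp
      | add p q hp hq => rw [Pi.single_add]; exact add_mem hp hq
      | single n c => exact Submodule.mem_iSup_of_mem _ (monom_mem_laurentGrading n s c)

/-- The Laurent polynomial vector fields form a quadratic graded perm algebra. -/
lemma laurent_isQuadraticGradedPerm :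
    IsQuadraticGradedPerm (laurentGrading k) (laurentDia k) (laurentOmega k) where
  perm :=
    { graded :=
        { finite := fun d => by
            let F : laurentGrading k d →ₗ[k] (Fin 2 → k) :=
              { toFun := fun f t => (f.1 t).coeff (d - expo t)
                map_add' := fun f g => by funext t; simp
                map_smul' := fun c f => by funext t; simp }
            refine FiniteDimensional.of_injective F ?_
            rw [injective_iff_map_eq_zero]
            intro f hf
            refine Subtype.ext (funext fun t => ?_)
            rw [mem_laurentGrading_iff.1 f.2 t]
            have : (f.1 t).coeff (d - expo t) = 0 := congrFun hf t
            simp [this]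
          mul_mem := fun i j f hf g hg t n hn => by
            have hf' := mem_laurentGrading_iff.1 hf
            have hg' := mem_laurentGrading_iff.1 hg
            have h : ∀ s, (AddMonoidAlgebra.single (expo s) (1 : k) * f s * g t).coeff n = 0 := by
              intro s
              rw [hf' s, hg' t]
              have : expo s + (i - expo s) + (j - expo t) ≠ n :=
                fun h => hn (by rw [← h]; abel)
              rw [AddMonoidAlgebra.single_mul_single, AddMonoidAlgebra.single_mul_single,
                AddMonoidAlgebra.coeff_single, Finsupp.single_eq_of_ne this.symm]
            simp only [laurentDia, LinearMap.mk₂_apply, Finset.sum_mul]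
            simp [h] }
      assoc := fun x y z => by
        funext t
        simp only [laurentDia, LinearMap.mk₂_apply, Fin.sum_univ_two]
        ring
      perm := fun x y z => by
        funext t
        simp only [laurentDia, LinearMap.mk₂_apply, Fin.sum_univ_two]
        ring }
  antisymm := fun x y => by
    simp only [laurentOmega, LinearMap.mk₂_apply]
    rw [← Finsupp.neg_apply, ← AddMonoidAlgebra.coeff_neg]
    congr 2
    ring
  invariant := fun x y z => by
    simp only [laurentOmega, laurentDia, LinearMap.mk₂_apply, Fin.sum_univ_two, Pi.sub_apply]
    congr 2
    ring
  nondegenerate := fun f hf => by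
    have key : ∀ t n, (f t).coeff n = 0 := by
      intro t n
      fin_cases t
      · simpa [laurentOmega, monom] using hf (monom k (-n) 1 1)
      · simpa [laurentOmega, monom] using hf (monom k (-n) 0 1)
    funext t
    ext n
    simp [key]
  graded := by
    refine ⟨(-1, -1), fun i j hij f hf g hg => ?_⟩
    have hf' := mem_laurentGrading_iff.1 hf
    have hg' := mem_laurentGrading_iff.1 hg
    have h : ∀ s t : Fin 2, s ≠ t → (f s * g t).coeff 0 = 0 := by
      intro s t hst
      rw [hf' s, hg' t]
      have hst' : expo s + expo t = (1, 1) := by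
        fin_cases s <;> fin_cases t <;> simp_all [expo]
      have : i - expo s + (j - expo t) ≠ 0 := by
        intro h
        apply hij
        have h1 : i + j = expo s + expo t := by
          rw [← sub_eq_zero, ← h]; abel
        rw [h1, hst']; rfl
      simp only [AddMonoidAlgebra.single_mul_single]
      simp [this]
    simp only [laurentOmega, LinearMap.mk₂_apply]
    simp [h 1 0 (by decide), h 0 1 (by decide)]

end Laurent

end PrePoissonAffinization

open PrePoissonAffinization

/-!
The dual space `A*` carries the multiplications `dualMul ϑ`, `dualMul θ`, and `A* ⊗ B` carries the
operations induced by them. The form `ω` pairs `A* ⊗ B` with `A ⊗ B` (`tensorForm`), homogeneous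
elements of `A* ⊗ B` separate the points of the completed tensor powers of `A ⊗ B`
(`completedTensor_eq_iff`, `completedTensor₃_eq_iff`), and the definition of `ν_ω` says precisely
that `Δ` and `δ` are, up to sign, dual to the induced product and bracket of `A* ⊗ B`
(`isDualProduct_inducedDelta`, `isDualProduct_inducedCobracket`). This reduces both directions to
identities between finitely many vectors.

* The axioms of a completed Poisson coalgebra on `A ⊗ B` are the axioms of a Poisson algebra on
  `A* ⊗ B`, and a finite-dimensional pre-Poisson coalgebra on `A` is a pre-Poisson algebra on `A*`.
  Thus the coalgebra part follows from the algebra part, which holds because a pre-Poisson algebra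
  tensored with a perm algebra is a Poisson algebra.
* Each of the four compatibility conditions becomes a scalar identity in `a, b ∈ A`, `f, g ∈ A*`
  and four elements of `B`, which enter through the values `ω(xᵢ, xⱼ ⋄ x_k ⋄ x_l)`. Invariance of
  `ω` forces these values to be differences `tᵢ - t_l` of a potential
  (`IsQuadraticGradedPerm.exists_potential`). The coefficients at the values of the potential are
  linear combinations of the conditions of a pre-Poisson bialgebra, in the dual form
  `IsDualCompat`.

For the converse it suffices that `B` contains homogeneous elements `e`, `n` with `e ⋄ e = e`,
`e ⋄ n = n`, `n ⋄ e = 0` and `ω(e, n) = 1` (`IsUnitNilPair`): in an identity on `A ⊗ B` or `A* ⊗ B`,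
placing `n` at one position and `e` at all others isolates a single condition on `A`. The Laurent
algebra has such a pair, namely `e = x₁⁻¹ ∂₁` and `n = x₂ ∂₁ - x₁ ∂₂`.
-/

open scoped TensorProduct DirectSum

namespace PrePoissonAffinization

/-! ### Dual multiplications of comultiplications -/

section DualMul

variable {k : Type*} [Field k]
variable {M N L M' N' : Type*} [AddCommGroup M] [Module k M] [AddCommGroup N] [Module k N]
  [AddCommGroup L] [Module k L] [AddCommGroup M'] [Module k M'] [AddCommGroup N'] [Module k N']
variable {A : Type*} [AddCommGroup A] [Module k A]

/-- The functional `x ⊗ y ↦ f x * g y` on `M ⊗ N`. -/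
noncomputable def dualTmul (f : Module.Dual k M) (g : Module.Dual k N) :
    Module.Dual k (M ⊗[k] N) :=
  TensorProduct.dualDistrib k M N (f ⊗ₜ g)

@[simp]
lemma dualTmul_tmul (f : Module.Dual k M) (g : Module.Dual k N) (x : M) (y : N) :
    dualTmul f g (x ⊗ₜ y) = f x * g y := rfl

lemma dualTmul_map (f : Module.Dual k M') (g : Module.Dual k N') (u : M →ₗ[k] M')
    (v : N →ₗ[k] N') (X : M ⊗[k] N) :
    dualTmul f g (TensorProduct.map u v X) = dualTmul (f ∘ₗ u) (g ∘ₗ v) X := by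
  rw [← LinearMap.comp_apply]
  congr 1
  exact TensorProduct.ext' fun x y => by simp

lemma dualTmul_rTensor (f : Module.Dual k M') (g : Module.Dual k N) (u : M →ₗ[k] M')
    (X : M ⊗[k] N) : dualTmul f g (u.rTensor N X) = dualTmul (f ∘ₗ u) g X :=
  dualTmul_map f g u LinearMap.id X

lemma dualTmul_lTensor (f : Module.Dual k M) (g : Module.Dual k N') (v : N →ₗ[k] N')
    (X : M ⊗[k] N) : dualTmul f g (v.lTensor M X) = dualTmul f (g ∘ₗ v) X :=
  dualTmul_map f g LinearMap.id v X

lemma dualTmul_comm (f : Module.Dual k N) (g : Module.Dual k M) (X : M ⊗[k] N) :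
    dualTmul f g (TensorProduct.comm k M N X) = dualTmul g f X := by
  rw [← LinearEquiv.coe_coe, ← LinearMap.comp_apply]
  congr 1
  exact TensorProduct.ext' fun x y => by simp [mul_comm]

lemma dualTmul_assoc_symm (f : Module.Dual k M) (g : Module.Dual k N) (h : Module.Dual k L)
    (X : M ⊗[k] (N ⊗[k] L)) :
    dualTmul (dualTmul f g) h ((TensorProduct.assoc k M N L).symm X) =
      dualTmul f (dualTmul g h) X := by
  rw [← LinearEquiv.coe_coe, ← LinearMap.comp_apply]
  congr 1
  refine TensorProduct.ext' fun x y => ?_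
  induction y with
  | zero => simp
  | tmul y z => simp [mul_assoc]
  | add y z hy hz => simp only [TensorProduct.tmul_add, map_add, hy, hz]

lemma dualTmul_add_left (f f' : Module.Dual k M) (g : Module.Dual k N) :
    dualTmul (f + f') g = dualTmul f g + dualTmul f' g := by
  simp [dualTmul, TensorProduct.add_tmul]

lemma dualTmul_add_right (f : Module.Dual k M) (g g' : Module.Dual k N) :
    dualTmul f (g + g') = dualTmul f g + dualTmul f g' := by
  simp [dualTmul, TensorProduct.tmul_add]

@[simp]
lemma dualTmul_zero_left (g : Module.Dual k N) : dualTmul (0 : Module.Dual k M) g = 0 := by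
  simp [dualTmul]

@[simp]
lemma dualTmul_zero_right (f : Module.Dual k M) : dualTmul f (0 : Module.Dual k N) = 0 := by
  simp [dualTmul]

lemma dualTmul_neg_left (f : Module.Dual k M) (g : Module.Dual k N) :
    dualTmul (-f) g = -dualTmul f g := by
  rw [eq_neg_iff_add_eq_zero, ← dualTmul_add_left, neg_add_cancel, dualTmul_zero_left]

lemma dualTmul_neg_right (f : Module.Dual k M) (g : Module.Dual k N) :
    dualTmul f (-g) = -dualTmul f g := by
  rw [eq_neg_iff_add_eq_zero, ← dualTmul_add_right, neg_add_cancel, dualTmul_zero_right]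

/-- Decomposable functionals separate the points of a tensor product of finite-dimensional
spaces. -/
lemma tensor_eq_iff_dualTmul [FiniteDimensional k M] [FiniteDimensional k N] {X Y : M ⊗[k] N} :
    X = Y ↔ ∀ f g, dualTmul f g X = dualTmul f g Y := by
  refine ⟨fun h _ _ => by rw [h], fun h => ?_⟩
  rw [← sub_eq_zero, ← Module.forall_dual_apply_eq_zero_iff k]
  intro φ
  obtain ⟨t, rfl⟩ := (TensorProduct.dualDistribEquiv k M N).surjective φ
  induction t with
  | zero => simp
  | tmul f g => exact (map_sub (dualTmul f g) X Y).trans (sub_eq_zero.2 (h f g))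
  | add s t hs ht => rw [map_add, LinearMap.add_apply, hs, ht, add_zero]

lemma tensor₃_eq_iff_dualTmul [FiniteDimensional k M] [FiniteDimensional k N]
    [FiniteDimensional k L] {X Y : (M ⊗[k] N) ⊗[k] L} :
    X = Y ↔ ∀ f g h, dualTmul (dualTmul f g) h X = dualTmul (dualTmul f g) h Y := by
  refine ⟨fun h _ _ _ => by rw [h], fun h => tensor_eq_iff_dualTmul.2 fun φ l => ?_⟩
  obtain ⟨t, rfl⟩ := (TensorProduct.dualDistribEquiv k M N).surjective φ
  induction t with
  | zero => simp
  | tmul f g => exact h f g l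
  | add s t hs ht => rw [map_add, dualTmul_add_left, LinearMap.add_apply, LinearMap.add_apply,
      hs, ht]

/-- The multiplication `f · g = (f ⊗ g) ∘ ϑ` on the dual space of a space with a
comultiplication `ϑ`. -/
noncomputable def dualMul (ϑ : A →ₗ[k] A ⊗[k] A) :
    Module.Dual k A →ₗ[k] Module.Dual k A →ₗ[k] Module.Dual k A :=
  (TensorProduct.mk k _ _).compr₂ (Module.Dual.transpose ϑ ∘ₗ TensorProduct.dualDistrib k A A)

lemma dualMul_apply (ϑ : A →ₗ[k] A ⊗[k] A) (f g : Module.Dual k A) (a : A) :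
    dualMul ϑ f g a = dualTmul f g (ϑ a) := rfl

lemma dualTmul_tau (f g : Module.Dual k A) (X : A ⊗[k] A) :
    dualTmul f g (tau X) = dualTmul g f X :=
  dualTmul_comm f g X

lemma dualTmul_tauId (f g h : Module.Dual k A) (X : (A ⊗[k] A) ⊗[k] A) :
    dualTmul (dualTmul f g) h (tauId X) = dualTmul (dualTmul g f) h X := by
  rw [tauId, dualTmul_rTensor]
  exact congrArg (fun φ => dualTmul φ h X) (LinearMap.ext fun Y => dualTmul_tau f g Y)

lemma dualTmul_comulLeft (Δ₁ Δ₂ : A →ₗ[k] A ⊗[k] A) (f g h : Module.Dual k A) (a : A) :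
    dualTmul (dualTmul f g) h (comulLeft Δ₁ Δ₂ a) = dualMul Δ₂ (dualMul Δ₁ f g) h a := by
  rw [comulLeft, LinearMap.comp_apply, dualTmul_rTensor]
  rfl

lemma dualTmul_comulRight (Δ₁ Δ₂ : A →ₗ[k] A ⊗[k] A) (f g h : Module.Dual k A) (a : A) :
    dualTmul (dualTmul f g) h (comulRight Δ₁ Δ₂ a) = dualMul Δ₂ f (dualMul Δ₁ g h) a := by
  rw [comulRight, LinearMap.comp_apply, LinearEquiv.coe_coe, dualTmul_assoc_symm,
    LinearMap.comp_apply, dualTmul_lTensor]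
  rfl

lemma dualMul_sub_tau (θ : A →ₗ[k] A ⊗[k] A) (f g : Module.Dual k A) :
    dualMul (θ - tau ∘ₗ θ) f g = dualMul θ f g - dualMul θ g f := by
  ext a
  simp only [dualMul_apply, LinearMap.sub_apply, LinearMap.comp_apply, map_sub, dualTmul_tau]

lemma dualMul_add_tau (ϑ : A →ₗ[k] A ⊗[k] A) (f g : Module.Dual k A) :
    dualMul (ϑ + tau ∘ₗ ϑ) f g = dualMul ϑ f g + dualMul ϑ g f := by
  ext a
  simp only [dualMul_apply, LinearMap.add_apply, LinearMap.comp_apply, map_add, dualTmul_tau]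

/-- An identity between maps `A → A ⊗ A ⊗ A` is an identity between trilinear products on the
dual space. -/
lemma forall_tensor₃_eq_iff [FiniteDimensional k A] {X Y : A → (A ⊗[k] A) ⊗[k] A}
    {F G : Module.Dual k A → Module.Dual k A → Module.Dual k A → Module.Dual k A}
    (hX : ∀ f g h a, dualTmul (dualTmul f g) h (X a) = F f g h a)
    (hY : ∀ f g h a, dualTmul (dualTmul f g) h (Y a) = G f g h a) :
    (∀ a, X a = Y a) ↔ ∀ f g h, F f g h = G f g h := by
  simp only [tensor₃_eq_iff_dualTmul, hX, hY, LinearMap.ext_iff]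
  exact ⟨fun h f g l a => h a f g l, fun h a f g l => h f g l a⟩

lemma isZinbielCoalgebra_iff_dual [FiniteDimensional k A] (ϑ : A →ₗ[k] A ⊗[k] A) :
    IsZinbielCoalgebra ϑ ↔ IsZinbielAlgebra (dualMul ϑ) :=
  (forall_tensor₃_eq_iff
    (F := fun f g h => dualMul ϑ (dualMul ϑ f g) h + dualMul ϑ (dualMul ϑ g f) h)
    (G := fun f g h => dualMul ϑ f (dualMul ϑ g h))
    (fun f g h a => by
      simp only [map_add, dualTmul_tauId, dualTmul_comulLeft, LinearMap.add_apply])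
    (fun f g h a => by simp only [dualTmul_comulRight])).trans
  ⟨fun H f g h => (H f g h).symm, fun H f g h => (H f g h).symm⟩

lemma isPreLieCoalgebra_iff_dual [FiniteDimensional k A] (θ : A →ₗ[k] A ⊗[k] A) :
    IsPreLieCoalgebra θ ↔ IsPreLieAlgebra (dualMul θ) :=
  (forall_tensor₃_eq_iff
    (F := fun f g h => dualMul θ f (dualMul θ g h) - dualMul θ g (dualMul θ f h))
    (G := fun f g h => dualMul θ (dualMul θ f g) h - dualMul θ (dualMul θ g f) h)
    (fun f g h a => by
      simp only [map_sub, dualTmul_tauId, dualTmul_comulRight, LinearMap.sub_apply])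
    (fun f g h a => by
      simp only [map_sub, dualTmul_tauId, dualTmul_comulLeft, LinearMap.sub_apply])).trans
  ⟨fun H f g h => by linear_combination (norm := module) -H f g h,
    fun H f g h => by linear_combination (norm := module) -H f g h⟩

/-- A finite-dimensional pre-Poisson coalgebra is the same thing as a pre-Poisson algebra structure
on the dual space. -/
lemma isPrePoissonCoalgebra_iff_dual [FiniteDimensional k A] (ϑ θ : A →ₗ[k] A ⊗[k] A) :
    IsPrePoissonCoalgebra ϑ θ ↔ IsPrePoissonAlgebra (dualMul ϑ) (dualMul θ) := by
  have h₁ := forall_tensor₃_eq_iff (A := A) (k := k)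
    (X := fun a => comulLeft (θ - tau ∘ₗ θ) ϑ a)
    (Y := fun a => comulRight ϑ θ a - tauId (comulRight θ ϑ a))
    (F := fun f g h => dualMul ϑ (dualMul θ f g - dualMul θ g f) h)
    (G := fun f g h => dualMul θ f (dualMul ϑ g h) - dualMul ϑ g (dualMul θ f h))
    (fun f g h a => by rw [dualTmul_comulLeft, dualMul_sub_tau])
    (fun f g h a => by
      simp only [map_sub, dualTmul_tauId, dualTmul_comulRight, LinearMap.sub_apply])
  have h₂ := forall_tensor₃_eq_iff (A := A) (k := k)
    (X := fun a => comulLeft (ϑ + tau ∘ₗ ϑ) θ a)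
    (Y := fun a => comulRight θ ϑ a + tauId (comulRight θ ϑ a))
    (F := fun f g h => dualMul θ (dualMul ϑ f g + dualMul ϑ g f) h)
    (G := fun f g h => dualMul ϑ f (dualMul θ g h) + dualMul ϑ g (dualMul θ f h))
    (fun f g h a => by rw [dualTmul_comulLeft, dualMul_add_tau])
    (fun f g h a => by
      simp only [map_add, dualTmul_tauId, dualTmul_comulRight, LinearMap.add_apply])
  exact ⟨fun H => ⟨(isZinbielCoalgebra_iff_dual ϑ).1 H.zinbiel,
      (isPreLieCoalgebra_iff_dual θ).1 H.preLie, h₁.1 H.compat₁, h₂.1 H.compat₂⟩,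
    fun H => ⟨(isZinbielCoalgebra_iff_dual ϑ).2 H.zinbiel,
      (isPreLieCoalgebra_iff_dual θ).2 H.preLie, h₁.2 H.compat₁, h₂.2 H.compat₂⟩⟩

/-- The compatibility conditions between the multiplications and the comultiplications of a
pre-Poisson bialgebra, tested against functionals `f`, `g`; here `F` and `G` are the
multiplications on the dual space. -/
structure IsDualCompat (ast circ : A →ₗ[k] A →ₗ[k] A)
    (F G : Module.Dual k A →ₗ[k] Module.Dual k A →ₗ[k] Module.Dual k A) : Prop where
  zinbiel₁ : ∀ a b f g,
    F f g (ast a b) + F g f (ast a b) =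
      F f (g ∘ₗ ast.flip b) a + F (f ∘ₗ ast a) g b + F g (f ∘ₗ ast a) b
  zinbiel₂ : ∀ a b f g,
    F f g (ast a b) + F f g (ast b a) =
      F (f ∘ₗ ast a) g b + F f (g ∘ₗ ast b) a + F f (g ∘ₗ ast.flip b) a
  preLie₁ : ∀ a b f g,
    G f g (circ a b) - G g f (circ a b) =
      G (f ∘ₗ circ a) g b - G g (f ∘ₗ circ a) b + G f (g ∘ₗ circ a) b - G (g ∘ₗ circ a) f b
        + G f (g ∘ₗ circ.flip b) a - G g (f ∘ₗ circ.flip b) a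
  preLie₂ : ∀ a b f g,
    G f g (circ a b) - G f g (circ b a) =
      G f (g ∘ₗ circ.flip b) a - G f (g ∘ₗ circ b) a + G f (g ∘ₗ circ a) b
        - G f (g ∘ₗ circ.flip a) b + G (f ∘ₗ circ a) g b - G (f ∘ₗ circ b) g a
  compat₁ : ∀ a b f g,
    G f g (ast a b) + G f g (ast b a) =
      G f (g ∘ₗ ast b) a + G f (g ∘ₗ ast.flip b) a + G f (g ∘ₗ ast a) b
        + G f (g ∘ₗ ast.flip a) b - F (f ∘ₗ circ a) g b - F (f ∘ₗ circ b) g a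
  compat₂ : ∀ a b f g,
    F f g (circ a b) - F f g (circ b a) =
      G (f ∘ₗ ast b) g a - G f (g ∘ₗ ast b) a - G f (g ∘ₗ ast.flip b) a
        + F (f ∘ₗ circ a) g b + F f (g ∘ₗ circ a) b - F f (g ∘ₗ circ.flip a) b
  compat₃ : ∀ a b f g,
    F f g (circ a b) + F g f (circ a b) =
      -G f (g ∘ₗ ast.flip b) a - G g (f ∘ₗ ast.flip b) a + F (f ∘ₗ circ a) g b
        + F g (f ∘ₗ circ a) b + F f (g ∘ₗ circ a) b + F (g ∘ₗ circ a) f b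
  compat₄ : ∀ a b f g,
    G f g (ast a b) - G g f (ast a b) =
      G f (g ∘ₗ ast.flip b) a + G f (g ∘ₗ ast a) b - G (g ∘ₗ ast a) f b
        + F g (f ∘ₗ circ.flip b) a - F (f ∘ₗ circ a) g b - F g (f ∘ₗ circ a) b

lemma isPrePoissonBialgebra_iff_dual [FiniteDimensional k A] (ast circ : A →ₗ[k] A →ₗ[k] A)
    (ϑ θ : A →ₗ[k] A ⊗[k] A) :
    IsPrePoissonBialgebra ast circ ϑ θ ↔
      IsPrePoissonAlgebra ast circ ∧ IsPrePoissonAlgebra (dualMul ϑ) (dualMul θ) ∧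
        IsDualCompat ast circ (dualMul ϑ) (dualMul θ) := by
  rw [← isPrePoissonCoalgebra_iff_dual]
  constructor
  · intro H
    have h₁ := fun a b f g => congrArg (dualTmul f g) (H.zinbiel.compat₁ a b)
    have h₂ := fun a b f g => congrArg (dualTmul f g) (H.zinbiel.compat₂ a b)
    have h₃ := fun a b f g => congrArg (dualTmul f g) (H.preLie.compat₁ a b)
    have h₄ := fun a b f g => congrArg (dualTmul f g) (H.preLie.compat₂ a b)
    have h₅ := fun a b f g => congrArg (dualTmul f g) (H.compat₁ a b)
    have h₆ := fun a b f g => congrArg (dualTmul f g) (H.compat₂ a b)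
    have h₇ := fun a b f g => congrArg (dualTmul f g) (H.compat₃ a b)
    have h₈ := fun a b f g => congrArg (dualTmul f g) (H.compat₄ a b)
    simp only [map_add, map_sub, map_neg, map_zero, LinearMap.add_apply, LinearMap.sub_apply,
      LinearMap.comp_apply, LinearMap.lTensor_add, LinearMap.lTensor_sub, dualTmul_rTensor,
      dualTmul_lTensor, dualTmul_tau] at h₁ h₂ h₃ h₄ h₅ h₆ h₇ h₈
    refine ⟨H.algebra, H.coalgebra, ⟨?_, ?_, ?_, ?_, ?_, ?_, ?_, ?_⟩⟩ <;> intro a b f g <;>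
      simp only [dualMul_apply]
    · linear_combination h₁ a b f g
    · linear_combination h₂ a b f g
    · linear_combination h₃ a b f g
    · linear_combination h₄ a b f g
    · linear_combination h₅ a b f g
    · linear_combination h₆ a b f g
    · linear_combination h₇ a b f g
    · linear_combination h₈ a b f g
  · rintro ⟨hA, hC, H⟩
    refine ⟨hA, hC, ⟨hA.zinbiel, hC.zinbiel, ?_, ?_⟩, ⟨hA.preLie, hC.preLie, ?_, ?_⟩, ?_, ?_, ?_,
      ?_⟩ <;> intro a b <;> rw [tensor_eq_iff_dualTmul] <;> intro f g <;>
    simp only [map_add, map_sub, map_neg, map_zero, LinearMap.add_apply, LinearMap.sub_apply,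
      LinearMap.comp_apply, LinearMap.lTensor_add, LinearMap.lTensor_sub, dualTmul_rTensor,
      dualTmul_lTensor, dualTmul_tau, ← dualMul_apply]
    · linear_combination H.zinbiel₁ a b f g
    · linear_combination H.zinbiel₂ a b f g
    · linear_combination H.preLie₁ a b f g
    · linear_combination H.preLie₂ a b f g
    · linear_combination H.compat₁ a b f g
    · linear_combination H.compat₂ a b f g
    · linear_combination H.compat₃ a b f g
    · linear_combination H.compat₄ a b f g

end DualMul

/-! ### The induced Poisson algebra -/

section InducedAlgebra

variable {k : Type*} [Field k] {A : Type*} [AddCommGroup A] [Module k A]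
variable {Γ : Type*} {B : Type*} [AddCommGroup B] [Module k B]

@[simp]
lemma inducedMul_tmul (ast : A →ₗ[k] A →ₗ[k] A) (dia : B →ₗ[k] B →ₗ[k] B) (a a' : A) (b b' : B) :
    inducedMul ast dia (a ⊗ₜ b) (a' ⊗ₜ b') = ast a a' ⊗ₜ dia b b' + ast a' a ⊗ₜ dia b' b := rfl

@[simp]
lemma inducedBracket_tmul (circ : A →ₗ[k] A →ₗ[k] A) (dia : B →ₗ[k] B →ₗ[k] B) (a a' : A)
    (b b' : B) :
    inducedBracket circ dia (a ⊗ₜ b) (a' ⊗ₜ b') =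
      circ a a' ⊗ₜ dia b b' - circ a' a ⊗ₜ dia b' b := rfl

lemma map₂_flip_flip (f : A →ₗ[k] A →ₗ[k] A) (dia : B →ₗ[k] B →ₗ[k] B) (x y : A ⊗[k] B) :
    TensorProduct.map₂ f.flip dia.flip x y = TensorProduct.map₂ f dia y x := by
  rw [← LinearMap.flip_apply (TensorProduct.map₂ f dia)]
  revert x y
  simp only [← LinearMap.ext_iff]
  ext
  simp

lemma inducedMul_apply (ast : A →ₗ[k] A →ₗ[k] A) (dia : B →ₗ[k] B →ₗ[k] B) (x y : A ⊗[k] B) :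
    inducedMul ast dia x y = TensorProduct.map₂ ast dia x y + TensorProduct.map₂ ast dia y x := by
  simp only [inducedMul, LinearMap.add_apply, map₂_flip_flip]

lemma inducedBracket_apply (circ : A →ₗ[k] A →ₗ[k] A) (dia : B →ₗ[k] B →ₗ[k] B)
    (x y : A ⊗[k] B) :
    inducedBracket circ dia x y =
      TensorProduct.map₂ circ dia x y - TensorProduct.map₂ circ dia y x := by
  simp only [inducedBracket, LinearMap.sub_apply, map₂_flip_flip]

lemma inducedMul_comm (ast : A →ₗ[k] A →ₗ[k] A) (dia : B →ₗ[k] B →ₗ[k] B) (x y : A ⊗[k] B) :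
    inducedMul ast dia x y = inducedMul ast dia y x := by
  rw [inducedMul_apply, inducedMul_apply, add_comm]

lemma inducedBracket_self (circ : A →ₗ[k] A →ₗ[k] A) (dia : B →ₗ[k] B →ₗ[k] B) (x : A ⊗[k] B) :
    inducedBracket circ dia x x = 0 := by
  rw [inducedBracket_apply, sub_self]

lemma inducedBracket_comm (circ : A →ₗ[k] A →ₗ[k] A) (dia : B →ₗ[k] B →ₗ[k] B) (x y : A ⊗[k] B) :
    inducedBracket circ dia x y = -inducedBracket circ dia y x := by
  rw [inducedBracket_apply, inducedBracket_apply, neg_sub]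

variable {ℬ : Γ → Submodule k B}

variable (A) in
lemma tmul_mem_tensorGrading {i : Γ} {b : B} (hb : b ∈ ℬ i) (a : A) :
    a ⊗ₜ[k] b ∈ tensorGrading A ℬ i :=
  ⟨a ⊗ₜ ⟨b, hb⟩, by simp⟩

/-- Induction principle for the component `A ⊗ B i` of `A ⊗ B`. -/
lemma tensorGrading_induction {i : Γ} {motive : A ⊗[k] B → Prop} (zero : motive 0)
    (tmul : ∀ a, ∀ b ∈ ℬ i, motive (a ⊗ₜ b))
    (add : ∀ x y, motive x → motive y → motive (x + y)) {x : A ⊗[k] B}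
    (hx : x ∈ tensorGrading A ℬ i) : motive x := by
  obtain ⟨t, rfl⟩ := hx
  induction t with
  | zero => simpa using zero
  | tmul a b => simpa using tmul a b b.2
  | add s t hs ht => rw [map_add]; exact add _ _ hs ht

lemma finiteDimensional_tensorGrading [FiniteDimensional k A] (i : Γ)
    (h : FiniteDimensional k (ℬ i)) : FiniteDimensional k (tensorGrading A ℬ i) := by
  unfold tensorGrading
  infer_instance

variable [AddCommGroup Γ] {dia : B →ₗ[k] B →ₗ[k] B}

lemma inducedMul_assoc {ast : A →ₗ[k] A →ₗ[k] A} (hA : IsZinbielAlgebra ast)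
    (hB : IsGradedPerm ℬ dia) (x y z : A ⊗[k] B) :
    inducedMul ast dia (inducedMul ast dia x y) z =
      inducedMul ast dia x (inducedMul ast dia y z) := by
  induction x with
  | zero => simp
  | add x x' hx hx' => simp only [map_add, LinearMap.add_apply, hx, hx']
  | tmul a p =>
  induction y with
  | zero => simp
  | add y y' hy hy' => simp only [map_add, LinearMap.add_apply, hy, hy']
  | tmul b q =>
  induction z with
  | zero => simp
  | add z z' hz hz' => simp only [map_add, hz, hz']
  | tmul c r =>
  simp only [inducedMul_tmul, map_add, LinearMap.add_apply, hB.assoc, hA _ _ _,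
    TensorProduct.add_tmul]
  rw [hB.perm q p r, hB.perm r p q, hB.perm q r p]
  abel

lemma inducedBracket_leibniz {circ : A →ₗ[k] A →ₗ[k] A} (hA : IsPreLieAlgebra circ)
    (hB : IsGradedPerm ℬ dia) (x y z : A ⊗[k] B) :
    inducedBracket circ dia x (inducedBracket circ dia y z) =
      inducedBracket circ dia (inducedBracket circ dia x y) z +
        inducedBracket circ dia y (inducedBracket circ dia x z) := by
  induction x with
  | zero => simp
  | add x x' hx hx' => simp only [map_add, LinearMap.add_apply, hx, hx']; abel
  | tmul a p =>
  induction y with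
  | zero => simp
  | add y y' hy hy' => simp only [map_add, LinearMap.add_apply, hy, hy']; abel
  | tmul b q =>
  induction z with
  | zero => simp
  | add z z' hz hz' => simp only [map_add, hz, hz']; abel
  | tmul c r =>
  have h₁ := congrArg (· ⊗ₜ[k] dia (dia p q) r) (hA a b c)
  have h₂ := congrArg (· ⊗ₜ[k] dia (dia p r) q) (hA a c b)
  have h₃ := congrArg (· ⊗ₜ[k] dia (dia q r) p) (hA b c a)
  simp only [TensorProduct.sub_tmul] at h₁ h₂ h₃
  simp only [inducedBracket_tmul, map_sub, LinearMap.sub_apply, hB.assoc]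
  rw [hB.perm q p r, hB.perm r p q, hB.perm r q p]
  linear_combination (norm := module) -h₁ + h₂ - h₃

lemma inducedBracket_mul {ast circ : A →ₗ[k] A →ₗ[k] A} (hA : IsPrePoissonAlgebra ast circ)
    (hB : IsGradedPerm ℬ dia) (x y z : A ⊗[k] B) :
    inducedBracket circ dia x (inducedMul ast dia y z) =
      inducedMul ast dia (inducedBracket circ dia x y) z +
        inducedMul ast dia y (inducedBracket circ dia x z) := by
  induction x with
  | zero => simp
  | add x x' hx hx' => simp only [map_add, LinearMap.add_apply, hx, hx']; abel
  | tmul a p =>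
  induction y with
  | zero => simp
  | add y y' hy hy' => simp only [map_add, LinearMap.add_apply, hy, hy']; abel
  | tmul b q =>
  induction z with
  | zero => simp
  | add z z' hz hz' => simp only [map_add, hz, hz']; abel
  | tmul c r =>
  have h₁ := congrArg (· ⊗ₜ[k] dia (dia p q) r) (hA.compat₁ a b c)
  have h₂ := congrArg (· ⊗ₜ[k] dia (dia p r) q) (hA.compat₁ a c b)
  have h₃ := congrArg (· ⊗ₜ[k] dia (dia q r) p) (hA.compat₂ b c a)
  simp only [map_add, map_sub, LinearMap.add_apply, LinearMap.sub_apply, TensorProduct.sub_tmul,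
    TensorProduct.add_tmul] at h₁ h₂ h₃
  simp only [inducedBracket_tmul, inducedMul_tmul, map_add, map_sub, LinearMap.sub_apply,
    hB.assoc]
  rw [hB.perm q p r, hB.perm r p q, hB.perm r q p]
  linear_combination (norm := module) -h₁ - h₂ - h₃

lemma inducedBracket_jacobi {circ : A →ₗ[k] A →ₗ[k] A} (hA : IsPreLieAlgebra circ)
    (hB : IsGradedPerm ℬ dia) (x y z : A ⊗[k] B) :
    inducedBracket circ dia x (inducedBracket circ dia y z) +
      inducedBracket circ dia y (inducedBracket circ dia z x) +
        inducedBracket circ dia z (inducedBracket circ dia x y) = 0 := by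
  rw [inducedBracket_leibniz hA hB x y z, inducedBracket_comm circ dia z x,
    inducedBracket_comm circ dia z (inducedBracket circ dia x y), map_neg]
  abel

/-- Left multiplication by `e` fixes `e` and `n`, left multiplication by `n` annihilates `e`, and
`e`, `n` form a hyperbolic pair for `ω`. -/
structure IsUnitNilPair (dia : B →ₗ[k] B →ₗ[k] B) (ω : B →ₗ[k] B →ₗ[k] k) (e n : B) : Prop where
  unit_unit : dia e e = e
  unit_nil : dia e n = n
  nil_unit : dia n e = 0
  form_unit_nil : ω e n = 1
  form_nil_unit : ω n e = -1

/-- The Poisson identities of `A ⊗ B` on the elements `a ⊗ e` and `a ⊗ n` give back the identities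
of a pre-Poisson algebra: placing `n` at one position selects the products ending in that
position. Only the images under a map `C` with `C (a ⊗ n) = a` are needed. -/
lemma isPrePoissonAlgebra_of_unitNilPair {ast circ : A →ₗ[k] A →ₗ[k] A}
    {ω : B →ₗ[k] B →ₗ[k] k} {e n : B} (hen : IsUnitNilPair dia ω e n) (C : A ⊗[k] B →ₗ[k] A)
    (hC : ∀ a, C (a ⊗ₜ n) = a)
    (hassoc : ∀ a b c : A,
      C (inducedMul ast dia (inducedMul ast dia (a ⊗ₜ e) (b ⊗ₜ e)) (c ⊗ₜ n)) =
        C (inducedMul ast dia (a ⊗ₜ e) (inducedMul ast dia (b ⊗ₜ e) (c ⊗ₜ n))))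
    (hlie : ∀ a b c : A,
      C (inducedBracket circ dia (a ⊗ₜ e) (inducedBracket circ dia (b ⊗ₜ e) (c ⊗ₜ n))) =
        C (inducedBracket circ dia (inducedBracket circ dia (a ⊗ₜ e) (b ⊗ₜ e)) (c ⊗ₜ n)) +
          C (inducedBracket circ dia (b ⊗ₜ e) (inducedBracket circ dia (a ⊗ₜ e) (c ⊗ₜ n))))
    (hleib : ∀ (a b c : A) (p r : B), (p = e ∧ r = n) ∨ (p = n ∧ r = e) →
      C (inducedBracket circ dia (a ⊗ₜ p) (inducedMul ast dia (b ⊗ₜ e) (c ⊗ₜ r))) =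
        C (inducedMul ast dia (inducedBracket circ dia (a ⊗ₜ p) (b ⊗ₜ e)) (c ⊗ₜ r)) +
          C (inducedMul ast dia (b ⊗ₜ e) (inducedBracket circ dia (a ⊗ₜ p) (c ⊗ₜ r)))) :
    IsPrePoissonAlgebra ast circ where
  zinbiel a b c := by
    have := hassoc a b c
    simp only [inducedMul_tmul, hen.unit_unit, hen.unit_nil, hen.nil_unit, map_add,
      LinearMap.add_apply, TensorProduct.tmul_zero, add_zero, hC] at this
    exact this.symm
  preLie a b c := by
    have := hlie a b c
    simp only [inducedBracket_tmul, hen.unit_unit, hen.unit_nil, hen.nil_unit, map_sub,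
      LinearMap.sub_apply, TensorProduct.tmul_zero, sub_zero, hC] at this
    linear_combination (norm := module) -this
  compat₁ a b c := by
    have := hleib a b c e n (Or.inl ⟨rfl, rfl⟩)
    simp only [inducedBracket_tmul, inducedMul_tmul, hen.unit_unit, hen.unit_nil, hen.nil_unit,
      map_sub, LinearMap.sub_apply, TensorProduct.tmul_zero, sub_zero, add_zero, hC] at this
    simp only [map_sub, LinearMap.sub_apply]
    linear_combination (norm := module) -this
  compat₂ b c a := by
    have := hleib a b c n e (Or.inr ⟨rfl, rfl⟩)
    simp only [inducedBracket_tmul, inducedMul_tmul, hen.unit_unit, hen.unit_nil, hen.nil_unit,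
      map_add, TensorProduct.tmul_zero, add_zero, zero_sub, zero_add, map_neg,
      LinearMap.neg_apply, hC] at this
    simp only [map_add, LinearMap.add_apply]
    linear_combination (norm := module) -this

lemma map₂_mem_tensorGrading (hB : IsGradedProduct ℬ dia) (f : A →ₗ[k] A →ₗ[k] A) {i j : Γ}
    {x y : A ⊗[k] B} (hx : x ∈ tensorGrading A ℬ i) (hy : y ∈ tensorGrading A ℬ j) :
    TensorProduct.map₂ f dia x y ∈ tensorGrading A ℬ (i + j) := by
  refine tensorGrading_induction (motive := fun x => TensorProduct.map₂ f dia x y ∈ _) (by simp)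
    (fun a p hp => ?_) (fun x x' h h' => ?_) hx
  · refine tensorGrading_induction (motive := fun y => TensorProduct.map₂ f dia (a ⊗ₜ p) y ∈ _)
      (by simp) (fun b q hq => ?_) (fun y y' h h' => by rw [map_add]; exact add_mem h h') hy
    exact tmul_mem_tensorGrading A (hB.mul_mem i j p hp q hq) _
  · rw [map_add, LinearMap.add_apply]
    exact add_mem h h'

lemma isGradedProduct_inducedMul [FiniteDimensional k A] (hB : IsGradedProduct ℬ dia)
    (ast : A →ₗ[k] A →ₗ[k] A) : IsGradedProduct (tensorGrading A ℬ) (inducedMul ast dia) where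
  finite i := finiteDimensional_tensorGrading i (hB.finite i)
  mul_mem i j x hx y hy := by
    rw [inducedMul_apply]
    refine add_mem (map₂_mem_tensorGrading hB _ hx hy) ?_
    rw [add_comm i j]
    exact map₂_mem_tensorGrading hB _ hy hx

lemma isGradedProduct_inducedBracket [FiniteDimensional k A] (hB : IsGradedProduct ℬ dia)
    (circ : A →ₗ[k] A →ₗ[k] A) :
    IsGradedProduct (tensorGrading A ℬ) (inducedBracket circ dia) where
  finite i := finiteDimensional_tensorGrading i (hB.finite i)
  mul_mem i j x hx y hy := by
    rw [inducedBracket_apply]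
    refine sub_mem (map₂_mem_tensorGrading hB _ hx hy) ?_
    rw [add_comm i j]
    exact map₂_mem_tensorGrading hB _ hy hx

lemma isGradedPoisson_induced [FiniteDimensional k A] {ast circ : A →ₗ[k] A →ₗ[k] A}
    (hA : IsPrePoissonAlgebra ast circ) (hB : IsGradedPerm ℬ dia) :
    IsGradedPoisson (tensorGrading A ℬ) (inducedMul ast dia) (inducedBracket circ dia) where
  commAssoc := ⟨isGradedProduct_inducedMul hB.graded ast, inducedMul_comm ast dia,
    inducedMul_assoc hA.zinbiel hB⟩
  lie := ⟨isGradedProduct_inducedBracket hB.graded circ, inducedBracket_self circ dia,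
    inducedBracket_jacobi hA.preLie hB⟩
  leibniz := inducedBracket_mul hA hB

end InducedAlgebra

/-! ### Functionals on completed tensor products -/

section PairHat

variable {k : Type*} [Field k] {Γ : Type*} {V : Type*} [AddCommGroup V] [Module k V]
variable {𝒱 : Γ → Submodule k V}

/-- A functional that vanishes on all but finitely many homogeneous components. -/
def IsContinuousFunctional (𝒱 : Γ → Submodule k V) (α : Module.Dual k V) : Prop :=
  {p : Γ | α ∘ₗ (𝒱 p).subtype ≠ 0}.Finite

/-- A functional that vanishes on all homogeneous components of degree different from `i`. -/
def IsSupportedAt (𝒱 : Γ → Submodule k V) (i : Γ) (α : Module.Dual k V) : Prop :=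
  ∀ p, p ≠ i → α ∘ₗ (𝒱 p).subtype = 0

lemma IsSupportedAt.isContinuous {i : Γ} {α : Module.Dual k V} (hα : IsSupportedAt 𝒱 i α) :
    IsContinuousFunctional 𝒱 α :=
  (Set.finite_singleton i).subset fun p hp => by_contra fun h => hp (hα p h)

lemma IsContinuousFunctional.add {α β : Module.Dual k V} (hα : IsContinuousFunctional 𝒱 α)
    (hβ : IsContinuousFunctional 𝒱 β) : IsContinuousFunctional 𝒱 (α + β) := by
  refine (hα.union hβ).subset fun p hp => ?_
  by_contra h
  simp only [Set.mem_union, Set.mem_ofPred_eq, not_or, not_not] at h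
  exact hp (by rw [LinearMap.add_comp, h.1, h.2, add_zero])

lemma isContinuousFunctional_zero : IsContinuousFunctional 𝒱 0 := by
  simp [IsContinuousFunctional]

/-- The functional `α ⊗̂ β` on `V ⊗̂ V`, for `α` and `β` that vanish on all but finitely many
components. -/
noncomputable def pairHat (𝒱 : Γ → Submodule k V) (X : CompletedTensor 𝒱 𝒱)
    (α β : Module.Dual k V) : k :=
  ∑ᶠ p : Γ × Γ, dualTmul (α ∘ₗ (𝒱 p.1).subtype) (β ∘ₗ (𝒱 p.2).subtype) (X p.1 p.2)

lemma finite_pairHat_support (X : CompletedTensor 𝒱 𝒱) {α β : Module.Dual k V}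
    (hα : IsContinuousFunctional 𝒱 α) (hβ : IsContinuousFunctional 𝒱 β) :
    (Function.support fun p : Γ × Γ =>
      dualTmul (α ∘ₗ (𝒱 p.1).subtype) (β ∘ₗ (𝒱 p.2).subtype) (X p.1 p.2)).Finite := by
  refine (hα.prod hβ).subset fun p hp => ?_
  by_contra h
  simp only [Set.mem_prod, Set.mem_ofPred_eq, not_and_or, not_not] at h
  rcases h with h | h <;> exact hp (by simp [h])

lemma pairHat_add (X Y : CompletedTensor 𝒱 𝒱) {α β : Module.Dual k V}
    (hα : IsContinuousFunctional 𝒱 α) (hβ : IsContinuousFunctional 𝒱 β) :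
    pairHat 𝒱 (X + Y) α β = pairHat 𝒱 X α β + pairHat 𝒱 Y α β := by
  unfold pairHat
  rw [← finsum_add_distrib (finite_pairHat_support X hα hβ) (finite_pairHat_support Y hα hβ)]
  simp only [Pi.add_apply, map_add]

lemma pairHat_neg (X : CompletedTensor 𝒱 𝒱) (α β : Module.Dual k V) :
    pairHat 𝒱 (-X) α β = -pairHat 𝒱 X α β := by
  unfold pairHat
  rw [← finsum_neg_distrib]
  simp only [Pi.neg_apply, map_neg]

lemma pairHat_sub (X Y : CompletedTensor 𝒱 𝒱) {α β : Module.Dual k V}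
    (hα : IsContinuousFunctional 𝒱 α) (hβ : IsContinuousFunctional 𝒱 β) :
    pairHat 𝒱 (X - Y) α β = pairHat 𝒱 X α β - pairHat 𝒱 Y α β := by
  rw [sub_eq_add_neg, pairHat_add _ _ hα hβ, pairHat_neg, sub_eq_add_neg]

lemma pairHat_add_left (X : CompletedTensor 𝒱 𝒱) {α α' β : Module.Dual k V}
    (hα : IsContinuousFunctional 𝒱 α) (hα' : IsContinuousFunctional 𝒱 α')
    (hβ : IsContinuousFunctional 𝒱 β) :
    pairHat 𝒱 X (α + α') β = pairHat 𝒱 X α β + pairHat 𝒱 X α' β := by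
  unfold pairHat
  rw [← finsum_add_distrib (finite_pairHat_support X hα hβ) (finite_pairHat_support X hα' hβ)]
  simp only [LinearMap.add_comp, dualTmul_add_left, LinearMap.add_apply]

lemma pairHat_add_right (X : CompletedTensor 𝒱 𝒱) {α β β' : Module.Dual k V}
    (hα : IsContinuousFunctional 𝒱 α) (hβ : IsContinuousFunctional 𝒱 β)
    (hβ' : IsContinuousFunctional 𝒱 β') :
    pairHat 𝒱 X α (β + β') = pairHat 𝒱 X α β + pairHat 𝒱 X α β' := by
  unfold pairHat
  rw [← finsum_add_distrib (finite_pairHat_support X hα hβ) (finite_pairHat_support X hα hβ')]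
  simp only [LinearMap.add_comp, dualTmul_add_right, LinearMap.add_apply]

lemma pairHat_neg_left (X : CompletedTensor 𝒱 𝒱) (α β : Module.Dual k V) :
    pairHat 𝒱 X (-α) β = -pairHat 𝒱 X α β := by
  unfold pairHat
  rw [← finsum_neg_distrib]
  simp only [LinearMap.neg_comp, dualTmul_neg_left, LinearMap.neg_apply]

lemma pairHat_neg_right (X : CompletedTensor 𝒱 𝒱) (α β : Module.Dual k V) :
    pairHat 𝒱 X α (-β) = -pairHat 𝒱 X α β := by
  unfold pairHat
  rw [← finsum_neg_distrib]
  simp only [LinearMap.neg_comp, dualTmul_neg_right, LinearMap.neg_apply]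

@[simp]
lemma pairHat_zero (α β : Module.Dual k V) : pairHat 𝒱 0 α β = 0 := by
  simp [pairHat]

@[simp]
lemma pairHat_zero_left (X : CompletedTensor 𝒱 𝒱) (β : Module.Dual k V) :
    pairHat 𝒱 X 0 β = 0 := by
  simp [pairHat]

@[simp]
lemma pairHat_zero_right (X : CompletedTensor 𝒱 𝒱) (α : Module.Dual k V) :
    pairHat 𝒱 X α 0 = 0 := by
  simp [pairHat]

lemma pairHat_tauHat (X : CompletedTensor 𝒱 𝒱) (α β : Module.Dual k V) :
    pairHat 𝒱 (tauHat 𝒱 X) α β = pairHat 𝒱 X β α := by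
  unfold pairHat
  rw [← finsum_comp_equiv (Equiv.prodComm Γ Γ)]
  exact finsum_congr fun p => dualTmul_comm _ _ _

/-- Against a functional supported in a single degree, the sum defining `α ⊗̂ β` runs over one
index only. -/
lemma pairHat_eq_finsum (X : CompletedTensor 𝒱 𝒱) (α : Module.Dual k V) {j : Γ}
    {β : Module.Dual k V} (hβ : IsSupportedAt 𝒱 j β) :
    pairHat 𝒱 X α β =
      ∑ᶠ p : Γ, dualTmul (α ∘ₗ (𝒱 p).subtype) (β ∘ₗ (𝒱 j).subtype) (X p j) := by
  unfold pairHat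
  have hinj : Function.Injective fun p : Γ => (p, j) := fun p q h => congrArg Prod.fst h
  rw [← finsum_mem_univ, ← finsum_mem_range hinj
    (f := fun p : Γ × Γ =>
      dualTmul (α ∘ₗ (𝒱 p.1).subtype) (β ∘ₗ (𝒱 p.2).subtype) (X p.1 p.2))]
  refine finsum_mem_inter_support_eq' _ _ _ fun p hp => ⟨fun _ => ?_, fun _ => Set.mem_univ p⟩
  by_contra h
  have hpj : p.2 ≠ j := fun hpj => h ⟨p.1, Prod.ext rfl hpj.symm⟩
  exact hp (by simp [hβ p.2 hpj])

lemma pairHat_eq_finsum_right (X : CompletedTensor 𝒱 𝒱) {i : Γ} {α : Module.Dual k V}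
    (hα : IsSupportedAt 𝒱 i α) (β : Module.Dual k V) :
    pairHat 𝒱 X α β =
      ∑ᶠ p : Γ, dualTmul (α ∘ₗ (𝒱 i).subtype) (β ∘ₗ (𝒱 p).subtype) (X i p) := by
  rw [← pairHat_tauHat, pairHat_eq_finsum _ _ hα]
  exact finsum_congr fun p => dualTmul_comm _ _ _

lemma pairHat_eq_of_isSupportedAt (X : CompletedTensor 𝒱 𝒱) {i j : Γ} {α β : Module.Dual k V}
    (hα : IsSupportedAt 𝒱 i α) (hβ : IsSupportedAt 𝒱 j β) :
    pairHat 𝒱 X α β = dualTmul (α ∘ₗ (𝒱 i).subtype) (β ∘ₗ (𝒱 j).subtype) (X i j) := by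
  rw [pairHat_eq_finsum X α hβ]
  exact finsum_eq_single _ i fun p hp => by simp [hα p hp]

/-- Evaluation of `(Δ ⊗̂ id) X` on `(α ⊗ β) ⊗ γ`, in terms of the functional `φ = (α ⊗ β) ∘ Δ`. -/
lemma dualTmul_comulHatId {Δ : V →ₗ[k] CompletedTensor 𝒱 𝒱} (hΔ : IsCompletedComul 𝒱 Δ)
    (X : CompletedTensor 𝒱 𝒱) {i j l : Γ} {α β γ φ : Module.Dual k V}
    (hφ : ∀ v, φ v = dualTmul (α ∘ₗ (𝒱 i).subtype) (β ∘ₗ (𝒱 j).subtype) (Δ v i j))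
    (hγ : IsSupportedAt 𝒱 l γ) :
    dualTmul (dualTmul (α ∘ₗ (𝒱 i).subtype) (β ∘ₗ (𝒱 j).subtype)) (γ ∘ₗ (𝒱 l).subtype)
      (comulHatId 𝒱 Δ X i j l) = pairHat 𝒱 X φ γ := by
  rw [pairHat_eq_finsum X φ hγ, comulHatId, map_finsum]
  · refine finsum_congr fun p => ?_
    rw [dualTmul_rTensor]
    congr 2
    ext v
    exact (hφ v).symm
  · refine (hΔ i j).subset fun p hp => ?_
    by_contra h
    have h' : CompletedTensor.component 𝒱 𝒱 i j ∘ₗ Δ ∘ₗ (𝒱 p).subtype = 0 := by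
      ext v
      by_contra hv
      exact h ⟨v, v.2, hv⟩
    exact hp (by simp [h'])

/-- Evaluation of `(id ⊗̂ Δ) X` on `(α ⊗ β) ⊗ γ`, in terms of the functional `φ = (β ⊗ γ) ∘ Δ`. -/
lemma dualTmul_idHatComul {Δ : V →ₗ[k] CompletedTensor 𝒱 𝒱} (hΔ : IsCompletedComul 𝒱 Δ)
    (X : CompletedTensor 𝒱 𝒱) {i j l : Γ} {α β γ φ : Module.Dual k V}
    (hφ : ∀ v, φ v = dualTmul (β ∘ₗ (𝒱 j).subtype) (γ ∘ₗ (𝒱 l).subtype) (Δ v j l))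
    (hα : IsSupportedAt 𝒱 i α) :
    dualTmul (dualTmul (α ∘ₗ (𝒱 i).subtype) (β ∘ₗ (𝒱 j).subtype)) (γ ∘ₗ (𝒱 l).subtype)
      (idHatComul 𝒱 Δ X i j l) = pairHat 𝒱 X α φ := by
  rw [pairHat_eq_finsum_right X hα φ, idHatComul, map_finsum]
  · refine finsum_congr fun p => ?_
    rw [dualTmul_assoc_symm, dualTmul_lTensor]
    congr 2
    ext v
    exact (hφ v).symm
  · refine (hΔ j l).subset fun p hp => ?_
    by_contra h
    have h' : CompletedTensor.component 𝒱 𝒱 j l ∘ₗ Δ ∘ₗ (𝒱 p).subtype = 0 := by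
      ext v
      by_contra hv
      exact h ⟨v, v.2, hv⟩
    exact hp (by simp [h'])

lemma dualTmul_tauHatId (Y : CompletedTensor₃ 𝒱) (i j l : Γ) (α : Module.Dual k (𝒱 i))
    (β : Module.Dual k (𝒱 j)) (γ : Module.Dual k (𝒱 l)) :
    dualTmul (dualTmul α β) γ (tauHatId 𝒱 Y i j l) = dualTmul (dualTmul β α) γ (Y j i l) := by
  rw [tauHatId, dualTmul_rTensor]
  exact congrArg (fun φ => dualTmul φ γ (Y j i l)) (LinearMap.ext fun Z => dualTmul_comm α β Z)

lemma tauHat_idAddTauHat (X : CompletedTensor 𝒱 𝒱) :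
    tauHat 𝒱 (idAddTauHat 𝒱 X) = idAddTauHat 𝒱 X := by
  funext i j
  change TensorProduct.comm k _ _ (idAddTauHat 𝒱 X j i) = idAddTauHat 𝒱 X i j
  rw [idAddTauHat_apply, idAddTauHat_apply, map_add, TensorProduct.comm_comm, add_comm]

lemma tauHat_idSubTauHat (X : CompletedTensor 𝒱 𝒱) :
    tauHat 𝒱 (idSubTauHat 𝒱 X) = -idSubTauHat 𝒱 X := by
  funext i j
  change TensorProduct.comm k _ _ (idSubTauHat 𝒱 X j i) = -idSubTauHat 𝒱 X i j
  rw [idSubTauHat_apply, idSubTauHat_apply, map_sub, TensorProduct.comm_comm, neg_sub]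

lemma sub_tauHatId_eq_iff (X Y : CompletedTensor₃ 𝒱) :
    X - tauHatId 𝒱 X = Y ↔ X = Y + tauHatId 𝒱 X := by
  simp only [funext_iff, Pi.sub_apply, Pi.add_apply, sub_eq_iff_eq_add]

variable [DecidableEq Γ] [DirectSum.Decomposition 𝒱]

lemma gradedProj_of_mem {i : Γ} {v : V} (hv : v ∈ 𝒱 i) : gradedProj 𝒱 i v = ⟨v, hv⟩ := by
  lift v to 𝒱 i using hv
  simp [gradedProj]

lemma gradedProj_of_mem_ne {i p : Γ} (hpi : p ≠ i) {v : V} (hv : v ∈ 𝒱 p) :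
    gradedProj 𝒱 i v = 0 := by
  lift v to 𝒱 p using hv
  simp [gradedProj, DirectSum.component.of, hpi]

lemma IsSupportedAt.apply_gradedProj {i : Γ} {α : Module.Dual k V} (hα : IsSupportedAt 𝒱 i α)
    (v : V) : α (gradedProj 𝒱 i v) = α v := by
  induction v using DirectSum.Decomposition.inductionOn 𝒱 with
  | zero => simp
  | add v w hv hw => simp only [map_add, Submodule.coe_add, hv, hw]
  | @homogeneous p v =>
    by_cases hpi : p = i
    · subst hpi
      rw [gradedProj_of_mem v.2]
    · rw [gradedProj_of_mem_ne hpi v.2, Submodule.coe_zero, map_zero]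
      exact (LinearMap.congr_fun (hα p hpi) v).symm

/-- The operator `f ⊗̂ g` is the transpose of `α ⊗ β ↦ (α ∘ f) ⊗ (β ∘ g)`. -/
lemma pairHat_hatMap {f g : V →ₗ[k] V} {i j : Γ}
    (hf : {p | gradedProj 𝒱 i ∘ₗ f ∘ₗ (𝒱 p).subtype ≠ 0}.Finite)
    (hg : {p | gradedProj 𝒱 j ∘ₗ g ∘ₗ (𝒱 p).subtype ≠ 0}.Finite) (X : CompletedTensor 𝒱 𝒱)
    {α β : Module.Dual k V} (hα : IsSupportedAt 𝒱 i α) (hβ : IsSupportedAt 𝒱 j β) :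
    pairHat 𝒱 (hatMap 𝒱 𝒱 𝒱 𝒱 f g X) α β = pairHat 𝒱 X (α ∘ₗ f) (β ∘ₗ g) := by
  rw [pairHat_eq_of_isSupportedAt _ hα hβ, hatMap, map_finsum]
  · refine finsum_congr fun p => ?_
    rw [dualTmul_map]
    congr 2
    · ext v
      exact hα.apply_gradedProj _
    · ext v
      exact hβ.apply_gradedProj _
  · refine (hf.prod hg).subset fun p hp => ?_
    by_contra h
    simp only [Set.mem_prod, Set.mem_ofPred_eq, not_and_or, not_not] at h
    rcases h with h | h <;> exact hp (by simp [h])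

lemma finite_gradedProj_id (i : Γ) :
    {p | gradedProj 𝒱 i ∘ₗ LinearMap.id ∘ₗ (𝒱 p).subtype ≠ 0}.Finite := by
  refine (Set.finite_singleton i).subset fun p hp => ?_
  by_contra h
  have h₀ : gradedProj 𝒱 i ∘ₗ LinearMap.id ∘ₗ (𝒱 p).subtype = 0 :=
    LinearMap.ext fun v => (gradedProj_of_mem_ne h v.2 :)
  exact hp h₀

lemma finite_gradedProj_mul [AddCommGroup Γ] {mul : V →ₗ[k] V →ₗ[k] V}
    (hmul : IsGradedProduct 𝒱 mul) (x : V) (i : Γ) :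
    {p | gradedProj 𝒱 i ∘ₗ mul x ∘ₗ (𝒱 p).subtype ≠ 0}.Finite := by
  induction x using DirectSum.Decomposition.inductionOn 𝒱 with
  | zero => simp
  | @homogeneous d x =>
    refine (Set.finite_singleton (i - d)).subset fun p hp => ?_
    by_contra h
    have hdp : d + p ≠ i := fun hdp => h (by rw [Set.mem_singleton_iff, ← hdp]; abel)
    have h₀ : gradedProj 𝒱 i ∘ₗ mul x ∘ₗ (𝒱 p).subtype = 0 :=
      LinearMap.ext fun v => (gradedProj_of_mem_ne hdp (hmul.mul_mem d p x x.2 v v.2) :)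
    exact hp h₀
  | add x y hx hy =>
    refine (hx.union hy).subset fun p hp => ?_
    by_contra h
    simp only [Set.mem_union, Set.mem_ofPred_eq, not_or, not_not] at h
    have h₀ : gradedProj 𝒱 i ∘ₗ mul (x + y) ∘ₗ (𝒱 p).subtype = 0 := by
      rw [map_add, LinearMap.add_comp, LinearMap.comp_add, h.1, h.2, add_zero]
    exact hp h₀

lemma pairHat_leftOp [AddCommGroup Γ] {mul : V →ₗ[k] V →ₗ[k] V} (hmul : IsGradedProduct 𝒱 mul)
    (x : V) (X : CompletedTensor 𝒱 𝒱) {i j : Γ} {α β : Module.Dual k V}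
    (hα : IsSupportedAt 𝒱 i α) (hβ : IsSupportedAt 𝒱 j β) :
    pairHat 𝒱 (leftOp 𝒱 (mul x) X) α β = pairHat 𝒱 X (α ∘ₗ mul x) β :=
  pairHat_hatMap (finite_gradedProj_mul hmul x i) (finite_gradedProj_id j) X hα hβ

lemma pairHat_rightOp [AddCommGroup Γ] {mul : V →ₗ[k] V →ₗ[k] V} (hmul : IsGradedProduct 𝒱 mul)
    (x : V) (X : CompletedTensor 𝒱 𝒱) {i j : Γ} {α β : Module.Dual k V}
    (hα : IsSupportedAt 𝒱 i α) (hβ : IsSupportedAt 𝒱 j β) :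
    pairHat 𝒱 (rightOp 𝒱 (mul x) X) α β = pairHat 𝒱 X α (β ∘ₗ mul x) :=
  pairHat_hatMap (finite_gradedProj_id i) (finite_gradedProj_mul hmul x j) X hα hβ

end PairHat

/-! ### The pairing between `A ⊗ B` and `A* ⊗ B` -/

section TensorForm

variable {k : Type*} [Field k] {A : Type*} [AddCommGroup A] [Module k A]
variable {Γ : Type*} {B : Type*} [AddCommGroup B] [Module k B]

/-- The pairing of `A* ⊗ B` with `A ⊗ B` which sends `f ⊗ y` to the functional
`a ⊗ b ↦ f a * ω b y`. -/
noncomputable def tensorForm (A : Type*) [AddCommGroup A] [Module k A] (ω : B →ₗ[k] B →ₗ[k] k) :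
    Module.Dual k A ⊗[k] B →ₗ[k] Module.Dual k (A ⊗[k] B) :=
  TensorProduct.dualDistrib k A B ∘ₗ ω.flip.lTensor (Module.Dual k A)

@[simp]
lemma tensorForm_tmul (ω : B →ₗ[k] B →ₗ[k] k) (f : Module.Dual k A) (y : B) (a : A) (b : B) :
    tensorForm A ω (f ⊗ₜ y) (a ⊗ₜ b) = f a * ω b y := rfl

/-- The bilinear product `N` on `A* ⊗ B` is the negative of the dual of the completed
comultiplication `Δ` of `A ⊗ B`. The sign is the one in the definition of `ν_ω`. -/
def IsDualProduct (ℬ : Γ → Submodule k B) (ω : B →ₗ[k] B →ₗ[k] k)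
    (Δ : A ⊗[k] B →ₗ[k] CompletedTensor (tensorGrading A ℬ) (tensorGrading A ℬ))
    (N : Module.Dual k A ⊗[k] B →ₗ[k] Module.Dual k A ⊗[k] B →ₗ[k] Module.Dual k A ⊗[k] B) :
    Prop :=
  ∀ x s t, pairHat (tensorGrading A ℬ) (Δ x) (tensorForm A ω s) (tensorForm A ω t) =
    -tensorForm A ω (N s t) x

variable {ℬ : Γ → Submodule k B} {ω : B →ₗ[k] B →ₗ[k] k}

/-- The value of `(f ⊗ y) ⊗ (g ⊗ z)` on `X • Y`. -/
lemma dualTmul_tensorForm_bullet (f g : Module.Dual k A) (y z : B) (i j : Γ) (X : A ⊗[k] A)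
    (Y : ℬ i ⊗[k] ℬ j) :
    dualTmul (tensorForm A ω (f ⊗ₜ y) ∘ₗ (tensorGrading A ℬ i).subtype)
        (tensorForm A ω (g ⊗ₜ z) ∘ₗ (tensorGrading A ℬ j).subtype)
        (TensorProduct.map (toTensorGrading A ℬ i) (toTensorGrading A ℬ j)
          (TensorProduct.tensorTensorTensorComm k A A (ℬ i) (ℬ j) (X ⊗ₜ Y))) =
      dualTmul f g X * omegaPair ℬ ω y z i j Y := by
  induction X with
  | zero => simp
  | add X X' h h' => simp only [TensorProduct.add_tmul, map_add, h, h', add_mul]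
  | tmul a a' =>
  induction Y with
  | zero => simp
  | add Y Y' h h' => simp only [TensorProduct.tmul_add, map_add, h, h', mul_add]
  | tmul b b' =>
  change f a * ω b y * (g a' * ω b' z) = f a * g a' * (ω b y * ω b' z)
  ring

/-- On homogeneous components the pairing is induced by the restriction of `ω`. -/
lemma lTensor_subtype_tensorForm (i j : Γ) (s : Module.Dual k A ⊗[k] ℬ j) (u : A ⊗[k] ℬ i) :
    tensorForm A ω ((ℬ j).subtype.lTensor _ s) ((ℬ i).subtype.lTensor A u) =
      TensorProduct.dualDistrib k A (ℬ i)
        ((ω.domRestrict₁₂ (ℬ i) (ℬ j)).flip.lTensor (Module.Dual k A) s) u := by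
  induction s with
  | zero => simp
  | add s s' h h' => simp only [map_add, LinearMap.add_apply, h, h']
  | tmul f y =>
  induction u with
  | zero => simp
  | add u u' h h' => simp only [map_add, h, h']
  | tmul a b => rfl

variable [AddCommGroup Γ] {m : Γ}

/-- The pairing of homogeneous elements vanishes unless their degrees add up to `-m`. -/
lemma tensorForm_apply_eq_zero
    (hm : ∀ i j, i + j + m ≠ 0 → ∀ x ∈ ℬ i, ∀ y ∈ ℬ j, ω x y = 0) {d p : Γ} (hdp : p + d + m ≠ 0)
    {s : Module.Dual k A ⊗[k] B} (hs : s ∈ tensorGrading (Module.Dual k A) ℬ d) {x : A ⊗[k] B}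
    (hx : x ∈ tensorGrading A ℬ p) : tensorForm A ω s x = 0 := by
  refine tensorGrading_induction (motive := fun s => tensorForm A ω s x = 0) (by simp)
    (fun f y hy => ?_) (fun s t h h' => by rw [map_add, LinearMap.add_apply, h, h', add_zero]) hs
  refine tensorGrading_induction (motive := fun x => tensorForm A ω (f ⊗ₜ y) x = 0) (by simp)
    (fun a b hb => ?_) (fun x x' h h' => by rw [map_add, h, h', add_zero]) hx
  rw [tensorForm_tmul, hm p d hdp b hb y hy, mul_zero]

lemma isSupportedAt_tensorForm
    (hm : ∀ i j, i + j + m ≠ 0 → ∀ x ∈ ℬ i, ∀ y ∈ ℬ j, ω x y = 0) {d i : Γ} (hdi : d = -m - i)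
    {s : Module.Dual k A ⊗[k] B} (hs : s ∈ tensorGrading (Module.Dual k A) ℬ d) :
    IsSupportedAt (tensorGrading A ℬ) i (tensorForm A ω s) := by
  subst hdi
  refine fun p hp => LinearMap.ext fun x => tensorForm_apply_eq_zero hm (fun h => hp ?_) hs x.2
  rw [← sub_eq_zero, ← h]
  abel

variable [DecidableEq Γ] [DirectSum.Decomposition ℬ]

lemma isContinuousFunctional_tensorForm
    (hm : ∀ i j, i + j + m ≠ 0 → ∀ x ∈ ℬ i, ∀ y ∈ ℬ j, ω x y = 0) (s : Module.Dual k A ⊗[k] B) :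
    IsContinuousFunctional (tensorGrading A ℬ) (tensorForm A ω s) := by
  induction s with
  | zero => rw [map_zero]; exact isContinuousFunctional_zero
  | add s t hs ht => rw [map_add]; exact hs.add ht
  | tmul f y =>
    induction y using DirectSum.Decomposition.inductionOn ℬ with
    | zero => rw [TensorProduct.tmul_zero, map_zero]; exact isContinuousFunctional_zero
    | add y z hy hz => rw [TensorProduct.tmul_add, map_add]; exact hy.add hz
    | @homogeneous p y =>
      exact (isSupportedAt_tensorForm hm (i := -m - p) (by abel)
        (tmul_mem_tensorGrading _ y.2 f)).isContinuous

variable {dia : B →ₗ[k] B →ₗ[k] B}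

/-- Every functional on `(A ⊗ B) i` comes from `(A* ⊗ B) (-m - i)`. -/
lemma exists_tensorForm_eq [FiniteDimensional k A] (hB : IsQuadraticGradedPerm ℬ dia ω)
    (hm : ∀ i j, i + j + m ≠ 0 → ∀ x ∈ ℬ i, ∀ y ∈ ℬ j, ω x y = 0) (i : Γ)
    (α : Module.Dual k (tensorGrading A ℬ i)) :
    ∃ s ∈ tensorGrading (Module.Dual k A) ℬ (-m - i),
      tensorForm A ω s ∘ₗ (tensorGrading A ℬ i).subtype = α := by
  have := hB.perm.graded.finite i
  have hperf := isPerfPair_restrict hB hm i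
  obtain ⟨t, ht⟩ := (TensorProduct.dualDistribEquiv k A (ℬ i)).surjective
    (α ∘ₗ toTensorGrading A ℬ i)
  obtain ⟨s, rfl⟩ := LinearMap.lTensor_surjective (Module.Dual k A)
    (LinearMap.IsPerfPair.bijective_right (ω.domRestrict₁₂ (ℬ i) (ℬ (-m - i)))).2 t
  refine ⟨(ℬ (-m - i)).subtype.lTensor _ s, ⟨s, rfl⟩, ?_⟩
  ext ⟨_, u, rfl⟩
  exact (lTensor_subtype_tensorForm i (-m - i) s u).trans (LinearMap.congr_fun ht u)

/-- Elements of `(A ⊗ B) i ⊗ (A ⊗ B) j` are separated by elements of `A* ⊗ B`. -/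
lemma completedTensor_eq_iff [FiniteDimensional k A] (hB : IsQuadraticGradedPerm ℬ dia ω)
    (hm : ∀ i j, i + j + m ≠ 0 → ∀ x ∈ ℬ i, ∀ y ∈ ℬ j, ω x y = 0)
    {X Y : CompletedTensor (tensorGrading A ℬ) (tensorGrading A ℬ)} (i j : Γ) :
    X i j = Y i j ↔ ∀ s ∈ tensorGrading (Module.Dual k A) ℬ (-m - i),
      ∀ t ∈ tensorGrading (Module.Dual k A) ℬ (-m - j),
        pairHat (tensorGrading A ℬ) X (tensorForm A ω s) (tensorForm A ω t) =
          pairHat (tensorGrading A ℬ) Y (tensorForm A ω s) (tensorForm A ω t) := by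
  have hfin := fun p => finiteDimensional_tensorGrading (A := A) p (hB.perm.graded.finite p)
  rw [tensor_eq_iff_dualTmul]
  constructor
  · intro h s hs t ht
    rw [pairHat_eq_of_isSupportedAt X (isSupportedAt_tensorForm hm rfl hs)
      (isSupportedAt_tensorForm hm rfl ht), h, pairHat_eq_of_isSupportedAt Y
      (isSupportedAt_tensorForm hm rfl hs) (isSupportedAt_tensorForm hm rfl ht)]
  · intro h α β
    obtain ⟨s, hs, rfl⟩ := exists_tensorForm_eq hB hm i α
    obtain ⟨t, ht, rfl⟩ := exists_tensorForm_eq hB hm j β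
    rw [← pairHat_eq_of_isSupportedAt X (isSupportedAt_tensorForm hm rfl hs)
      (isSupportedAt_tensorForm hm rfl ht), h s hs t ht, pairHat_eq_of_isSupportedAt Y
      (isSupportedAt_tensorForm hm rfl hs) (isSupportedAt_tensorForm hm rfl ht)]

lemma completedTensor₃_eq_iff [FiniteDimensional k A] (hB : IsQuadraticGradedPerm ℬ dia ω)
    (hm : ∀ i j, i + j + m ≠ 0 → ∀ x ∈ ℬ i, ∀ y ∈ ℬ j, ω x y = 0)
    {X Y : CompletedTensor₃ (tensorGrading A ℬ)} :
    X = Y ↔ ∀ i j l, ∀ s ∈ tensorGrading (Module.Dual k A) ℬ (-m - i),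
      ∀ t ∈ tensorGrading (Module.Dual k A) ℬ (-m - j),
      ∀ u ∈ tensorGrading (Module.Dual k A) ℬ (-m - l),
        dualTmul (dualTmul (tensorForm A ω s ∘ₗ (tensorGrading A ℬ i).subtype)
          (tensorForm A ω t ∘ₗ (tensorGrading A ℬ j).subtype))
          (tensorForm A ω u ∘ₗ (tensorGrading A ℬ l).subtype) (X i j l) =
        dualTmul (dualTmul (tensorForm A ω s ∘ₗ (tensorGrading A ℬ i).subtype)
          (tensorForm A ω t ∘ₗ (tensorGrading A ℬ j).subtype))
          (tensorForm A ω u ∘ₗ (tensorGrading A ℬ l).subtype) (Y i j l) := by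
  have hfin := fun p => finiteDimensional_tensorGrading (A := A) p (hB.perm.graded.finite p)
  constructor
  · rintro rfl
    intros
    rfl
  · refine fun h => funext fun i => funext fun j => funext fun l =>
      tensor₃_eq_iff_dualTmul.2 fun α β γ => ?_
    obtain ⟨s, hs, rfl⟩ := exists_tensorForm_eq hB hm i α
    obtain ⟨t, ht, rfl⟩ := exists_tensorForm_eq hB hm j β
    obtain ⟨u, hu, rfl⟩ := exists_tensorForm_eq hB hm l γ
    exact h i j l s hs t ht u hu

lemma pairHat_bullet (hB : IsQuadraticGradedPerm ℬ dia ω)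
    (hm : ∀ i j, i + j + m ≠ 0 → ∀ x ∈ ℬ i, ∀ y ∈ ℬ j, ω x y = 0) (ϑ : A →ₗ[k] A ⊗[k] A)
    (x : A ⊗[k] B) (s t : Module.Dual k A ⊗[k] B) :
    pairHat (tensorGrading A ℬ) (bullet ℬ ϑ (nuOmega hB) x) (tensorForm A ω s)
      (tensorForm A ω t) = -tensorForm A ω (TensorProduct.map₂ (dualMul ϑ) dia s t) x := by
  have hc := fun s => isContinuousFunctional_tensorForm (A := A) hm s
  induction x with
  | zero => simp
  | add x x' h h' => rw [map_add, pairHat_add _ _ (hc s) (hc t), h, h', map_add, neg_add]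
  | tmul a b =>
  induction s with
  | zero => simp
  | add s s' h h' =>
    rw [map_add, pairHat_add_left _ (hc s) (hc s') (hc t), h, h', map_add, LinearMap.add_apply,
      map_add, LinearMap.add_apply, neg_add]
  | tmul f y =>
  induction t with
  | zero => simp
  | add t t' h h' =>
    rw [map_add, pairHat_add_right _ (hc _) (hc t) (hc t'), h, h', map_add, map_add,
      LinearMap.add_apply, neg_add]
  | tmul g z =>
  rw [TensorProduct.map₂_apply_tmul, TensorProduct.map_tmul, tensorForm_tmul, dualMul_apply,
    ← mul_neg, ← omegaHat_nuOmega hB, omegaHat, mul_finsum]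
  exact finsum_congr fun p => dualTmul_tensorForm_bullet f g y z p.1 p.2 (ϑ a) _

lemma isDualProduct_inducedDelta (hB : IsQuadraticGradedPerm ℬ dia ω) (ϑ : A →ₗ[k] A ⊗[k] A) :
    IsDualProduct ℬ ω (inducedDelta ℬ ϑ (nuOmega hB)) (inducedMul (dualMul ϑ) dia) := by
  obtain ⟨m, hm⟩ := hB.graded
  intro x s t
  have hc := fun s => isContinuousFunctional_tensorForm (A := A) hm s
  change pairHat _ (bullet ℬ ϑ (nuOmega hB) x + tauHat _ (bullet ℬ ϑ (nuOmega hB) x)) _ _ = _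
  rw [pairHat_add _ _ (hc s) (hc t), pairHat_tauHat, pairHat_bullet hB hm, pairHat_bullet hB hm,
    inducedMul_apply, map_add, LinearMap.add_apply, neg_add]

lemma isDualProduct_inducedCobracket (hB : IsQuadraticGradedPerm ℬ dia ω)
    (θ : A →ₗ[k] A ⊗[k] A) :
    IsDualProduct ℬ ω (inducedCobracket ℬ θ (nuOmega hB)) (inducedBracket (dualMul θ) dia) := by
  obtain ⟨m, hm⟩ := hB.graded
  intro x s t
  have hc := fun s => isContinuousFunctional_tensorForm (A := A) hm s
  change pairHat _ (bullet ℬ θ (nuOmega hB) x - tauHat _ (bullet ℬ θ (nuOmega hB) x)) _ _ = _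
  rw [pairHat_sub _ _ (hc s) (hc t), pairHat_tauHat, pairHat_bullet hB hm, pairHat_bullet hB hm,
    inducedBracket_apply, map_sub, LinearMap.sub_apply, neg_sub, neg_sub_neg]

/-- A comultiplication with a graded dual product has finite components. -/
lemma IsDualProduct.isCompletedComul [FiniteDimensional k A] (hB : IsQuadraticGradedPerm ℬ dia ω)
    {Δ : A ⊗[k] B →ₗ[k] CompletedTensor (tensorGrading A ℬ) (tensorGrading A ℬ)}
    {N : Module.Dual k A ⊗[k] B →ₗ[k] Module.Dual k A ⊗[k] B →ₗ[k] Module.Dual k A ⊗[k] B}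
    (hΔ : IsDualProduct ℬ ω Δ N) (hN : IsGradedProduct (tensorGrading (Module.Dual k A) ℬ) N) :
    IsCompletedComul (tensorGrading A ℬ) Δ := by
  obtain ⟨m, hm⟩ := hB.graded
  refine fun i j => (Set.finite_singleton (i + j + m)).subset ?_
  rintro p ⟨x, hx, hne⟩
  by_contra hp
  refine hne ((completedTensor_eq_iff hB hm (Y := 0) i j).2 fun s hs t ht => ?_)
  rw [hΔ x s t, pairHat_zero, neg_eq_zero]
  refine tensorForm_apply_eq_zero hm (fun h => hp ?_) (hN.mul_mem _ _ s hs t ht) hx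
  rw [Set.mem_singleton_iff, ← sub_eq_zero, ← h]
  abel

end TensorForm

/-! ### The induced Poisson coalgebra -/

section InducedCoalgebra

variable {k : Type*} [Field k] {A : Type*} [AddCommGroup A] [Module k A]
variable {Γ : Type*} {B : Type*} [AddCommGroup B] [Module k B]
variable {ℬ : Γ → Submodule k B} {ω : B →ₗ[k] B →ₗ[k] k} {dia : B →ₗ[k] B →ₗ[k] B}
variable {Δ₁ Δ₂ : A ⊗[k] B →ₗ[k] CompletedTensor (tensorGrading A ℬ) (tensorGrading A ℬ)}
variable {N₁ N₂ : Module.Dual k A ⊗[k] B →ₗ[k] Module.Dual k A ⊗[k] B →ₗ[k]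
  Module.Dual k A ⊗[k] B}

/-- The value of `(s ⊗ t) ⊗ u`, for `s`, `t`, `u` in `A* ⊗ B`, on the component of degree
`(i, j, l)` of an element of `(A ⊗ B) ⊗̂ (A ⊗ B) ⊗̂ (A ⊗ B)`. -/
noncomputable def tripleForm (ω : B →ₗ[k] B →ₗ[k] k) (i j l : Γ) (s t u : Module.Dual k A ⊗[k] B)
    (Y : CompletedTensor₃ (tensorGrading A ℬ)) : k :=
  dualTmul (dualTmul (tensorForm A ω s ∘ₗ (tensorGrading A ℬ i).subtype)
    (tensorForm A ω t ∘ₗ (tensorGrading A ℬ j).subtype))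
    (tensorForm A ω u ∘ₗ (tensorGrading A ℬ l).subtype) (Y i j l)

lemma tripleForm_add (i j l : Γ) (s t u : Module.Dual k A ⊗[k] B)
    (X Y : CompletedTensor₃ (tensorGrading A ℬ)) :
    tripleForm ω i j l s t u (X + Y) = tripleForm ω i j l s t u X + tripleForm ω i j l s t u Y :=
  map_add _ (X i j l) (Y i j l)

lemma tripleForm_tauHatId (i j l : Γ) (s t u : Module.Dual k A ⊗[k] B)
    (Y : CompletedTensor₃ (tensorGrading A ℬ)) :
    tripleForm ω i j l s t u (tauHatId _ Y) = tripleForm ω j i l t s u Y :=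
  dualTmul_tauHatId Y i j l _ _ _

variable [AddCommGroup Γ] {m : Γ}

lemma tripleForm_comulHatId (hm : ∀ i j, i + j + m ≠ 0 → ∀ x ∈ ℬ i, ∀ y ∈ ℬ j, ω x y = 0)
    (h₁ : IsDualProduct ℬ ω Δ₁ N₁) (h₂ : IsDualProduct ℬ ω Δ₂ N₂)
    (hΔ : IsCompletedComul (tensorGrading A ℬ) Δ₁) {i j l : Γ} {s t u : Module.Dual k A ⊗[k] B}
    (hs : s ∈ tensorGrading (Module.Dual k A) ℬ (-m - i))
    (ht : t ∈ tensorGrading (Module.Dual k A) ℬ (-m - j))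
    (hu : u ∈ tensorGrading (Module.Dual k A) ℬ (-m - l)) (x : A ⊗[k] B) :
    tripleForm ω i j l s t u (comulHatId _ Δ₁ (Δ₂ x)) = tensorForm A ω (N₂ (N₁ s t) u) x := by
  rw [tripleForm, dualTmul_comulHatId hΔ (φ := -tensorForm A ω (N₁ s t)) (Δ₂ x) (fun v => ?_)
    (isSupportedAt_tensorForm hm rfl hu), pairHat_neg_left, h₂ x, neg_neg]
  rw [LinearMap.neg_apply, ← h₁, pairHat_eq_of_isSupportedAt _
    (isSupportedAt_tensorForm hm rfl hs) (isSupportedAt_tensorForm hm rfl ht)]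

lemma tripleForm_idHatComul (hm : ∀ i j, i + j + m ≠ 0 → ∀ x ∈ ℬ i, ∀ y ∈ ℬ j, ω x y = 0)
    (h₁ : IsDualProduct ℬ ω Δ₁ N₁) (h₂ : IsDualProduct ℬ ω Δ₂ N₂)
    (hΔ : IsCompletedComul (tensorGrading A ℬ) Δ₁) {i j l : Γ} {s t u : Module.Dual k A ⊗[k] B}
    (hs : s ∈ tensorGrading (Module.Dual k A) ℬ (-m - i))
    (ht : t ∈ tensorGrading (Module.Dual k A) ℬ (-m - j))
    (hu : u ∈ tensorGrading (Module.Dual k A) ℬ (-m - l)) (x : A ⊗[k] B) :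
    tripleForm ω i j l s t u (idHatComul _ Δ₁ (Δ₂ x)) = tensorForm A ω (N₂ s (N₁ t u)) x := by
  rw [tripleForm, dualTmul_idHatComul hΔ (φ := -tensorForm A ω (N₁ t u)) (Δ₂ x) (fun v => ?_)
    (isSupportedAt_tensorForm hm rfl hs), pairHat_neg_right, h₂ x, neg_neg]
  rw [LinearMap.neg_apply, ← h₁, pairHat_eq_of_isSupportedAt _
    (isSupportedAt_tensorForm hm rfl ht) (isSupportedAt_tensorForm hm rfl hu)]

variable [DecidableEq Γ] [DirectSum.Decomposition ℬ] [FiniteDimensional k A]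

/-- An identity in `(A ⊗ B) ⊗̂ (A ⊗ B) ⊗̂ (A ⊗ B)` may be tested on homogeneous elements of
`A* ⊗ B`. -/
lemma completedTensor₃_eq_iff_homogeneous (hB : IsQuadraticGradedPerm ℬ dia ω)
    (hm : ∀ i j, i + j + m ≠ 0 → ∀ x ∈ ℬ i, ∀ y ∈ ℬ j, ω x y = 0)
    {X Y : CompletedTensor₃ (tensorGrading A ℬ)}
    {F G : Module.Dual k A ⊗[k] B → Module.Dual k A ⊗[k] B → Module.Dual k A ⊗[k] B → k}
    (hF : ∀ i j l, ∀ s ∈ tensorGrading (Module.Dual k A) ℬ (-m - i),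
      ∀ t ∈ tensorGrading (Module.Dual k A) ℬ (-m - j),
      ∀ u ∈ tensorGrading (Module.Dual k A) ℬ (-m - l), tripleForm ω i j l s t u X = F s t u)
    (hG : ∀ i j l, ∀ s ∈ tensorGrading (Module.Dual k A) ℬ (-m - i),
      ∀ t ∈ tensorGrading (Module.Dual k A) ℬ (-m - j),
      ∀ u ∈ tensorGrading (Module.Dual k A) ℬ (-m - l), tripleForm ω i j l s t u Y = G s t u) :
    X = Y ↔ ∀ s t u, SetLike.IsHomogeneousElem (tensorGrading (Module.Dual k A) ℬ) s →
      SetLike.IsHomogeneousElem (tensorGrading (Module.Dual k A) ℬ) t →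
      SetLike.IsHomogeneousElem (tensorGrading (Module.Dual k A) ℬ) u → F s t u = G s t u := by
  rw [completedTensor₃_eq_iff hB hm]
  constructor
  · rintro h s t u ⟨d₁, hs⟩ ⟨d₂, ht⟩ ⟨d₃, hu⟩
    have hd : ∀ d : Γ, d = -m - (-m - d) := fun d => by abel
    rw [hd d₁] at hs
    rw [hd d₂] at ht
    rw [hd d₃] at hu
    rw [← hF _ _ _ s hs t ht u hu, ← hG _ _ _ s hs t ht u hu]
    exact h _ _ _ s hs t ht u hu
  · intro h i j l s hs t ht u hu
    exact (hF i j l s hs t ht u hu).trans ((h s t u ⟨_, hs⟩ ⟨_, ht⟩ ⟨_, hu⟩).trans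
      (hG i j l s hs t ht u hu).symm)

section Axioms

variable (hB : IsQuadraticGradedPerm ℬ dia ω)
include hB

/-- Coassociativity is associativity of the dual product. -/
lemma coassoc_iff (h₁ : IsDualProduct ℬ ω Δ₁ N₁) (hΔ : IsCompletedComul (tensorGrading A ℬ) Δ₁)
    (x : A ⊗[k] B) :
    comulHatId _ Δ₁ (Δ₁ x) = idHatComul _ Δ₁ (Δ₁ x) ↔
      ∀ s t u, SetLike.IsHomogeneousElem (tensorGrading (Module.Dual k A) ℬ) s →
        SetLike.IsHomogeneousElem (tensorGrading (Module.Dual k A) ℬ) t →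
        SetLike.IsHomogeneousElem (tensorGrading (Module.Dual k A) ℬ) u →
          tensorForm A ω (N₁ (N₁ s t) u) x = tensorForm A ω (N₁ s (N₁ t u)) x := by
  obtain ⟨m, hm⟩ := hB.graded
  exact completedTensor₃_eq_iff_homogeneous hB hm
    (fun _ _ _ s hs t ht u hu => tripleForm_comulHatId hm h₁ h₁ hΔ hs ht hu x)
    (fun _ _ _ s hs t ht u hu => tripleForm_idHatComul hm h₁ h₁ hΔ hs ht hu x)

/-- The co-Leibniz rule is the Leibniz rule of the dual products. For `Δ₁ = Δ₂` this is the
statement that the co-Jacobi identity is the Jacobi identity. -/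
lemma coleibniz_iff (h₁ : IsDualProduct ℬ ω Δ₁ N₁) (h₂ : IsDualProduct ℬ ω Δ₂ N₂)
    (hΔ₁ : IsCompletedComul (tensorGrading A ℬ) Δ₁)
    (hΔ₂ : IsCompletedComul (tensorGrading A ℬ) Δ₂) (x : A ⊗[k] B) :
    idHatComul _ Δ₁ (Δ₂ x) = comulHatId _ Δ₂ (Δ₁ x) + tauHatId _ (idHatComul _ Δ₂ (Δ₁ x)) ↔
      ∀ s t u, SetLike.IsHomogeneousElem (tensorGrading (Module.Dual k A) ℬ) s →
        SetLike.IsHomogeneousElem (tensorGrading (Module.Dual k A) ℬ) t →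
        SetLike.IsHomogeneousElem (tensorGrading (Module.Dual k A) ℬ) u →
          tensorForm A ω (N₂ s (N₁ t u)) x =
            tensorForm A ω (N₁ (N₂ s t) u) x + tensorForm A ω (N₁ t (N₂ s u)) x := by
  obtain ⟨m, hm⟩ := hB.graded
  refine completedTensor₃_eq_iff_homogeneous hB hm
    (G := fun s t u => tensorForm A ω (N₁ (N₂ s t) u) x + tensorForm A ω (N₁ t (N₂ s u)) x)
    (fun _ _ _ s hs t ht u hu => tripleForm_idHatComul hm h₁ h₂ hΔ₁ hs ht hu x)
    (fun _ _ _ s hs t ht u hu => ?_)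
  rw [tripleForm_add, tripleForm_tauHatId, tripleForm_comulHatId hm h₂ h₁ hΔ₂ hs ht hu,
    tripleForm_idHatComul hm h₂ h₁ hΔ₂ ht hs hu]

lemma isCompletedComul_inducedDelta (ϑ : A →ₗ[k] A ⊗[k] A) :
    IsCompletedComul (tensorGrading A ℬ) (inducedDelta ℬ ϑ (nuOmega hB)) :=
  (isDualProduct_inducedDelta hB ϑ).isCompletedComul hB
    (isGradedProduct_inducedMul hB.perm.graded (dualMul ϑ))

lemma isCompletedComul_inducedCobracket (θ : A →ₗ[k] A ⊗[k] A) :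
    IsCompletedComul (tensorGrading A ℬ) (inducedCobracket ℬ θ (nuOmega hB)) :=
  (isDualProduct_inducedCobracket hB θ).isCompletedComul hB
    (isGradedProduct_inducedBracket hB.perm.graded (dualMul θ))

/-- The Poisson coalgebra `A ⊗ B` is dual to the Poisson algebra `A* ⊗ B`. -/
lemma isCompletedPoissonCoalgebra_induced {ϑ θ : A →ₗ[k] A ⊗[k] A}
    (hA : IsPrePoissonAlgebra (dualMul ϑ) (dualMul θ)) :
    IsCompletedPoissonCoalgebra (tensorGrading A ℬ) (inducedDelta ℬ ϑ (nuOmega hB))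
      (inducedCobracket ℬ θ (nuOmega hB)) where
  cocommCoassoc :=
    { comul := isCompletedComul_inducedDelta hB ϑ
      cocomm := fun x => tauHat_idAddTauHat _
      coassoc := fun x => (coassoc_iff hB (isDualProduct_inducedDelta hB ϑ)
        (isCompletedComul_inducedDelta hB ϑ) x).2 fun s t u _ _ _ => by
          rw [inducedMul_assoc hA.zinbiel hB.perm] }
  lie :=
    { comul := isCompletedComul_inducedCobracket hB θ
      coantisymm := fun x => tauHat_idSubTauHat _
      cojacobi := fun x => (sub_tauHatId_eq_iff _ _).2 <| (coleibniz_iff hB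
        (isDualProduct_inducedCobracket hB θ) (isDualProduct_inducedCobracket hB θ)
        (isCompletedComul_inducedCobracket hB θ) (isCompletedComul_inducedCobracket hB θ) x).2
          fun s t u _ _ _ => by
            rw [inducedBracket_leibniz hA.preLie hB.perm s t u, map_add, LinearMap.add_apply] }
  coleibniz x := (coleibniz_iff hB (isDualProduct_inducedDelta hB ϑ)
    (isDualProduct_inducedCobracket hB θ) (isCompletedComul_inducedDelta hB ϑ)
    (isCompletedComul_inducedCobracket hB θ) x).2 fun s t u _ _ _ => by
      rw [inducedBracket_mul hA hB.perm s t u, map_add, LinearMap.add_apply]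

/-- Testing the Poisson coalgebra `A ⊗ B` on a homogeneous unit-nil pair recovers the pre-Poisson
algebra `A*`. -/
lemma isPrePoissonAlgebra_dualMul_of_induced {ϑ θ : A →ₗ[k] A ⊗[k] A} {e n : B}
    (hen : IsUnitNilPair dia ω e n) (he : SetLike.IsHomogeneousElem ℬ e)
    (hn : SetLike.IsHomogeneousElem ℬ n)
    (H : IsCompletedPoissonCoalgebra (tensorGrading A ℬ) (inducedDelta ℬ ϑ (nuOmega hB))
      (inducedCobracket ℬ θ (nuOmega hB))) :
    IsPrePoissonAlgebra (dualMul ϑ) (dualMul θ) := by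
  have homog : ∀ {b : B}, SetLike.IsHomogeneousElem ℬ b → ∀ f : Module.Dual k A,
      SetLike.IsHomogeneousElem (tensorGrading (Module.Dual k A) ℬ) (f ⊗ₜ b) :=
    fun ⟨d, hb⟩ f => ⟨d, tmul_mem_tensorGrading _ hb f⟩
  let C : Module.Dual k A ⊗[k] B →ₗ[k] Module.Dual k A :=
    Module.Dual.transpose ((TensorProduct.mk k A B).flip e) ∘ₗ tensorForm A ω
  refine isPrePoissonAlgebra_of_unitNilPair hen C (fun f => LinearMap.ext fun a => ?_)
    (fun f g h => LinearMap.ext fun a => ?_) (fun f g h => LinearMap.ext fun a => ?_)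
    (fun f g h p r hpr => LinearMap.ext fun a => ?_)
  · change f a * ω e n = f a
    rw [hen.form_unit_nil, mul_one]
  · exact (coassoc_iff hB (isDualProduct_inducedDelta hB ϑ) H.cocommCoassoc.comul (a ⊗ₜ e)).1
      (H.cocommCoassoc.coassoc _) _ _ _ (homog he f) (homog he g) (homog hn h)
  · exact (coleibniz_iff hB (isDualProduct_inducedCobracket hB θ)
      (isDualProduct_inducedCobracket hB θ) H.lie.comul H.lie.comul (a ⊗ₜ e)).1
        ((sub_tauHatId_eq_iff _ _).1 (H.lie.cojacobi _)) _ _ _ (homog he f) (homog he g)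
          (homog hn h)
  · have hp : SetLike.IsHomogeneousElem ℬ p ∧ SetLike.IsHomogeneousElem ℬ r := by
      rcases hpr with ⟨rfl, rfl⟩ | ⟨rfl, rfl⟩
      exacts [⟨he, hn⟩, ⟨hn, he⟩]
    exact (coleibniz_iff hB (isDualProduct_inducedDelta hB ϑ)
      (isDualProduct_inducedCobracket hB θ) H.cocommCoassoc.comul H.lie.comul (a ⊗ₜ e)).1
        (H.coleibniz _) _ _ _ (homog hp.1 f) (homog he g) (homog hp.2 h)

end Axioms

end InducedCoalgebra

/-! ### Transposed actions and the potential of four elements -/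

section Compat

variable {k : Type*} [Field k] {A : Type*} [AddCommGroup A] [Module k A]
variable {Γ : Type*} {B : Type*} [AddCommGroup B] [Module k B]

/-- The action of `A ⊗ B` on `A* ⊗ B` transposed to multiplication: it sends `a ⊗ b` and `f ⊗ y` to
`(f ∘ l(a)) ⊗ (b ⋄ y) + (f ∘ r(a)) ⊗ (b ⋄ y - y ⋄ b)`. -/
noncomputable def inducedMulTranspose (ast : A →ₗ[k] A →ₗ[k] A) (dia : B →ₗ[k] B →ₗ[k] B) :
    A ⊗[k] B →ₗ[k] Module.Dual k A ⊗[k] B →ₗ[k] Module.Dual k A ⊗[k] B :=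
  TensorProduct.map₂ (Module.Dual.transpose ∘ₗ ast) dia +
    TensorProduct.map₂ (Module.Dual.transpose ∘ₗ ast.flip) (dia - dia.flip)

/-- The action of `A ⊗ B` on `A* ⊗ B` transposed to the bracket: it sends `a ⊗ b` and `f ⊗ y` to
`(f ∘ l̂(a)) ⊗ (b ⋄ y) - (f ∘ r̂(a)) ⊗ (b ⋄ y - y ⋄ b)`. -/
noncomputable def inducedBracketTranspose (circ : A →ₗ[k] A →ₗ[k] A)
    (dia : B →ₗ[k] B →ₗ[k] B) :
    A ⊗[k] B →ₗ[k] Module.Dual k A ⊗[k] B →ₗ[k] Module.Dual k A ⊗[k] B :=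
  TensorProduct.map₂ (Module.Dual.transpose ∘ₗ circ) dia +
    TensorProduct.map₂ (Module.Dual.transpose ∘ₗ circ.flip) (dia.flip - dia)

lemma inducedMulTranspose_tmul (ast : A →ₗ[k] A →ₗ[k] A) (dia : B →ₗ[k] B →ₗ[k] B) (a : A) (b : B)
    (f : Module.Dual k A) (y : B) :
    inducedMulTranspose ast dia (a ⊗ₜ b) (f ⊗ₜ y) =
      (f ∘ₗ ast a) ⊗ₜ dia b y + (f ∘ₗ ast.flip a) ⊗ₜ (dia b y - dia y b) := rfl

lemma inducedBracketTranspose_tmul (circ : A →ₗ[k] A →ₗ[k] A) (dia : B →ₗ[k] B →ₗ[k] B) (a : A)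
    (b : B) (f : Module.Dual k A) (y : B) :
    inducedBracketTranspose circ dia (a ⊗ₜ b) (f ⊗ₜ y) =
      (f ∘ₗ circ a) ⊗ₜ dia b y + (f ∘ₗ circ.flip a) ⊗ₜ (dia y b - dia b y) := rfl

variable {ℬ : Γ → Submodule k B} {ω : B →ₗ[k] B →ₗ[k] k} {dia : B →ₗ[k] B →ₗ[k] B}
variable {Δ : A ⊗[k] B →ₗ[k] CompletedTensor (tensorGrading A ℬ) (tensorGrading A ℬ)}
variable {N : Module.Dual k A ⊗[k] B →ₗ[k] Module.Dual k A ⊗[k] B →ₗ[k] Module.Dual k A ⊗[k] B}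
variable [AddCommGroup Γ]

namespace IsQuadraticGradedPerm

variable (hB : IsQuadraticGradedPerm ℬ dia ω)
include hB

/-- Left multiplications are self-adjoint. -/
lemma form_mul_left (x y z : B) : ω (dia x y) z = ω y (dia x z) := by
  have h₁ := hB.invariant x y z
  have h₂ := hB.invariant x z y
  rw [map_sub] at h₁ h₂
  rw [hB.antisymm y]
  linear_combination h₁ + h₂

/-- The adjoint of right multiplication by `y` is `z ↦ y ⋄ z - z ⋄ y`. -/
lemma form_mul_right (x y z : B) : ω (dia x y) z = ω x (dia y z) - ω x (dia z y) := by
  rw [hB.invariant, map_sub]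

lemma form_cocycle (x y z : B) : ω x (dia z y) = ω x (dia y z) - ω y (dia x z) := by
  linear_combination hB.form_mul_right x y z - hB.form_mul_left x y z

/-- For four elements of a quadratic perm algebra the values `ω(xᵢ, xⱼ ⋄ x_k ⋄ x_l)` do not depend
on the order of `xⱼ` and `x_k`, and they are the differences `tᵢ - t_l` of four scalars, normalized
here by `t_v = 0`: the scalars of `p`, `q`, `u` are `c₁`, `c₂`, `c₃`. -/
lemma exists_potential (p q u v : B) : ∃ c₁ c₂ c₃ : k,
    (ω p (dia (dia q u) v) = c₁ ∧ ω p (dia (dia u q) v) = c₁ ∧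
      ω p (dia (dia q v) u) = c₁ - c₃ ∧ ω p (dia (dia v q) u) = c₁ - c₃ ∧
      ω p (dia (dia u v) q) = c₁ - c₂ ∧ ω p (dia (dia v u) q) = c₁ - c₂) ∧
    ω q (dia (dia p u) v) = c₂ ∧ ω q (dia (dia u p) v) = c₂ ∧
      ω q (dia (dia p v) u) = c₂ - c₃ ∧ ω q (dia (dia v p) u) = c₂ - c₃ ∧
      ω q (dia (dia u v) p) = c₂ - c₁ ∧ ω q (dia (dia v u) p) = c₂ - c₁ := by
  have hp := hB.perm.perm
  have ha := hB.perm.assoc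
  have key : ∀ x y z w, ω x (dia (dia y z) w) = ω x (dia (dia y w) z) + ω z (dia (dia x y) w) := by
    intro x y z w
    rw [← ha y z w, ← ha y w z, ← hB.form_mul_left, hB.form_cocycle, hB.form_mul_left, hp x y,
      ← hB.form_mul_left (dia y x) z w, hB.antisymm w]
    ring
  have h₁ := key p q u v
  have h₂ := key p u q v
  have h₃ := key q p u v
  have h₄ := key q u p v
  rw [hp u q] at h₂
  rw [hp q p] at h₃
  rw [hp u p] at h₄
  refine ⟨_, _, ω u (dia (dia p q) v), ⟨rfl, ?_, ?_, ?_, ?_, ?_⟩, rfl, ?_, ?_, ?_, ?_, ?_⟩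
  · rw [hp]
  · linear_combination -h₁
  · rw [hp v q]
    linear_combination -h₁
  · linear_combination -h₂
  · rw [hp v u]
    linear_combination -h₂
  · rw [hp]
  · linear_combination -h₃
  · rw [hp v p]
    linear_combination -h₃
  · linear_combination -h₄
  · rw [hp v u]
    linear_combination -h₄

end IsQuadraticGradedPerm

lemma tensorForm_inducedMul (hB : IsQuadraticGradedPerm ℬ dia ω) (ast : A →ₗ[k] A →ₗ[k] A)
    (s : Module.Dual k A ⊗[k] B) (x x' : A ⊗[k] B) :
    tensorForm A ω s (inducedMul ast dia x x') =
      tensorForm A ω (inducedMulTranspose ast dia x s) x' := by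
  induction s with
  | zero => simp
  | add s t hs ht => simp only [map_add, LinearMap.add_apply, hs, ht]
  | tmul f y =>
  induction x with
  | zero => simp
  | add x y hx hy => simp only [map_add, LinearMap.add_apply, hx, hy]
  | tmul a p =>
  induction x' with
  | zero => simp
  | add x y hx hy => simp only [map_add, hx, hy]
  | tmul b q =>
  simp only [inducedMul_tmul, inducedMulTranspose_tmul, map_add, LinearMap.add_apply,
    tensorForm_tmul, LinearMap.comp_apply, LinearMap.flip_apply, map_sub, hB.form_mul_left p q y,
    hB.form_mul_right q p y]

lemma tensorForm_inducedBracket (hB : IsQuadraticGradedPerm ℬ dia ω) (circ : A →ₗ[k] A →ₗ[k] A)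
    (s : Module.Dual k A ⊗[k] B) (x x' : A ⊗[k] B) :
    tensorForm A ω s (inducedBracket circ dia x x') =
      tensorForm A ω (inducedBracketTranspose circ dia x s) x' := by
  induction s with
  | zero => simp
  | add s t hs ht => simp only [map_add, LinearMap.add_apply, hs, ht]
  | tmul f y =>
  induction x with
  | zero => simp
  | add x y hx hy => simp only [map_add, LinearMap.add_apply, hx, hy]
  | tmul a p =>
  induction x' with
  | zero => simp
  | add x y hx hy => simp only [map_add, hx, hy]
  | tmul b q =>
  simp only [inducedBracket_tmul, inducedBracketTranspose_tmul, map_add, LinearMap.add_apply,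
    tensorForm_tmul, LinearMap.comp_apply, LinearMap.flip_apply, map_sub, hB.form_mul_left p q y,
    hB.form_mul_right q p y]
  ring

variable [DecidableEq Γ] [DirectSum.Decomposition ℬ] {m : Γ}

/-- An identity in `(A ⊗ B) ⊗̂ (A ⊗ B)` may be tested on pure tensors in `A* ⊗ B` with homogeneous
second factor. -/
lemma completedTensor_eq_iff_homogeneous [FiniteDimensional k A]
    (hB : IsQuadraticGradedPerm ℬ dia ω)
    (hm : ∀ i j, i + j + m ≠ 0 → ∀ x ∈ ℬ i, ∀ y ∈ ℬ j, ω x y = 0)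
    {X Y : CompletedTensor (tensorGrading A ℬ) (tensorGrading A ℬ)}
    {F G : Module.Dual k A ⊗[k] B → Module.Dual k A ⊗[k] B → k}
    (hF : ∀ i j s t, IsSupportedAt (tensorGrading A ℬ) i (tensorForm A ω s) →
      IsSupportedAt (tensorGrading A ℬ) j (tensorForm A ω t) →
        pairHat _ X (tensorForm A ω s) (tensorForm A ω t) = -F s t)
    (hG : ∀ i j s t, IsSupportedAt (tensorGrading A ℬ) i (tensorForm A ω s) →
      IsSupportedAt (tensorGrading A ℬ) j (tensorForm A ω t) →
        pairHat _ Y (tensorForm A ω s) (tensorForm A ω t) = -G s t) :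
    X = Y ↔ ∀ (f g : Module.Dual k A) (u v : B), SetLike.IsHomogeneousElem ℬ u →
      SetLike.IsHomogeneousElem ℬ v → F (f ⊗ₜ u) (g ⊗ₜ v) = G (f ⊗ₜ u) (g ⊗ₜ v) := by
  have hc := fun s => isContinuousFunctional_tensorForm (A := A) hm s
  constructor
  · rintro rfl f g u v ⟨d, hu⟩ ⟨d', hv⟩
    have hs := isSupportedAt_tensorForm hm (i := -m - d) (by abel) (tmul_mem_tensorGrading _ hu f)
    have ht := isSupportedAt_tensorForm hm (i := -m - d') (by abel) (tmul_mem_tensorGrading _ hv g)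
    exact neg_injective ((hF _ _ _ _ hs ht).symm.trans (hG _ _ _ _ hs ht))
  · refine fun h => funext fun i => funext fun j =>
      (completedTensor_eq_iff hB hm i j).2 fun s hs t ht => ?_
    refine tensorGrading_induction (motive := fun s =>
      pairHat _ X (tensorForm A ω s) (tensorForm A ω t) =
        pairHat _ Y (tensorForm A ω s) (tensorForm A ω t)) (by simp) (fun f u hu => ?_)
      (fun s s' h h' => ?_) hs
    · refine tensorGrading_induction (motive := fun t =>
        pairHat _ X (tensorForm A ω (f ⊗ₜ u)) (tensorForm A ω t) =
          pairHat _ Y (tensorForm A ω (f ⊗ₜ u)) (tensorForm A ω t)) (by simp) (fun g v hv => ?_)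
        (fun t t' h h' => ?_) ht
      · have hs := isSupportedAt_tensorForm hm (i := i) rfl (tmul_mem_tensorGrading _ hu f)
        have ht := isSupportedAt_tensorForm hm (i := j) rfl (tmul_mem_tensorGrading _ hv g)
        rw [hF _ _ _ _ hs ht, hG _ _ _ _ hs ht, h f g u v ⟨_, hu⟩ ⟨_, hv⟩]
      · rw [map_add, pairHat_add_right _ (hc _) (hc t) (hc t'), h, h',
          pairHat_add_right _ (hc _) (hc t) (hc t')]
    · rw [map_add, pairHat_add_left _ (hc s) (hc s') (hc t), h, h',
        pairHat_add_left _ (hc s) (hc s') (hc t)]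

section Transpose

variable {mul : A ⊗[k] B →ₗ[k] A ⊗[k] B →ₗ[k] A ⊗[k] B}
  {mulTr : A ⊗[k] B →ₗ[k] Module.Dual k A ⊗[k] B →ₗ[k] Module.Dual k A ⊗[k] B}

lemma IsDualProduct.pairHat_leftOp (hΔ : IsDualProduct ℬ ω Δ N)
    (hmul : IsGradedProduct (tensorGrading A ℬ) mul)
    (htr : ∀ s x x', tensorForm A ω s (mul x x') = tensorForm A ω (mulTr x s) x')
    (x y : A ⊗[k] B) {i j : Γ} {s t : Module.Dual k A ⊗[k] B}
    (hs : IsSupportedAt (tensorGrading A ℬ) i (tensorForm A ω s))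
    (ht : IsSupportedAt (tensorGrading A ℬ) j (tensorForm A ω t)) :
    pairHat _ (leftOp _ (mul x) (Δ y)) (tensorForm A ω s) (tensorForm A ω t) =
      -tensorForm A ω (N (mulTr x s) t) y := by
  rw [PrePoissonAffinization.pairHat_leftOp hmul x _ hs ht, ← hΔ]
  exact congrArg (fun φ => pairHat _ (Δ y) φ _) (LinearMap.ext fun x' => htr s x x')

lemma IsDualProduct.pairHat_rightOp (hΔ : IsDualProduct ℬ ω Δ N)
    (hmul : IsGradedProduct (tensorGrading A ℬ) mul)
    (htr : ∀ s x x', tensorForm A ω s (mul x x') = tensorForm A ω (mulTr x s) x')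
    (x y : A ⊗[k] B) {i j : Γ} {s t : Module.Dual k A ⊗[k] B}
    (hs : IsSupportedAt (tensorGrading A ℬ) i (tensorForm A ω s))
    (ht : IsSupportedAt (tensorGrading A ℬ) j (tensorForm A ω t)) :
    pairHat _ (rightOp _ (mul x) (Δ y)) (tensorForm A ω s) (tensorForm A ω t) =
      -tensorForm A ω (N s (mulTr x t)) y := by
  rw [PrePoissonAffinization.pairHat_rightOp hmul x _ hs ht, ← hΔ]
  exact congrArg (fun φ => pairHat _ (Δ y) _ φ) (LinearMap.ext fun x' => htr t x x')

end Transpose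

end Compat

/-! ### The compatibility conditions as scalar identities -/

section CompatIff

variable {k : Type*} [Field k] {A : Type*} [AddCommGroup A] [Module k A]
variable {Γ : Type*} [AddCommGroup Γ] {B : Type*} [AddCommGroup B] [Module k B]
variable {ℬ : Γ → Submodule k B} {dia : B →ₗ[k] B →ₗ[k] B}

section Conditions

variable (ω : B →ₗ[k] B →ₗ[k] k) (mul br : A ⊗[k] B →ₗ[k] A ⊗[k] B →ₗ[k] A ⊗[k] B)
  (mulTr brTr : A ⊗[k] B →ₗ[k] Module.Dual k A ⊗[k] B →ₗ[k] Module.Dual k A ⊗[k] B)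
  (N K : Module.Dual k A ⊗[k] B →ₗ[k] Module.Dual k A ⊗[k] B →ₗ[k] Module.Dual k A ⊗[k] B)

/-- The condition `Δ(x y) = (u(y) ⊗̂ id) Δ(x) + (id ⊗̂ u(x)) Δ(y)`, evaluated at `s ⊗ t` for `s`,
`t` in `A* ⊗ B`. Here `N` is the product dual to `Δ`, and `mulTr` is transposed to `mul`. -/
def DeltaMulAt (x y : A ⊗[k] B) (s t : Module.Dual k A ⊗[k] B) : Prop :=
  tensorForm A ω (N s t) (mul x y) =
    tensorForm A ω (N (mulTr y s) t) x + tensorForm A ω (N s (mulTr x t)) y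

/-- The condition that `δ` is a one-cocycle for the bracket, evaluated at `s ⊗ t`. Here `K` is the
product dual to `δ`, and `brTr` is transposed to `br`. -/
def CobracketBracketAt (x y : A ⊗[k] B) (s t : Module.Dual k A ⊗[k] B) : Prop :=
  tensorForm A ω (K s t) (br x y) =
    tensorForm A ω (K (brTr x s) t) y + tensorForm A ω (K s (brTr x t)) y
      - tensorForm A ω (K (brTr y s) t) x - tensorForm A ω (K s (brTr y t)) x

/-- The condition on `Δ([x, y])` in a Poisson bialgebra, evaluated at `s ⊗ t`. -/
def DeltaBracketAt (x y : A ⊗[k] B) (s t : Module.Dual k A ⊗[k] B) : Prop :=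
  tensorForm A ω (N s t) (br x y) =
    tensorForm A ω (N (brTr x s) t) y + tensorForm A ω (N s (brTr x t)) y
      + tensorForm A ω (K (mulTr y s) t) x - tensorForm A ω (K s (mulTr y t)) x

/-- The condition on `δ(x y)` in a Poisson bialgebra, evaluated at `s ⊗ t`. -/
def CobracketMulAt (x y : A ⊗[k] B) (s t : Module.Dual k A ⊗[k] B) : Prop :=
  tensorForm A ω (K s t) (mul x y) =
    tensorForm A ω (K (mulTr x s) t) y + tensorForm A ω (K (mulTr y s) t) x
      + tensorForm A ω (N s (brTr x t)) y + tensorForm A ω (N s (brTr y t)) x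

end Conditions

variable {ω : B →ₗ[k] B →ₗ[k] k}

section Scalar

variable {ast circ : A →ₗ[k] A →ₗ[k] A}
  {F G : Module.Dual k A →ₗ[k] Module.Dual k A →ₗ[k] Module.Dual k A}

/-- On pure tensors each of the four conditions is an identity with coefficients
`ω(xᵢ, xⱼ ⋄ x_k ⋄ x_l)`, where the `xᵢ` are the four factors in `B`. After inserting the potential
of these values, the coefficients at the three free scalars are conditions of a pre-Poisson
bialgebra. -/
lemma IsDualCompat.inducedDelta_mul (hB : IsQuadraticGradedPerm ℬ dia ω)
    (H : IsDualCompat ast circ F G)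
    (x y : A ⊗[k] B) (f g : Module.Dual k A) (u v : B) :
    DeltaMulAt ω (inducedMul ast dia) (inducedMulTranspose ast dia) (inducedMul F dia) x y (f ⊗ₜ u)
      (g ⊗ₜ v) := by
  unfold DeltaMulAt
  induction x with
  | zero => simp
  | add x x' h h' =>
    simp only [map_add, LinearMap.add_apply, h, h']
    ring
  | tmul a p =>
  induction y with
  | zero => simp
  | add y y' h h' =>
    simp only [map_add, LinearMap.add_apply, h, h']
    ring
  | tmul b q =>
  obtain ⟨c₁, c₂, c₃, ⟨h₁, h₂, h₃, h₄, h₅, h₆⟩, h₇, h₈, h₉, h₁₀, h₁₁, h₁₂⟩ :=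
    hB.exists_potential p q u v
  simp only [inducedMul_tmul, inducedMulTranspose_tmul, map_add, map_sub, LinearMap.add_apply,
    LinearMap.sub_apply, tensorForm_tmul, hB.form_mul_left _ _ (dia _ _), hB.perm.assoc, h₁,
    h₂, h₃, h₄, h₆, h₇, h₈, h₉, h₁₀, h₁₁]
  linear_combination c₂ * H.zinbiel₁ a b g f + c₁ * H.zinbiel₁ b a f g - c₃ * H.zinbiel₂ a b g f

lemma IsDualCompat.inducedCobracket_bracket (hB : IsQuadraticGradedPerm ℬ dia ω)
    (H : IsDualCompat ast circ F G)
    (x y : A ⊗[k] B) (f g : Module.Dual k A) (u v : B) :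
    CobracketBracketAt ω (inducedBracket circ dia) (inducedBracketTranspose circ dia)
      (inducedBracket G dia) x y (f ⊗ₜ u) (g ⊗ₜ v) := by
  unfold CobracketBracketAt
  induction x with
  | zero => simp
  | add x x' h h' =>
    simp only [map_add, LinearMap.add_apply, h, h']
    ring
  | tmul a p =>
  induction y with
  | zero => simp
  | add y y' h h' =>
    simp only [map_add, LinearMap.add_apply, h, h']
    ring
  | tmul b q =>
  obtain ⟨c₁, c₂, c₃, ⟨h₁, h₂, h₃, h₄, h₅, h₆⟩, h₇, h₈, h₉, h₁₀, h₁₁, h₁₂⟩ :=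
    hB.exists_potential p q u v
  simp only [inducedBracket_tmul, inducedBracketTranspose_tmul, map_add, map_sub,
    LinearMap.add_apply, LinearMap.sub_apply, tensorForm_tmul, hB.form_mul_left _ _ (dia _ _),
    hB.perm.assoc, h₁, h₂, h₃, h₄, h₅, h₆, h₇, h₈, h₉, h₁₀, h₁₁, h₁₂]
  linear_combination c₂ * H.preLie₁ a b f g - c₁ * H.preLie₁ b a f g + c₃ * H.preLie₂ a b g f

lemma IsDualCompat.inducedDelta_bracket (hB : IsQuadraticGradedPerm ℬ dia ω)
    (H : IsDualCompat ast circ F G)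
    (x y : A ⊗[k] B) (f g : Module.Dual k A) (u v : B) :
    DeltaBracketAt ω (inducedBracket circ dia) (inducedMulTranspose ast dia)
      (inducedBracketTranspose circ dia) (inducedMul F dia) (inducedBracket G dia) x y (f ⊗ₜ u)
      (g ⊗ₜ v) := by
  unfold DeltaBracketAt
  induction x with
  | zero => simp
  | add x x' h h' =>
    simp only [map_add, LinearMap.add_apply, h, h']
    ring
  | tmul a p =>
  induction y with
  | zero => simp
  | add y y' h h' =>
    simp only [map_add, LinearMap.add_apply, h, h']
    ring
  | tmul b q =>
  obtain ⟨c₁, c₂, c₃, ⟨h₁, h₂, h₃, h₄, h₅, h₆⟩, h₇, h₈, h₉, h₁₀, h₁₁, h₁₂⟩ :=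
    hB.exists_potential p q u v
  simp only [inducedMul_tmul, inducedBracket_tmul, inducedMulTranspose_tmul,
    inducedBracketTranspose_tmul, map_add, map_sub, LinearMap.add_apply, LinearMap.sub_apply,
    tensorForm_tmul, hB.form_mul_left _ _ (dia _ _), hB.perm.assoc, h₁, h₂, h₃, h₄, h₅, h₆,
    h₇, h₈, h₉, h₁₀, h₁₁, h₁₂]
  linear_combination c₂ * H.compat₃ a b f g - c₃ * H.compat₂ a b g f +
    c₁ * (H.compat₂ a b f g + H.compat₂ a b g f - H.compat₃ a b f g)

lemma IsDualCompat.inducedCobracket_mul (hB : IsQuadraticGradedPerm ℬ dia ω)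
    (H : IsDualCompat ast circ F G)
    (x y : A ⊗[k] B) (f g : Module.Dual k A) (u v : B) :
    CobracketMulAt ω (inducedMul ast dia) (inducedMulTranspose ast dia)
      (inducedBracketTranspose circ dia) (inducedMul F dia) (inducedBracket G dia) x y (f ⊗ₜ u)
      (g ⊗ₜ v) := by
  unfold CobracketMulAt
  induction x with
  | zero => simp
  | add x x' h h' =>
    simp only [map_add, LinearMap.add_apply, h, h']
    ring
  | tmul a p =>
  induction y with
  | zero => simp
  | add y y' h h' =>
    simp only [map_add, LinearMap.add_apply, h, h']
    ring
  | tmul b q =>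
  obtain ⟨c₁, c₂, c₃, ⟨h₁, h₂, h₃, h₄, h₅, h₆⟩, h₇, h₈, h₉, h₁₀, h₁₁, h₁₂⟩ :=
    hB.exists_potential p q u v
  simp only [inducedMul_tmul, inducedBracket_tmul, inducedMulTranspose_tmul,
    inducedBracketTranspose_tmul, map_add, map_sub, LinearMap.add_apply, LinearMap.sub_apply,
    tensorForm_tmul, hB.form_mul_left _ _ (dia _ _), hB.perm.assoc, h₁, h₂, h₃, h₄, h₅, h₆,
    h₇, h₈, h₉, h₁₀, h₁₁, h₁₂]
  linear_combination -(c₂ * H.compat₄ a b g f) - c₁ * H.compat₄ b a g f + c₃ * H.compat₁ a b g f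

end Scalar

section Iff

variable [DecidableEq Γ] [DirectSum.Decomposition ℬ] [FiniteDimensional k A]
variable (hB : IsQuadraticGradedPerm ℬ dia ω) (ast circ : A →ₗ[k] A →ₗ[k] A)
  (ϑ θ : A →ₗ[k] A ⊗[k] A) (x y : A ⊗[k] B)

lemma inducedDelta_mul_iff :
    inducedDelta ℬ ϑ (nuOmega hB) (inducedMul ast dia x y) =
      leftOp _ (inducedMul ast dia y) (inducedDelta ℬ ϑ (nuOmega hB) x) +
        rightOp _ (inducedMul ast dia x) (inducedDelta ℬ ϑ (nuOmega hB) y) ↔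
    ∀ (f g : Module.Dual k A) (u v : B), SetLike.IsHomogeneousElem ℬ u →
      SetLike.IsHomogeneousElem ℬ v →
        DeltaMulAt ω (inducedMul ast dia) (inducedMulTranspose ast dia) (inducedMul (dualMul ϑ) dia)
          x y (f ⊗ₜ u) (g ⊗ₜ v) := by
  obtain ⟨m, hm⟩ := hB.graded
  have hc := fun s => isContinuousFunctional_tensorForm (A := A) hm s
  have hΔ := isDualProduct_inducedDelta hB ϑ
  have hM := isGradedProduct_inducedMul (A := A) hB.perm.graded ast
  refine completedTensor_eq_iff_homogeneous hB hm
    (F := fun s t => tensorForm A ω (inducedMul (dualMul ϑ) dia s t) (inducedMul ast dia x y))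
    (G := fun s t =>
      tensorForm A ω (inducedMul (dualMul ϑ) dia (inducedMulTranspose ast dia y s) t) x
      + tensorForm A ω (inducedMul (dualMul ϑ) dia s (inducedMulTranspose ast dia x t)) y)
    (fun _ _ s t _ _ => hΔ _ s t) (fun i j s t hs ht => ?_)
  simp only [pairHat_add _ _ (hc s) (hc t),
    hΔ.pairHat_leftOp hM (tensorForm_inducedMul hB ast) y x hs ht,
    hΔ.pairHat_rightOp hM (tensorForm_inducedMul hB ast) x y hs ht]
  ring

lemma inducedCobracket_bracket_iff :
    inducedCobracket ℬ θ (nuOmega hB) (inducedBracket circ dia x y) =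
      (leftOp _ (inducedBracket circ dia x) (inducedCobracket ℬ θ (nuOmega hB) y) +
        rightOp _ (inducedBracket circ dia x) (inducedCobracket ℬ θ (nuOmega hB) y)) -
      (leftOp _ (inducedBracket circ dia y) (inducedCobracket ℬ θ (nuOmega hB) x) +
        rightOp _ (inducedBracket circ dia y) (inducedCobracket ℬ θ (nuOmega hB) x)) ↔
    ∀ (f g : Module.Dual k A) (u v : B), SetLike.IsHomogeneousElem ℬ u →
      SetLike.IsHomogeneousElem ℬ v →
        CobracketBracketAt ω (inducedBracket circ dia) (inducedBracketTranspose circ dia)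
          (inducedBracket (dualMul θ) dia) x y (f ⊗ₜ u) (g ⊗ₜ v) := by
  obtain ⟨m, hm⟩ := hB.graded
  have hc := fun s => isContinuousFunctional_tensorForm (A := A) hm s
  have hδ := isDualProduct_inducedCobracket hB θ
  have hK := isGradedProduct_inducedBracket (A := A) hB.perm.graded circ
  refine completedTensor_eq_iff_homogeneous hB hm
    (F := fun s t =>
      tensorForm A ω (inducedBracket (dualMul θ) dia s t) (inducedBracket circ dia x y))
    (G := fun s t =>
      tensorForm A ω (inducedBracket (dualMul θ) dia (inducedBracketTranspose circ dia x s) t) y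
      + tensorForm A ω (inducedBracket (dualMul θ) dia s (inducedBracketTranspose circ dia x t)) y
      - tensorForm A ω (inducedBracket (dualMul θ) dia (inducedBracketTranspose circ dia y s) t) x
      - tensorForm A ω (inducedBracket (dualMul θ) dia s (inducedBracketTranspose circ dia y t)) x)
    (fun _ _ s t _ _ => hδ _ s t) (fun i j s t hs ht => ?_)
  simp only [pairHat_add _ _ (hc s) (hc t), pairHat_sub _ _ (hc s) (hc t),
    hδ.pairHat_leftOp hK (tensorForm_inducedBracket hB circ) x y hs ht,
    hδ.pairHat_rightOp hK (tensorForm_inducedBracket hB circ) x y hs ht,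
    hδ.pairHat_leftOp hK (tensorForm_inducedBracket hB circ) y x hs ht,
    hδ.pairHat_rightOp hK (tensorForm_inducedBracket hB circ) y x hs ht]
  ring

lemma inducedDelta_bracket_iff :
    inducedDelta ℬ ϑ (nuOmega hB) (inducedBracket circ dia x y) =
      (leftOp _ (inducedBracket circ dia x) (inducedDelta ℬ ϑ (nuOmega hB) y) +
        rightOp _ (inducedBracket circ dia x) (inducedDelta ℬ ϑ (nuOmega hB) y)) +
      (leftOp _ (inducedMul ast dia y) (inducedCobracket ℬ θ (nuOmega hB) x) -
        rightOp _ (inducedMul ast dia y) (inducedCobracket ℬ θ (nuOmega hB) x)) ↔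
    ∀ (f g : Module.Dual k A) (u v : B), SetLike.IsHomogeneousElem ℬ u →
      SetLike.IsHomogeneousElem ℬ v →
        DeltaBracketAt ω (inducedBracket circ dia) (inducedMulTranspose ast dia)
          (inducedBracketTranspose circ dia) (inducedMul (dualMul ϑ) dia)
          (inducedBracket (dualMul θ) dia) x y (f ⊗ₜ u) (g ⊗ₜ v) := by
  obtain ⟨m, hm⟩ := hB.graded
  have hc := fun s => isContinuousFunctional_tensorForm (A := A) hm s
  have hΔ := isDualProduct_inducedDelta hB ϑ
  have hδ := isDualProduct_inducedCobracket hB θ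
  have hM := isGradedProduct_inducedMul (A := A) hB.perm.graded ast
  have hK := isGradedProduct_inducedBracket (A := A) hB.perm.graded circ
  refine completedTensor_eq_iff_homogeneous hB hm
    (F := fun s t =>
      tensorForm A ω (inducedMul (dualMul ϑ) dia s t) (inducedBracket circ dia x y))
    (G := fun s t =>
      tensorForm A ω (inducedMul (dualMul ϑ) dia (inducedBracketTranspose circ dia x s) t) y
      + tensorForm A ω (inducedMul (dualMul ϑ) dia s (inducedBracketTranspose circ dia x t)) y
      + tensorForm A ω (inducedBracket (dualMul θ) dia (inducedMulTranspose ast dia y s) t) x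
      - tensorForm A ω (inducedBracket (dualMul θ) dia s (inducedMulTranspose ast dia y t)) x)
    (fun _ _ s t _ _ => hΔ _ s t) (fun i j s t hs ht => ?_)
  simp only [pairHat_add _ _ (hc s) (hc t), pairHat_sub _ _ (hc s) (hc t),
    hΔ.pairHat_leftOp hK (tensorForm_inducedBracket hB circ) x y hs ht,
    hΔ.pairHat_rightOp hK (tensorForm_inducedBracket hB circ) x y hs ht,
    hδ.pairHat_leftOp hM (tensorForm_inducedMul hB ast) y x hs ht,
    hδ.pairHat_rightOp hM (tensorForm_inducedMul hB ast) y x hs ht]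
  ring

lemma inducedCobracket_mul_iff :
    inducedCobracket ℬ θ (nuOmega hB) (inducedMul ast dia x y) =
      leftOp _ (inducedMul ast dia x) (inducedCobracket ℬ θ (nuOmega hB) y) +
        leftOp _ (inducedMul ast dia y) (inducedCobracket ℬ θ (nuOmega hB) x) +
        rightOp _ (inducedBracket circ dia x) (inducedDelta ℬ ϑ (nuOmega hB) y) +
        rightOp _ (inducedBracket circ dia y) (inducedDelta ℬ ϑ (nuOmega hB) x) ↔
    ∀ (f g : Module.Dual k A) (u v : B), SetLike.IsHomogeneousElem ℬ u →
      SetLike.IsHomogeneousElem ℬ v →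
        CobracketMulAt ω (inducedMul ast dia) (inducedMulTranspose ast dia)
          (inducedBracketTranspose circ dia) (inducedMul (dualMul ϑ) dia)
          (inducedBracket (dualMul θ) dia) x y (f ⊗ₜ u) (g ⊗ₜ v) := by
  obtain ⟨m, hm⟩ := hB.graded
  have hc := fun s => isContinuousFunctional_tensorForm (A := A) hm s
  have hΔ := isDualProduct_inducedDelta hB ϑ
  have hδ := isDualProduct_inducedCobracket hB θ
  have hM := isGradedProduct_inducedMul (A := A) hB.perm.graded ast
  have hK := isGradedProduct_inducedBracket (A := A) hB.perm.graded circ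
  refine completedTensor_eq_iff_homogeneous hB hm
    (F := fun s t => tensorForm A ω (inducedBracket (dualMul θ) dia s t) (inducedMul ast dia x y))
    (G := fun s t =>
      tensorForm A ω (inducedBracket (dualMul θ) dia (inducedMulTranspose ast dia x s) t) y
      + tensorForm A ω (inducedBracket (dualMul θ) dia (inducedMulTranspose ast dia y s) t) x
      + tensorForm A ω (inducedMul (dualMul ϑ) dia s (inducedBracketTranspose circ dia x t)) y
      + tensorForm A ω (inducedMul (dualMul ϑ) dia s (inducedBracketTranspose circ dia y t)) x)
    (fun _ _ s t _ _ => hδ _ s t) (fun i j s t hs ht => ?_)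
  simp only [pairHat_add _ _ (hc s) (hc t),
    hδ.pairHat_leftOp hM (tensorForm_inducedMul hB ast) x y hs ht,
    hδ.pairHat_leftOp hM (tensorForm_inducedMul hB ast) y x hs ht,
    hΔ.pairHat_rightOp hK (tensorForm_inducedBracket hB circ) x y hs ht,
    hΔ.pairHat_rightOp hK (tensorForm_inducedBracket hB circ) y x hs ht]
  ring

end Iff

end CompatIff

/-! ### Transfer of the bialgebra conditions -/

section Transfer

variable {k : Type*} [Field k] {A : Type*} [AddCommGroup A] [Module k A] [FiniteDimensional k A]
variable {Γ : Type*} [AddCommGroup Γ] [DecidableEq Γ] {B : Type*} [AddCommGroup B] [Module k B]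
variable {ℬ : Γ → Submodule k B} [DirectSum.Decomposition ℬ] {ω : B →ₗ[k] B →ₗ[k] k}
  {dia : B →ₗ[k] B →ₗ[k] B} {ast circ : A →ₗ[k] A →ₗ[k] A} {ϑ θ : A →ₗ[k] A ⊗[k] A}

/-- The potential of `IsQuadraticGradedPerm.exists_potential` for three copies of `e` and one
copy of `n` is concentrated at `n`. Hence placing `n` among the four arguments of a compatibility
condition isolates one of its coefficients. -/
lemma isDualCompat_of_induced (hB : IsQuadraticGradedPerm ℬ dia ω) {e n : B}
    (hen : IsUnitNilPair dia ω e n) (he : SetLike.IsHomogeneousElem ℬ e)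
    (hn : SetLike.IsHomogeneousElem ℬ n)
    (H : InducedIsCompletedPoissonBialgebra ast circ ϑ θ hB) :
    IsDualCompat ast circ (dualMul ϑ) (dualMul θ) := by
  have h₁ := fun (a b : A) (f g : Module.Dual k A) (q u : B) hu =>
    (inducedDelta_mul_iff hB ast ϑ (a ⊗ₜ e) (b ⊗ₜ q)).1 (H.infinitesimal.compat _ _) f g u e hu he
  have h₂ := fun (a b : A) (f g : Module.Dual k A) (q u : B) hu =>
    (inducedCobracket_bracket_iff hB circ θ (a ⊗ₜ e) (b ⊗ₜ q)).1 (H.lie.compat _ _) f g u e hu he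
  have h₃ := fun (a b : A) (f g : Module.Dual k A) (q u : B) hu =>
    (inducedDelta_bracket_iff hB ast circ ϑ θ (a ⊗ₜ e) (b ⊗ₜ q)).1 (H.compat₁ _ _) f g u e hu he
  have h₄ := fun (a b : A) (f g : Module.Dual k A) (q u : B) hu =>
    (inducedCobracket_mul_iff hB ast circ ϑ θ (a ⊗ₜ e) (b ⊗ₜ q)).1 (H.compat₂ _ _) f g u e hu he
  have h₁q := fun a b f g => h₁ a b f g n e he
  have h₁u := fun a b f g => h₁ a b f g e n hn
  have h₂q := fun a b f g => h₂ a b f g n e he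
  have h₂u := fun a b f g => h₂ a b f g e n hn
  have h₃q := fun a b f g => h₃ a b f g n e he
  have h₃u := fun a b f g => h₃ a b f g e n hn
  have h₄q := fun a b f g => h₄ a b f g n e he
  have h₄u := fun a b f g => h₄ a b f g e n hn
  clear h₁ h₂ h₃ h₄
  simp only [DeltaMulAt, CobracketBracketAt, DeltaBracketAt, CobracketMulAt, inducedMul_tmul,
    inducedBracket_tmul, inducedMulTranspose_tmul, inducedBracketTranspose_tmul, map_add,
    map_sub, LinearMap.add_apply, LinearMap.sub_apply, tensorForm_tmul, hen.unit_unit, hen.unit_nil,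
    hen.nil_unit, map_zero, LinearMap.zero_apply, hen.form_unit_nil, hen.form_nil_unit]
    at h₁q h₁u h₂q h₂u h₃q h₃u h₄q h₄u
  refine ⟨?_, ?_, ?_, ?_, ?_, ?_, ?_, ?_⟩ <;> intro a b f g
  · linear_combination -h₁q a b g f
  · linear_combination h₁u a b g f
  · linear_combination -h₂q a b f g
  · linear_combination -h₂u a b g f
  · linear_combination -h₄u a b g f
  · linear_combination h₃u a b g f
  · linear_combination -h₃q a b f g
  · linear_combination h₄q a b g f

/-- The affinization of a finite-dimensional pre-Poisson bialgebra by a quadratic graded perm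
algebra is a completed Poisson bialgebra. -/
lemma inducedIsCompletedPoissonBialgebra_of_isPrePoissonBialgebra
    (hB : IsQuadraticGradedPerm ℬ dia ω) (H : IsPrePoissonBialgebra ast circ ϑ θ) :
    InducedIsCompletedPoissonBialgebra ast circ ϑ θ hB := by
  obtain ⟨hA, hA', hc⟩ := (isPrePoissonBialgebra_iff_dual ast circ ϑ θ).1 H
  have halg := isGradedPoisson_induced hA hB.perm
  have hcoalg := isCompletedPoissonCoalgebra_induced hB hA'
  exact
    { algebra := halg
      coalgebra := hcoalg
      infinitesimal := ⟨halg.commAssoc, hcoalg.cocommCoassoc, fun x y =>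
        (inducedDelta_mul_iff hB ast ϑ x y).2 fun f g u v _ _ => hc.inducedDelta_mul hB x y f g u v⟩
      lie := ⟨halg.lie, hcoalg.lie, fun x y =>
        (inducedCobracket_bracket_iff hB circ θ x y).2 fun f g u v _ _ =>
          hc.inducedCobracket_bracket hB x y f g u v⟩
      compat₁ := fun x y => (inducedDelta_bracket_iff hB ast circ ϑ θ x y).2 fun f g u v _ _ =>
        hc.inducedDelta_bracket hB x y f g u v
      compat₂ := fun x y => (inducedCobracket_mul_iff hB ast circ ϑ θ x y).2 fun f g u v _ _ =>
        hc.inducedCobracket_mul hB x y f g u v }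

/-- If the quadratic perm algebra contains a homogeneous unit-nil pair, then only pre-Poisson
bialgebras induce completed Poisson bialgebras. -/
lemma isPrePoissonBialgebra_of_induced (hB : IsQuadraticGradedPerm ℬ dia ω) {e n : B}
    (hen : IsUnitNilPair dia ω e n) (he : SetLike.IsHomogeneousElem ℬ e)
    (hn : SetLike.IsHomogeneousElem ℬ n)
    (H : InducedIsCompletedPoissonBialgebra ast circ ϑ θ hB) :
    IsPrePoissonBialgebra ast circ ϑ θ := by
  refine (isPrePoissonBialgebra_iff_dual ast circ ϑ θ).2
    ⟨isPrePoissonAlgebra_of_unitNilPair hen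
      (TensorProduct.lift ((LinearMap.lsmul k A).flip.compl₂ (ω e))) (fun a => ?_)
      (fun a b c => ?_) (fun a b c => ?_) (fun a b c p r _ => ?_),
    isPrePoissonAlgebra_dualMul_of_induced hB hen he hn H.coalgebra,
    isDualCompat_of_induced hB hen he hn H⟩
  · simp [hen.form_unit_nil]
  · rw [H.algebra.commAssoc.assoc]
  · have hjac := H.algebra.lie.jacobi (a ⊗ₜ e) (b ⊗ₜ e) (c ⊗ₜ n)
    rw [inducedBracket_comm circ dia (c ⊗ₜ n) (a ⊗ₜ e), inducedBracket_comm circ dia (c ⊗ₜ n)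
      (inducedBracket circ dia _ _), map_neg] at hjac
    rw [← map_add]
    congr 1
    linear_combination (norm := module) hjac
  · rw [H.algebra.leibniz, map_add]

end Transfer

/-! ### The Laurent perm algebra -/

section LaurentPair

variable (k : Type*) [Field k]

/-- The vector field `x₁⁻¹ ∂₁`, a left unit. -/
noncomputable def laurentUnit : LaurentField k := monom k (-1, 0) 0 1

/-- The vector field `x₂ ∂₁ - x₁ ∂₂`, which annihilates `B` by left multiplication. -/
noncomputable def laurentNil : LaurentField k := monom k (0, 1) 0 1 - monom k (1, 0) 1 1

lemma laurentUnit_isHomogeneousElem :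
    SetLike.IsHomogeneousElem (laurentGrading k) (laurentUnit k) :=
  ⟨_, monom_mem_laurentGrading (-1, 0) 0 1⟩

lemma laurentNil_isHomogeneousElem :
    SetLike.IsHomogeneousElem (laurentGrading k) (laurentNil k) :=
  ⟨(1, 1), sub_mem (monom_mem_laurentGrading (0, 1) 0 1) (monom_mem_laurentGrading (1, 0) 1 1)⟩

lemma laurent_isUnitNilPair :
    IsUnitNilPair (laurentDia k) (laurentOmega k) (laurentUnit k) (laurentNil k) := by
  have he : ∀ f, laurentDia k (laurentUnit k) f = f := fun f => by
    funext t
    simp [laurentDia, laurentUnit, monom, expo, AddMonoidAlgebra.single_mul_single,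
      Prod.mk_zero_zero, ← AddMonoidAlgebra.one_def]
  have hn : ∀ f, laurentDia k (laurentNil k) f = 0 := fun f => by
    funext t
    simp [laurentDia, laurentNil, monom, expo, AddMonoidAlgebra.single_mul_single]
  refine ⟨he _, he _, hn _, ?_, ?_⟩ <;>
    simp [laurentOmega, laurentUnit, laurentNil, monom, AddMonoidAlgebra.single_mul_single,
      Prod.mk_zero_zero]

end LaurentPair

end PrePoissonAffinization

open PrePoissonAffinization

theorem mainTheorem1 {k : Type*} [Field k] [CharZero k]
    {A : Type*} [AddCommGroup A] [Module k A] [FiniteDimensional k A]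
    (ast circ : A →ₗ[k] A →ₗ[k] A) (ϑ θ : A →ₗ[k] A ⊗[k] A) :
    (IsPrePoissonBialgebra ast circ ϑ θ →
      ∀ {Γ : Type*} [AddCommGroup Γ] [DecidableEq Γ]
        {B : Type*} [AddCommGroup B] [Module k B]
        {ℬ : Γ → Submodule k B} [DirectSum.Decomposition ℬ]
        {dia : B →ₗ[k] B →ₗ[k] B} {ω : B →ₗ[k] B →ₗ[k] k}
        (hB : IsQuadraticGradedPerm ℬ dia ω),
        InducedIsCompletedPoissonBialgebra ast circ ϑ θ hB) ∧
    (InducedIsCompletedPoissonBialgebra ast circ ϑ θ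
        (laurent_isQuadraticGradedPerm (k := k)) ↔
      IsPrePoissonBialgebra ast circ ϑ θ) := by
  exact ⟨fun H => fun hB => inducedIsCompletedPoissonBialgebra_of_isPrePoissonBialgebra hB H,
    isPrePoissonBialgebra_of_induced _ (laurent_isUnitNilPair k) (laurentUnit_isHomogeneousElem k)
      (laurentNil_isHomogeneousElem k),
    inducedIsCompletedPoissonBialgebra_of_isPrePoissonBialgebra _⟩
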